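/- Let ${\rm SG}\subset\mathbb R^2$ be the Sierpinski gasket, i.e. the nonempty compact set with ${\rm SG}=\bigcup_{i=0}^2F_i({\rm SG})$, $F_i(p)=\frac12(p-p_i)+p_i$, where $V_0=\{p_0,p_1,p_2\}$ are the vertices of an equilateral triangle of side one. Let $\nu$ be its self-similar probability measure (mass $3^{-m}$ on each cell of level $m$), let $\mathcal E(u,v)=\lim_m(5/3)^m\mathcal E_m(u,v)$ be the standard energy, where $\mathcal E_m$ is the graph energy of the level-$m$ approximation, let $\mathcal F$ be the space of continuous functions of finite energy, and let $\Delta=\Delta_{\rm SG}$ be the Neumann Laplacian, so that $-\Delta\varphi=\lambda\varphi$ means $\varphi\in\mathcal F$ and $\mathcal E(\varphi,v)=\lambda\langle\varphi,v\rangle$ for all $v\in\mathcal F$. For $0<s\le1$ let $H^s=(I-\Delta)^{-s/2}L^2({\rm SG},\nu)$ with norm $\|u\|_{H^s}=\|(I-\Delta)^{s/2}u\|_{L^2}$. Consider $$i\partial_tu+\Delta u=\kappa|u|^{2k}u,\qquad u(0)=u_0,\qquad(\ast)$$ where a solution in $C([-T,T];H^s)$ is a curve $u$ with $|u|^{2k}u\in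 L^1([-T,T]\times{\rm SG})$ that satisfies Duhamel's formula $u(t)=e^{it\Delta}u_0-i\kappa\int_0^te^{i(t-\tau)\Delta}|u|^{2k}u(\tau)\,d\tau$ (on the coefficients with respect to the eigenfunctions of $\Delta$). Theorem. There are $c>0$ and real-valued eigenfunctions $\psi_j$, $j\ge2$, of $-\Delta$ with eigenvalue $c\,5^j$, with $\|\psi_j\|_{L^2}=1$, with support disjoint from $V_0$ and of measure comparable to $3^{-j}$ (with constants independent of $j$), such that the following holds for every $0<s<\sigma_\infty=d_S/2=\log3/\log5$, every integer $k\ge1$ and $\kappa=\pm1$. Equation $(\ast)$ is $C^{2k+1}$-ill-posed in $H^s$, in the following sense. (i) For all $T>0$ and $C\in\mathbb R$ and all sufficiently large $j$: for real $\gamma$ near $0$ there is a unique solution $u(\gamma)\in C([-T,T];H^1)$ of $(\ast)$ with data $\gamma\psi_j$, the map $\gamma\mapsto u(\gamma)\in C([-T,T];H^s)$ is of class $C^{2k+1}$ near $0$, and $$\big\|\partial_\gamma^{2k+1}u(\gamma,T)|_{\gamma=0}\big\|_{H^s}>C\,\|\psi_j\|_{H^s}^{2k+1}.$$ Thus no bound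 $\|\partial_\gamma^{2k+1}u(\gamma,t)|_{\gamma=0}\|_{H^s}\le C_T\|u_0\|_{H^s}^{2k+1}$, $t\in[-T,T]$, holds for the solutions with data $\gamma u_0$. (ii) There are no $T,r>0$ and no class $X\subset C([-T,T];H^s)$, containing the solutions that lie in $C([-T,T];H^1)$ and have data of $H^s$-norm less than $r$, such that $(\ast)$ has exactly one solution in $X$ for all data $u_0$ with $\|u_0\|_{H^s}<r$ and the solution map, from $H^s$ to $C([-T,T];H^s)$, is of class $C^{2k+1}$ near $0$. (iii) The flow map cannot be extended from $H^1$ to $H^s$ as a $C^{2k+1}$ map near the origin: for no $T>0$ is there a map $\Phi:H^s\to C([-T,T];H^s)$, of class $C^{2k+1}$ near $0$, such that for some $\delta>0$ and all $u_0\in H^1$ with $\|u_0\|_{H^1}<\delta$ every solution in $C([-T,T];H^1)$ with data $u_0$ equals $\Phi(u_0)$. In particular the threshold $\sigma_\infty$ does not depend on $k$. -/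

import Mathlib

open MeasureTheory

noncomputable section

namespace SierpinskiNLS

/-! ### The Sierpinski gasket and its self-similar measure -/

/-- The Euclidean plane. -/
abbrev Plane : Type := EuclideanSpace ℝ (Fin 2)

/-- The vertices `p₀, p₁, p₂` of an equilateral triangle of side length one. -/
def vertex : Fin 3 → Plane :=
  ![!₂[0, 0], !₂[1, 0], !₂[1 / 2, Real.sqrt 3 / 2]]

/-- The contractions `F_i(p) = (p - p_i) / 2 + p_i`. -/
def contraction (i : Fin 3) (p : Plane) : Plane :=
  (1 / 2 : ℝ) • (p - vertex i) + vertex i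

/-- The point with address `ω`, that is, the only point of
`⋂ m, F_{ω 0} ∘ ⋯ ∘ F_{ω (m - 1)} (triangle)`. -/
def address (ω : ℕ → Fin 3) : Plane :=
  ∑' n, (1 / 2 : ℝ) ^ (n + 1) • vertex (ω n)

/-- The Sierpinski gasket. By `isCompact_gasket`, `nonempty_gasket` and `gasket_eq` below, it is the
nonempty compact set `K` with `K = F₀ K ∪ F₁ K ∪ F₂ K` (which is unique by Banach's fixed point
theorem). -/
def gasket : Set Plane := Set.range address

theorem norm_term_le (ω : ℕ → Fin 3) (n : ℕ) :
    ‖(1 / 2 : ℝ) ^ (n + 1) • vertex (ω n)‖ ≤ (∑ i, ‖vertex i‖) * (1 / 2 : ℝ) ^ n := by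
  rw [norm_smul, Real.norm_eq_abs, abs_of_pos (by positivity), mul_comm]
  have h : ‖vertex (ω n)‖ ≤ ∑ i, ‖vertex i‖ :=
    Finset.single_le_sum (f := fun i => ‖vertex i‖) (fun _ _ => norm_nonneg _) (Finset.mem_univ _)
  refine mul_le_mul h ?_ (by positivity) (by positivity)
  exact pow_le_pow_of_le_one (by norm_num) (by norm_num) (Nat.le_succ n)

theorem summable_bound :
    Summable fun n : ℕ => (∑ i, ‖vertex i‖) * (1 / 2 : ℝ) ^ n :=
  (summable_geometric_of_lt_one (by norm_num) (by norm_num)).mul_left _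

theorem continuous_address : Continuous address :=
  continuous_tsum (fun n => ((continuous_of_discreteTopology (f := vertex)).comp
    (continuous_apply n)).const_smul ((1 / 2 : ℝ) ^ (n + 1)))
    summable_bound (fun n ω => norm_term_le ω n)

theorem isCompact_gasket : IsCompact gasket := isCompact_range continuous_address

theorem nonempty_gasket : gasket.Nonempty := Set.range_nonempty _

/-- The address `i ω₀ ω₁ …`. -/
def consAddress (i : Fin 3) (ω : ℕ → Fin 3) : ℕ → Fin 3
  | 0 => i
  | n + 1 => ω n

theorem contraction_address (i : Fin 3) (ω : ℕ → Fin 3) :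
    contraction i (address ω) = address (consAddress i ω) := by
  have hs : ∀ ω : ℕ → Fin 3, Summable fun n => (1 / 2 : ℝ) ^ (n + 1) • vertex (ω n) := fun ω =>
    Summable.of_norm_bounded summable_bound (norm_term_le ω)
  have h1 : address (consAddress i ω) = (1 / 2 : ℝ) • vertex i + (1 / 2 : ℝ) • address ω := by
    unfold address
    rw [(hs _).tsum_eq_zero_add, ← (hs ω).tsum_const_smul]
    congr 1
    · simp [consAddress]
    · refine tsum_congr fun n => ?_
      rw [smul_smul, ← pow_succ']
      rfl
  rw [h1, contraction]
  module

theorem address_const (i : Fin 3) : address (fun _ => i) = vertex i := by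
  have h : consAddress i (fun _ => i) = fun _ => i := by
    funext n
    cases n <;> rfl
  have h2 := contraction_address i (fun _ => i)
  rw [h, contraction] at h2
  have h3 : address (fun _ => i) - vertex i = (1 / 2 : ℝ) • (address (fun _ => i) - vertex i) :=
    sub_eq_of_eq_add h2.symm
  have h4 : (1 / 2 : ℝ) • (address (fun _ => i) - vertex i) = 0 := by
    nth_rewrite 1 [← sub_eq_zero] at h3
    rw [← h3]
    module
  exact sub_eq_zero.mp ((smul_eq_zero.mp h4).resolve_left (by norm_num))

theorem gasket_eq : gasket = ⋃ i, contraction i '' gasket := by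
  ext x
  simp only [Set.mem_iUnion, Set.mem_image]
  constructor
  · rintro ⟨ω, rfl⟩
    refine ⟨ω 0, _, ⟨fun n => ω (n + 1), rfl⟩, ?_⟩
    rw [contraction_address]
    congr 1
    funext n
    cases n <;> rfl
  · rintro ⟨i, _, ⟨ω, rfl⟩, rfl⟩
    exact ⟨_, (contraction_address i ω).symm⟩

/-- The gasket as a space. -/
abbrev SG : Type := gasket

/-- The boundary points `p_i`, as points of the gasket; `V₀ = {p₀, p₁, p₂}`. -/
def corner (i : Fin 3) : SG := ⟨vertex i, ⟨_, address_const i⟩⟩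

/-- The contraction `F_i` as a map of the gasket into itself. -/
def cellMap (i : Fin 3) (x : SG) : SG :=
  ⟨contraction i x, gasket_eq.superset (Set.mem_iUnion.mpr ⟨i, Set.mem_image_of_mem _ x.2⟩)⟩

/-- The self-similar Bernoulli measure on the gasket, which gives mass `3⁻ᵐ` to each cell
`F_{w₁} ∘ ⋯ ∘ F_{w_m} (SG)`: the law of a point whose address consists of independent digits, each
uniformly distributed on `{0, 1, 2}`. -/
def sgMeasure : Measure SG :=
  (Measure.infinitePi fun _ : ℕ => (PMF.uniformOfFintype (Fin 3)).toMeasure).map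
    (Set.rangeFactorization address)

/-! ### The energy form and the Neumann Laplacian -/

/-- The (sesquilinear) graph energy of level `m`, the sum over all edges `{p, q}` of the graph with
vertex set `V_m` of `(u p - u q) * conj (v p - v q)`. The level `0` graph is the triangle `V₀`, and
the level `m + 1` graph consists of three copies, under `F₀, F₁, F₂`, of the level `m` graph, which
have no edge in common. -/
def graphEnergy : ℕ → (SG → ℂ) → (SG → ℂ) → ℂ
  | 0, u, v => (1 / 2) * ∑ i, ∑ j,
      (u (corner i) - u (corner j)) * starRingEnd ℂ (v (corner i) - v (corner j))
  | m + 1, u, v => ∑ i, graphEnergy m (u ∘ cellMap i) (v ∘ cellMap i)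

/-- The domain `ℱ` of the energy form: continuous functions of finite energy. The renormalized graph
energies `(5/3)ᵐ ℰ_m(u, u)` are nondecreasing in `m`. -/
def FiniteEnergy (u : SG → ℂ) : Prop :=
  Continuous u ∧ BddAbove (Set.range fun m : ℕ => (5 / 3 : ℝ) ^ m * (graphEnergy m u u).re)

/-- `ℰ(u, v) = e`, where `ℰ(u, v) = lim_m (5/3)ᵐ ℰ_m(u, v)`. -/
def HasEnergy (u v : SG → ℂ) (e : ℂ) : Prop :=
  Filter.Tendsto (fun m : ℕ => (5 / 3 : ℂ) ^ m * graphEnergy m u v) Filter.atTop (nhds e)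

/-- `φ` is zero or an eigenfunction of the Neumann Laplacian `-Δ` with eigenvalue `lam`:
`φ ∈ ℱ` and `ℰ(φ, v) = lam ⟨φ, v⟩` for all `v ∈ ℱ`. -/
def IsNeumannEigenfunction (lam : ℝ) (φ : SG → ℂ) : Prop :=
  FiniteEnergy φ ∧ ∀ v : SG → ℂ, FiniteEnergy v →
    HasEnergy φ v (lam * ∫ x, φ x * starRingEnd ℂ (v x) ∂sgMeasure)

/-- A localized eigenfunction with eigenvalue `lam`: a nonzero real-valued Neumann eigenfunction whose
support does not meet the boundary `V₀` (so that it is also a Dirichlet eigenfunction). -/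
def IsLocalizedEigenfunction (lam : ℝ) (ψ : SG → ℝ) : Prop :=
  IsNeumannEigenfunction lam (fun x => (ψ x : ℂ)) ∧ ψ ≠ 0 ∧ ∀ i, corner i ∉ tsupport ψ

/-- The complex Hilbert space `L²(SG, μ)`. -/
abbrev L2 : Type := Lp ℂ 2 sgMeasure

/-- The eigenspace of the Neumann Laplacian in `L²` for `lam` (zero if `lam` is not an eigenvalue). -/
def eigenspace (lam : ℝ) : Submodule ℂ L2 :=
  (Submodule.span ℂ
    {f : L2 | ∃ φ, IsNeumannEigenfunction lam φ ∧ f =ᵐ[sgMeasure] φ}).topologicalClosure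

/-- The orthogonal projection of `L²` onto the eigenspace for `lam`. -/
def eigenProjection (lam : ℝ) : L2 →L[ℂ] L2 :=
  haveI : CompleteSpace (eigenspace lam) := Submodule.topologicalClosure.completeSpace _
  (eigenspace lam).starProjection

/-! ### Sobolev spaces -/

/-- The Bessel potential `(I - Δ)^(-s/2) f = ∑ (1 + lam)^(-s/2) P_lam f`, the sum over the eigenvalues
of the Neumann Laplacian. -/
def besselPotential (s : ℝ) (f : L2) : L2 :=
  ∑' lam : ℝ, (((1 + lam) ^ (-s / 2) : ℝ) : ℂ) • eigenProjection lam f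

/-- The Sobolev space `H^s = {(I - Δ)^(-s/2) f : f ∈ L²}` with the norm
`‖u‖ = ‖(I - Δ)^(s/2) u‖_{L²}`. The function `u = (I - Δ)^(-s/2) f` is represented by `f`;
it is recovered by `Sobolev.toL2`. For `0 < s ≤ 1` the space contains the harmonic functions. -/
def Sobolev (_s : ℝ) : Type := L2

instance (s : ℝ) : NormedAddCommGroup (Sobolev s) := inferInstanceAs (NormedAddCommGroup L2)

instance (s : ℝ) : NormedSpace ℂ (Sobolev s) := inferInstanceAs (NormedSpace ℂ L2)

instance (s : ℝ) : NormedSpace ℝ (Sobolev s) := inferInstanceAs (NormedSpace ℝ L2)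

/-- The function in `L²` that an element of `H^s` is. -/
def Sobolev.toL2 {s : ℝ} (u : Sobolev s) : L2 := besselPotential s u

/-! ### The nonlinear Schrödinger equation -/

/-- The space `C([-T, T]; H^s)` with the supremum norm. -/
abbrev Curve (s T : ℝ) : Type := C(Set.Icc (-T) T, Sobolev s)

/-- The value in `L²` of a curve at the time `t` (zero outside of `[-T, T]`). -/
def Curve.val {s T : ℝ} (u : Curve s T) (t : ℝ) : L2 :=
  open Classical in if h : t ∈ Set.Icc (-T) T then (u ⟨t, h⟩).toL2 else 0

/-- `u ∈ C([-T, T]; H^s)` solves `i ∂_t u + Δ u = κ |u|^{2k} u`, `u(0) = u₀`, that is, the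
nonlinearity is integrable on `[-T, T] × SG` and Duhamel's formula
`u(t) = e^{itΔ} u₀ - i κ ∫_0^t e^{i(t-τ)Δ} |u(τ)|^{2k} u(τ) dτ` holds for all `t ∈ [-T, T]`.
The formula is read on the coefficients with respect to all Neumann eigenfunctions `φ`, on
which `e^{itΔ}` acts as multiplication by `e^{-it lam}`. -/
def IsSolution {s : ℝ} (k : ℕ) (κ : ℝ) (T : ℝ) (u₀ : Sobolev s) (u : Curve s T) : Prop :=
  (∫⁻ t in Set.Icc (-T) T, ∫⁻ x, ‖u.val t x‖ₑ ^ (2 * k + 1) ∂sgMeasure) < ⊤ ∧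
  ∀ (lam : ℝ) (φ : SG → ℂ), IsNeumannEigenfunction lam φ → ∀ t ∈ Set.Icc (-T) T,
    ∫ x, u.val t x * starRingEnd ℂ (φ x) ∂sgMeasure =
      Complex.exp (-(Complex.I * t * lam)) * ∫ x, u₀.toL2 x * starRingEnd ℂ (φ x) ∂sgMeasure
      - Complex.I * κ * ∫ τ in (0 : ℝ)..t, Complex.exp (-(Complex.I * (t - τ) * lam)) *
          ∫ x, ((‖u.val τ x‖ ^ (2 * k) : ℝ) : ℂ) * u.val τ x * starRingEnd ℂ (φ x) ∂sgMeasure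

/-- `Φ` extends the flow map of `H^1` near the origin: for small data in `H^1`, every solution in
`C([-T, T]; H^1)` is the one given by `Φ`. -/
def ExtendsH1Flow {s : ℝ} (k : ℕ) (κ : ℝ) (T : ℝ) (Φ : Sobolev s → Curve s T) : Prop :=
  ∃ δ > 0, ∀ (w₀ : Sobolev 1) (w : Curve 1 T), ‖w₀‖ < δ → IsSolution k κ T w₀ w →
    ∀ u₀ : Sobolev s, u₀.toL2 = w₀.toL2 → ∀ t, (Φ u₀ t).toL2 = (w t).toL2

/-- Local well-posedness in `H^s` near the origin with a solution map of class `C^m`: for some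
`T, r > 0` and some class `X` of curves in `C([-T, T]; H^s)`, which contains the solutions that lie
in `C([-T, T]; H^1)`, all data `u₀ ∈ H^s` with `‖u₀‖ < r` have exactly one solution `Φ u₀` in `X`,
and `Φ` is of class `C^m` near `0`, from `H^s` to `C([-T, T]; H^s)`. -/
def IsWellPosed (m : ℕ) (s : ℝ) (k : ℕ) (κ : ℝ) : Prop :=
  ∃ T > 0, ∃ r > 0, ∃ (X : Set (Curve s T)) (Φ : Sobolev s → Curve s T),
    (∀ u₀ : Sobolev s, ‖u₀‖ < r →
      (Φ u₀ ∈ X ∧ IsSolution k κ T u₀ (Φ u₀)) ∧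
      (∀ u ∈ X, IsSolution k κ T u₀ u → u = Φ u₀) ∧
      (∀ (u : Curve s T) (w : Curve 1 T), (∀ t, (u t).toL2 = (w t).toL2) →
        IsSolution k κ T u₀ u → u ∈ X)) ∧
    ContDiffAt ℝ m Φ 0

end SierpinskiNLS

end

open MeasureTheory

noncomputable section

namespace SierpinskiNLS

/-! The counterexample is a single eigenfunction shrunk to smaller and smaller cells. Let `φ` be a
real eigenfunction of `-Δ`, normalized in L², that satisfies the Neumann condition and vanishes at
the three vertices. Its copy on a smaller cell, extended by zero, is again a Neumann eigenfunction:
each step multiplies the energy by 5/3 and the integrals by 1/3, hence the eigenvalue by 5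
(`IsNeumannEigenfunction.copy`). Normalized in L², the copy `ψ` after `j` steps satisfies `∫
ψ^(2k+2) = 3^(kj) q` with `q > 0` (`exists_localized_eigenfunctions`).

The solution with data `γ ψ` is `γ e^{itΔ} ψ + γ^(2k+1) D(|e^{itΔ} ψ|^{2k} e^{itΔ} ψ) +
o(γ^(2k+1))`, with `D` the Duhamel operator. On `ψ` the linear flow is a phase of modulus one, so
the nonlinear term has the same phase and its coefficient along `ψ` is resonant: nothing oscillates
under the time integral, and the coefficient at time `T` has modulus `T 3^(kj) q`
(`norm_duhamel_nlC_ge`). With `λ = c 5^j`, the derivative of order `2k+1` has H^s norm at least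
`(1+λ)^(s/2) T 3^(kj) q`, whereas `‖ψ‖_{H^s}^(2k+1) = (1+λ)^(s(2k+1)/2)`. Up to constants the
quotient is `(3/5^s)^(kj)`, which is unbounded because `5^s < 3` (`eventually_growth`). A map of
class C^(2k+1) has bounded derivatives along lines (`exists_iteratedDeriv_line_le`), so no such map
can give these solutions.

Two constructions support this. The eigenfunction `φ` comes from symmetry: a function that
alternates under the permutations of the vertices vanishes at each vertex, and by completeness of
the eigenfunctions some eigenfunction has a nonzero alternating part (`exists_alternate_ne_zero`).
Completeness is the spectral theorem for the compact resolvent; compactness holds since energy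
controls oscillation, so that Arzelà–Ascoli applies. The solutions come from the inverse function
theorem in the space of curves in `ℱ = H¹`, which is an algebra under pointwise multiplication; here
`T` is arbitrary and only `γ` is small (`exists_solutions`). Uniqueness in H¹ is the uniqueness
theorem for an ordinary differential equation in the interaction picture (`duhamel_unique`). -/

/-! ### Barycentric coordinates -/

/-- The barycentric coordinates of the plane with respect to the three vertices. -/
def bary (i : Fin 3) (p : Plane) : ℝ :=
  ![1 - p 0 - p 1 / Real.sqrt 3, p 0 - p 1 / Real.sqrt 3, 2 * p 1 / Real.sqrt 3] i

theorem continuous_bary (i : Fin 3) : Continuous (bary i) := by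
  unfold bary
  fin_cases i <;> simp <;> fun_prop

theorem bary_vertex (i j : Fin 3) : bary i (vertex j) = if i = j then 1 else 0 := by
  have h : Real.sqrt 3 ≠ 0 := by positivity
  fin_cases i <;> fin_cases j <;> simp [bary, vertex] <;> field_simp <;> norm_num

theorem bary_contraction (i j : Fin 3) (p : Plane) :
    bary i (contraction j p) = (bary i p + if i = j then 1 else 0) / 2 := by
  have h : Real.sqrt 3 ≠ 0 := by positivity
  fin_cases i <;> fin_cases j <;> simp [bary, vertex, contraction] <;> field_simp <;> ring

theorem sum_bary (p : Plane) : ∑ i, bary i p = 1 := by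
  have h : Real.sqrt 3 ≠ 0 := by positivity
  simp [Fin.sum_univ_three, bary]
  field_simp
  ring

theorem bary_injective {p q : Plane} (h : ∀ i, bary i p = bary i q) : p = q := by
  have h3 : Real.sqrt 3 ≠ 0 := by positivity
  have h1 := h 1
  have h2 := h 2
  simp [bary] at h1 h2
  have e : p 1 = q 1 := by
    exact h2
  rw [e] at h1
  ext i
  fin_cases i
  · simpa using h1
  · simpa using e

theorem exists_cellMap (x : SG) : ∃ i y, cellMap i y = x := by
  have h := gasket_eq.subset x.2
  simp only [Set.mem_iUnion, Set.mem_image] at h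
  obtain ⟨i, y, hy, e⟩ := h
  exact ⟨i, ⟨y, hy⟩, Subtype.ext e⟩

theorem isCompact_univ_SG : CompactSpace SG := isCompact_iff_compactSpace.mp isCompact_gasket

instance : CompactSpace SG := isCompact_univ_SG

instance : Nonempty SG := ⟨corner 0⟩

theorem bary_cellMap (i j : Fin 3) (x : SG) :
    bary i (cellMap j x : SG) = (bary i x + if i = j then 1 else 0) / 2 :=
  bary_contraction i j x

/-- A minimum over the compact gasket is attained at a point of some cell, where the halving
relation bounds it below by half of itself; so it is not negative. -/
theorem bary_nonneg (i : Fin 3) (x : SG) : 0 ≤ bary i x := by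
  obtain ⟨z, -, hz⟩ := isCompact_univ.exists_isMinOn (s := (Set.univ : Set SG)) Set.univ_nonempty
    ((continuous_bary i).comp continuous_subtype_val).continuousOn
  obtain ⟨j, y, rfl⟩ := exists_cellMap z
  have h1 := hz (Set.mem_univ y)
  have h2 := hz (Set.mem_univ x)
  simp only [Function.comp, Set.mem_ofPred_eq, bary_cellMap] at h1 h2
  split_ifs at h1 h2 <;> linarith

theorem bary_le_one (i : Fin 3) (x : SG) : bary i x ≤ 1 :=
  (Finset.single_le_sum (f := fun i => bary i (x : Plane)) (fun j _ => bary_nonneg j x)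
    (Finset.mem_univ i)).trans (sum_bary _).le

theorem cellMap_injective (i : Fin 3) : Function.Injective (cellMap i) := by
  intro x y h
  refine Subtype.ext (bary_injective fun j => ?_)
  have := congrArg (fun z : SG => bary j z) h
  simp only [bary_cellMap] at this
  linarith

theorem continuous_cellMap (i : Fin 3) : Continuous (cellMap i) := by
  unfold cellMap contraction
  fun_prop

theorem isClosedEmbedding_cellMap (i : Fin 3) : Topology.IsClosedEmbedding (cellMap i) :=
  (continuous_cellMap i).isClosedEmbedding (cellMap_injective i)

theorem eq_corner_of_bary_eq_one {i : Fin 3} {x : SG} (h : bary i x = 1) : x = corner i := by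
  refine Subtype.ext (bary_injective fun j => ?_)
  have hs := sum_bary (x : Plane)
  rw [Fin.sum_univ_three] at hs
  have h0 := bary_nonneg 0 x
  have h1 := bary_nonneg 1 x
  have h2 := bary_nonneg 2 x
  change _ = bary j (vertex i)
  rw [bary_vertex]
  fin_cases i <;> fin_cases j <;> simp at h ⊢ <;> linarith

/-- Two cells of level one meet at most in the midpoint between two vertices. -/
theorem cellMap_eq_cellMap {i j : Fin 3} (hij : i ≠ j) {x y : SG} (h : cellMap i x = cellMap j y) :
    x = corner j ∧ y = corner i := by
  have hi := congrArg (fun z : SG => bary i z) h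
  have hj := congrArg (fun z : SG => bary j z) h
  simp only [bary_cellMap, if_neg hij, if_neg hij.symm, if_true] at hi hj
  -- The `i`-th coordinate gives `bary i x + 1 = bary i y`; with both values in [0, 1] this forces
  -- `bary i y = 1`. The `j`-th coordinate gives the other half.
  have := bary_nonneg i x
  have := bary_le_one i y
  have := bary_nonneg j y
  have := bary_le_one j x
  exact ⟨eq_corner_of_bary_eq_one (by linarith), eq_corner_of_bary_eq_one (by linarith)⟩

theorem cellMap_corner (i j : Fin 3) : cellMap i (corner j) = cellMap j (corner i) := by
  refine Subtype.ext (bary_injective fun k => ?_)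
  simp only [bary_cellMap]
  change (bary k (vertex j) + _) / 2 = (bary k (vertex i) + _) / 2
  rw [bary_vertex, bary_vertex, add_comm]

theorem cellMap_corner_self (i : Fin 3) : cellMap i (corner i) = corner i := by
  apply eq_corner_of_bary_eq_one
  rw [bary_cellMap]
  change (bary i (vertex i) + _) / 2 = 1
  rw [bary_vertex]
  norm_num

theorem corner_eq_cellMap {i j : Fin 3} {x : SG} (h : cellMap j x = corner i) :
    j = i ∧ x = corner i := by
  have hi := congrArg (fun z : SG => bary i z) h
  have h1 : bary i (corner i : SG) = 1 := by
    change bary i (vertex i) = 1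
    rw [bary_vertex, if_pos rfl]
  simp only [bary_cellMap, h1] at hi
  have := bary_le_one i x
  by_cases hij : i = j
  · rw [if_pos hij] at hi
    exact ⟨hij.symm, eq_corner_of_bary_eq_one (by linarith)⟩
  · rw [if_neg hij] at hi
    linarith

/-! ### Functions on the cells of level one -/

theorem isClosed_range_cellMap (i : Fin 3) : IsClosed (Set.range (cellMap i)) :=
  (isClosedEmbedding_cellMap i).isClosed_range

/-- The three cells form a finite closed cover, and each is embedded by its cell map. -/
theorem continuous_of_comp_cellMap {E : Type*} [TopologicalSpace E] {g : SG → E}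
    (h : ∀ i, Continuous (g ∘ cellMap i)) : Continuous g := by
  rw [← continuousOn_univ]
  have hU : (Set.univ : Set SG) = ⋃ i, Set.range (cellMap i) := by
    ext x
    obtain ⟨i, y, rfl⟩ := exists_cellMap x
    simp only [Set.mem_univ, Set.mem_iUnion, true_iff]
    exact ⟨i, y, rfl⟩
  rw [hU]
  refine (locallyFinite_of_finite _).continuousOn_iUnion isClosed_range_cellMap fun i => ?_
  rw [← Set.image_univ]
  intro x hx
  obtain ⟨y, -, rfl⟩ := hx
  have := (isClosedEmbedding_cellMap i).isInducing
  rw [ContinuousWithinAt, Set.image_univ, ← this.map_nhds_eq, Filter.tendsto_map'_iff]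
  exact (h i).continuousAt

/-- The function `g` with `g ∘ F_i = f i`, if the `f i` agree at the common points of the cells. -/
def glue {E : Type*} (f : Fin 3 → SG → E) (x : SG) : E :=
  f (exists_cellMap x).choose (exists_cellMap x).choose_spec.choose

/-- The arbitrary choice of a preimage in `glue` is harmless: a point in two different cells is
their common midpoint, where the hypothesis makes the two candidates equal. -/
theorem glue_comp {E : Type*} {f : Fin 3 → SG → E} (h : ∀ i j, f i (corner j) = f j (corner i))
    (i : Fin 3) : glue f ∘ cellMap i = f i := by
  funext x
  have hx := (exists_cellMap (cellMap i x)).choose_spec.choose_spec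
  unfold glue
  simp only [Function.comp]
  generalize (exists_cellMap (cellMap i x)).choose_spec.choose = y at hx ⊢
  generalize (exists_cellMap (cellMap i x)).choose = k at hx ⊢
  by_cases hk : k = i
  · have : y = x := cellMap_injective i (by rw [← hx, hk])
    change f k y = _
    rw [hk, this]
  · obtain ⟨h1, h2⟩ := cellMap_eq_cellMap hk hx
    change f k y = _
    rw [h1, h2, h]

theorem glue_corner {E : Type*} {f : Fin 3 → SG → E} (h : ∀ i j, f i (corner j) = f j (corner i))
    (i : Fin 3) : glue f (corner i) = f i (corner i) := by
  rw [← glue_comp h i, Function.comp, cellMap_corner_self]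

/-! ### Symmetries -/

theorem consAddress_shift (ω : ℕ → Fin 3) : consAddress (ω 0) (fun n => ω (n + 1)) = ω := by
  funext n
  cases n <;> rfl

/-- The affine map of the plane that permutes the vertices by `π`. -/
def permMap (π : Equiv.Perm (Fin 3)) (p : Plane) : Plane := ∑ i, bary i p • vertex (π i)

theorem continuous_permMap (π : Equiv.Perm (Fin 3)) : Continuous (permMap π) :=
  continuous_finsetSum _ fun i _ => (continuous_bary i).smul continuous_const

theorem permMap_contraction (π : Equiv.Perm (Fin 3)) (j : Fin 3) (p : Plane) :
    permMap π (contraction j p) = contraction (π j) (permMap π p) := by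
  have h : ∀ i, ((bary i p + if i = j then 1 else 0) / 2) • vertex (π i) =
      (1 / 2 : ℝ) • (bary i p • vertex (π i)) +
      (1 / 2 : ℝ) • (if i = j then vertex (π j) else 0) := by
    intro i
    split_ifs with h
    · rw [h]; module
    · module
  simp only [permMap, bary_contraction, h, Finset.sum_add_distrib, ← Finset.smul_sum,
    Finset.sum_ite_eq', Finset.mem_univ, if_true]
  simp only [contraction]
  module

/-- The defect between the two sides is continuous on the compact code space, and shifting the code
doubles it. At a maximum this is possible only if the defect is zero. -/
theorem permMap_address (π : Equiv.Perm (Fin 3)) (ω : ℕ → Fin 3) :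
    permMap π (address ω) = address (π ∘ ω) := by
  have hc : Continuous fun ω : ℕ → Fin 3 => ‖permMap π (address ω) - address (π ∘ ω)‖ :=
    (((continuous_permMap π).comp continuous_address).sub (continuous_address.comp
      (continuous_pi fun n => (continuous_of_discreteTopology (f := π)).comp
        (continuous_apply n)))).norm
  obtain ⟨z, -, hz⟩ := isCompact_univ.exists_isMaxOn (s := (Set.univ : Set (ℕ → Fin 3)))
    Set.univ_nonempty hc.continuousOn
  have hh : ‖permMap π (address z) - address (π ∘ z)‖ =
      1 / 2 * ‖permMap π (address fun n => z (n + 1)) - address (π ∘ fun n => z (n + 1))‖ := by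
    conv_lhs => rw [← consAddress_shift z, ← consAddress_shift (π ∘ _), ← contraction_address,
      ← contraction_address, permMap_contraction]
    have : ‖(1 / 2 : ℝ)‖ = 1 / 2 := by norm_num
    rw [← this, ← norm_smul]
    congr 1
    change contraction (π (z 0)) _ - contraction (π (z 0)) _ = _
    unfold contraction
    simp only [Function.comp_def, consAddress]
    module
  have h1 := hz (Set.mem_univ fun n => z (n + 1))
  have h2 := hz (Set.mem_univ ω)
  simp only [Set.mem_ofPred_eq] at h1 h2
  have h3 : ‖permMap π (address ω) - address (π ∘ ω)‖ ≤ 0 := by linarith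
  exact sub_eq_zero.mp (norm_le_zero_iff.mp h3)

/-- The symmetry of the gasket that permutes the vertices by `π`. -/
def sym (π : Equiv.Perm (Fin 3)) (x : SG) : SG :=
  ⟨permMap π x, by obtain ⟨_, ω, rfl⟩ := x; exact ⟨_, (permMap_address π ω).symm⟩⟩

theorem continuous_sym (π : Equiv.Perm (Fin 3)) : Continuous (sym π) :=
  ((continuous_permMap π).comp continuous_subtype_val).subtype_mk _

theorem sym_cellMap (π : Equiv.Perm (Fin 3)) (i : Fin 3) (x : SG) :
    sym π (cellMap i x) = cellMap (π i) (sym π x) :=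
  Subtype.ext (permMap_contraction π i x)

theorem permMap_vertex (π : Equiv.Perm (Fin 3)) (i : Fin 3) :
    permMap π (vertex i) = vertex (π i) := by
  simp [permMap, bary_vertex]

theorem sym_corner (π : Equiv.Perm (Fin 3)) (i : Fin 3) : sym π (corner i) = corner (π i) :=
  Subtype.ext (permMap_vertex π i)

theorem sym_mul (π τ : Equiv.Perm (Fin 3)) (x : SG) : sym (π * τ) x = sym π (sym τ x) := by
  obtain ⟨_, ω, rfl⟩ := x
  refine Subtype.ext ?_
  simp only [sym, permMap_address]
  rfl

theorem sym_one (x : SG) : sym 1 x = x := by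
  obtain ⟨_, ω, rfl⟩ := x
  refine Subtype.ext ?_
  simp only [sym, permMap_address]
  rfl

/-! ### The self-similar measure -/

/-- The uniform measure on the digits. -/
abbrev digitMeasure : Measure (Fin 3) := (PMF.uniformOfFintype (Fin 3)).toMeasure

/-- The law of a sequence of independent uniform digits. -/
abbrev codeMeasure : Measure (ℕ → Fin 3) := Measure.infinitePi fun _ : ℕ => digitMeasure

/-- The point of the gasket with a given address. -/
abbrev codeMap : (ℕ → Fin 3) → SG := Set.rangeFactorization address

theorem continuous_codeMap : Continuous codeMap := continuous_address.subtype_mk _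

theorem measurable_codeMap : Measurable codeMap := continuous_codeMap.measurable

theorem sgMeasure_eq : sgMeasure = codeMeasure.map codeMap := rfl

instance : IsProbabilityMeasure sgMeasure :=
  Measure.isProbabilityMeasure_map measurable_codeMap.aemeasurable

theorem cellMap_codeMap (i : Fin 3) (ω : ℕ → Fin 3) :
    cellMap i (codeMap ω) = codeMap (consAddress i ω) :=
  Subtype.ext (contraction_address i ω)

theorem measurable_consAddress (i : Fin 3) : Measurable (consAddress i) := by
  refine measurable_pi_lambda _ fun n => ?_
  cases n
  · exact measurable_const
  · exact measurable_pi_apply _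

theorem digitMeasure_apply (t : Set (Fin 3)) :
    digitMeasure t = ∑ i, (3 : ENNReal)⁻¹ * t.indicator 1 i := by
  classical
  rw [PMF.toMeasure_apply_fintype]
  refine Finset.sum_congr rfl fun i _ => ?_
  by_cases h : i ∈ t <;> simp [h]

/-- Putting an independent uniform digit in front of independent uniform digits reproduces their
law; it suffices to test this on finite boxes. -/
theorem sum_map_consAddress :
    ∑ i, (3 : ENNReal)⁻¹ • codeMeasure.map (consAddress i) = codeMeasure := by
  refine Measure.eq_infinitePi _ fun s t ht => ?_
  classical
  obtain ⟨N, hN⟩ : ∃ N, s ⊆ Finset.range (N + 1) :=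
    ⟨s.sup id, fun n hn => Finset.mem_range.mpr (Nat.lt_succ_of_le (Finset.le_sup (f := id) hn))⟩
  -- The box is padded to an initial segment that contains the index `0`, so that the first digit
  -- can be split off.
  set t' : ℕ → Set (Fin 3) := fun n => if n ∈ s then t n else Set.univ
  have hset : Set.pi (s : Set ℕ) t = Set.pi (Finset.range (N + 1) : Set ℕ) t' := by
    ext ω
    simp only [Set.mem_pi, t']
    constructor
    · intro h n _
      split_ifs with hn
      · exact h n hn
      · trivial
    · intro h n hn
      have := h n (hN hn)
      rwa [if_pos (by exact hn)] at this
  have hprod : ∏ n ∈ s, digitMeasure (t n) = ∏ n ∈ Finset.range (N + 1), digitMeasure (t' n) := by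
    rw [← Finset.prod_subset hN]
    · refine Finset.prod_congr rfl fun n hn => ?_
      simp only [t', if_pos hn]
    · intro n _ hn
      simp only [t', if_neg hn, measure_univ]
  have ht' : ∀ n, MeasurableSet (t' n) := fun n => MeasurableSet.of_discrete
  rw [hset, hprod, Finset.prod_range_succ', digitMeasure_apply (t' 0), Finset.mul_sum]
  simp only [Measure.coe_finsetSum, Finset.sum_apply, Measure.smul_apply, smul_eq_mul]
  refine Finset.sum_congr rfl fun i _ => ?_
  rw [Measure.map_apply (measurable_consAddress i)
    (MeasurableSet.pi (Finset.countable_toSet _) fun n _ => ht' n)]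
  have hpre : consAddress i ⁻¹' Set.pi (Finset.range (N + 1) : Set ℕ) t' =
      if i ∈ t' 0 then Set.pi (Finset.range N : Set ℕ) (fun n => t' (n + 1)) else ∅ := by
    ext ω
    split_ifs with hi
    · simp only [Set.mem_preimage, Set.mem_pi, Finset.coe_range, Set.mem_Iio]
      constructor
      · intro h n hn
        exact h (n + 1) (by omega)
      · intro h n hn
        cases n with
        | zero => exact hi
        | succ n => exact h n (by omega)
    · simp only [Set.mem_preimage, Set.mem_pi, Finset.coe_range, Set.mem_Iio,
        Set.mem_empty_iff_false, iff_false]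
      exact fun h => hi (h 0 (by omega))
  rw [hpre]
  split_ifs with hi
  · rw [Measure.infinitePi_pi _ fun n _ => ht' (n + 1)]
    simp [hi, mul_comm]
  · simp [hi]

/-- The self-similarity of the measure. -/
theorem sgMeasure_selfSimilar :
    sgMeasure = ∑ i, (3 : ENNReal)⁻¹ • sgMeasure.map (cellMap i) := by
  conv_lhs => rw [sgMeasure_eq, ← sum_map_consAddress]
  rw [← Measure.mapₗ_apply_of_measurable measurable_codeMap, map_sum]
  refine Finset.sum_congr rfl fun i _ => ?_
  rw [Measure.mapₗ_apply_of_measurable measurable_codeMap, Measure.map_smul, Measure.map_map measurable_codeMap (measurable_consAddress i), sgMeasure_eq,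
    Measure.map_map (continuous_cellMap i).measurable measurable_codeMap]
  congr 2
  funext ω
  exact (cellMap_codeMap i ω).symm

theorem measure_eq_sum_cells {A : Set SG} (hA : MeasurableSet A) :
    sgMeasure A = ∑ i, (3 : ENNReal)⁻¹ * sgMeasure (cellMap i ⁻¹' A) := by
  conv_lhs => rw [sgMeasure_selfSimilar]
  simp only [Measure.coe_finsetSum, Finset.sum_apply, Measure.smul_apply, smul_eq_mul]
  refine Finset.sum_congr rfl fun i _ => ?_
  rw [Measure.map_apply (continuous_cellMap i).measurable hA]

theorem integral_eq_sum_cells {E : Type*} [NormedAddCommGroup E] [NormedSpace ℝ E] {g : SG → E}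
    (hg : Continuous g) :
    ∫ x, g x ∂sgMeasure = (1 / 3 : ℝ) • ∑ i, ∫ x, g (cellMap i x) ∂sgMeasure := by
  conv_lhs => rw [sgMeasure_selfSimilar]
  have hfin : ∀ i, IsFiniteMeasure ((3 : ENNReal)⁻¹ • sgMeasure.map (cellMap i)) := fun i =>
    Measure.smul_finite _ (by simp)
  rw [integral_finsetSum_measure, Finset.smul_sum]
  · refine Finset.sum_congr rfl fun i _ => ?_
    rw [integral_smul_measure, integral_map (continuous_cellMap i).aemeasurable
      hg.aestronglyMeasurable]
    simp
  · intro i _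
    exact hg.integrable_of_hasCompactSupport (HasCompactSupport.of_compactSpace _)

/-- A vertex lies in one cell of level one only and is fixed by its map, so self-similarity says
that its mass is a third of itself. -/
theorem measure_corner (i : Fin 3) : sgMeasure {corner i} = 0 := by
  have h := measure_eq_sum_cells (measurableSet_singleton (corner i))
  have h1 : ∀ j, cellMap j ⁻¹' {corner i} = if j = i then {corner i} else ∅ := by
    intro j
    ext x
    split_ifs with hj
    · subst hj
      simp only [Set.mem_preimage, Set.mem_singleton_iff]
      exact ⟨fun h => (corner_eq_cellMap h).2, fun h => by rw [h, cellMap_corner_self]⟩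
    · simp only [Set.mem_preimage, Set.mem_singleton_iff, Set.mem_empty_iff_false, iff_false]
      exact fun h => hj (corner_eq_cellMap h).1
  have h2 : ∀ j, (3 : ENNReal)⁻¹ * sgMeasure (cellMap j ⁻¹' {corner i}) =
      if j = i then 3⁻¹ * sgMeasure {corner i} else 0 := by
    intro j
    rw [h1]
    split_ifs <;> simp
  simp only [h2, Finset.sum_ite_eq', Finset.mem_univ, if_true] at h
  have h3 := congrArg ENNReal.toReal h
  rw [ENNReal.toReal_mul] at h3
  norm_num at h3
  have h4 : (sgMeasure {corner i}).toReal = 0 := by linarith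
  exact (ENNReal.toReal_eq_zero_iff _).mp h4 |>.resolve_right (measure_ne_top _ _)

/-- The other two cells meet the image in at most one midpoint each, whose preimage is a vertex and
thus a null set. -/
theorem measure_image_cellMap {A : Set SG} (hA : MeasurableSet A) (i : Fin 3) :
    sgMeasure (cellMap i '' A) = 3⁻¹ * sgMeasure A := by
  rw [measure_eq_sum_cells ((isClosedEmbedding_cellMap i).measurableEmbedding.measurableSet_image.mpr
    hA), Finset.sum_eq_single i]
  · rw [(cellMap_injective i).preimage_image]
  · intro j _ hj
    have : cellMap j ⁻¹' (cellMap i '' A) ⊆ {corner i} := by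
      rintro x ⟨y, -, hy⟩
      exact (cellMap_eq_cellMap hj hy.symm).1
    rw [measure_mono_null this (measure_corner i), mul_zero]
  · simp

theorem map_sym (π : Equiv.Perm (Fin 3)) : sgMeasure.map (sym π) = sgMeasure := by
  have h1 : codeMeasure.map (fun ω n => π (ω n)) = codeMeasure := by
    rw [Measure.infinitePi_map_pi]
    · congr 1
      funext n
      ext t ht
      rw [Measure.map_apply (measurable_of_finite _) ht, digitMeasure_apply, digitMeasure_apply]
      exact Equiv.sum_comp π fun i => (3 : ENNReal)⁻¹ * t.indicator 1 i
    · exact fun _ => measurable_of_finite _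
  conv_rhs => rw [sgMeasure_eq, ← h1]
  rw [sgMeasure_eq, Measure.map_map (continuous_sym π).measurable measurable_codeMap,
    Measure.map_map (g := codeMap) (f := fun (ω : ℕ → Fin 3) n => π (ω n)) measurable_codeMap
      (measurable_pi_lambda _ fun n => (measurable_of_finite _).comp (measurable_pi_apply n))]
  congr 1
  funext ω
  exact Subtype.ext (permMap_address π ω)

/-- The codes of an open set contain a cylinder, and each digit that it prescribes has positive
probability. This makes the map from continuous functions to L² injective. -/
instance : Measure.IsOpenPosMeasure sgMeasure := by
  constructor
  intro U hU hne h0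
  rw [sgMeasure_eq, Measure.map_apply measurable_codeMap hU.measurableSet] at h0
  obtain ⟨⟨_, ω, rfl⟩, hω⟩ := hne
  have hV : IsOpen (codeMap ⁻¹' U) := hU.preimage continuous_codeMap
  obtain ⟨I, u, hu, hsub⟩ := isOpen_pi_iff.mp hV ω hω
  have := measure_mono_null hsub h0
  rw [Measure.infinitePi_pi _ fun _ _ => MeasurableSet.of_discrete, Finset.prod_eq_zero_iff] at this
  obtain ⟨n, hn, h⟩ := this
  rw [digitMeasure_apply, Finset.sum_eq_zero_iff] at h
  have := h (ω n) (Finset.mem_univ _)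
  simp [(hu n hn).2] at this

/-! ### Graph energies -/

theorem graphEnergy_add_left (m : ℕ) (u u' v : SG → ℂ) :
    graphEnergy m (u + u') v = graphEnergy m u v + graphEnergy m u' v := by
  induction m generalizing u u' v with
  | zero => simp only [graphEnergy, Pi.add_apply, Fin.sum_univ_three]; ring
  | succ m ih =>
    simp only [graphEnergy, ← Finset.sum_add_distrib, ← ih]
    rfl

theorem graphEnergy_smul_left (m : ℕ) (c : ℂ) (u v : SG → ℂ) :
    graphEnergy m (c • u) v = c * graphEnergy m u v := by
  induction m generalizing u v with
  | zero => simp only [graphEnergy, Pi.smul_apply, smul_eq_mul, Fin.sum_univ_three]; ring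
  | succ m ih =>
    simp only [graphEnergy, Finset.mul_sum, ← ih]
    rfl

theorem graphEnergy_conj_symm (m : ℕ) (u v : SG → ℂ) :
    starRingEnd ℂ (graphEnergy m u v) = graphEnergy m v u := by
  induction m generalizing u v with
  | zero =>
    simp only [graphEnergy, Fin.sum_univ_three, map_mul, map_add, map_sub, Complex.conj_conj]
    simp only [map_div₀, map_one, map_ofNat]
    ring
  | succ m ih => simp only [graphEnergy, map_sum, ih]

theorem graphEnergy_add_right (m : ℕ) (u v v' : SG → ℂ) :
    graphEnergy m u (v + v') = graphEnergy m u v + graphEnergy m u v' := by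
  rw [← graphEnergy_conj_symm, graphEnergy_add_left, map_add, graphEnergy_conj_symm,
    graphEnergy_conj_symm]

theorem graphEnergy_smul_right (m : ℕ) (c : ℂ) (u v : SG → ℂ) :
    graphEnergy m u (c • v) = starRingEnd ℂ c * graphEnergy m u v := by
  rw [← graphEnergy_conj_symm, graphEnergy_smul_left, map_mul, graphEnergy_conj_symm]

/-- The graph energy `ℰ_m(u, u)`, as a real number. -/
def graphNormSq (m : ℕ) (u : SG → ℂ) : ℝ := (graphEnergy m u u).re

theorem graphNormSq_zero (u : SG → ℂ) : graphNormSq 0 u = ‖u (corner 0) - u (corner 1)‖ ^ 2 +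
    ‖u (corner 0) - u (corner 2)‖ ^ 2 + ‖u (corner 1) - u (corner 2)‖ ^ 2 := by
  simp only [← Complex.normSq_eq_norm_sq]
  simp only [graphNormSq, graphEnergy, Complex.mul_conj, Fin.sum_univ_three, sub_self,
    Complex.normSq_zero]
  rw [← Complex.normSq_neg (u (corner 1) - u (corner 0)),
    ← Complex.normSq_neg (u (corner 2) - u (corner 0)),
    ← Complex.normSq_neg (u (corner 2) - u (corner 1))]
  simp only [neg_sub]
  norm_num
  ring

theorem graphNormSq_succ (m : ℕ) (u : SG → ℂ) :
    graphNormSq (m + 1) u = ∑ i, graphNormSq m (u ∘ cellMap i) := by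
  simp only [graphNormSq, graphEnergy, Complex.re_sum]

theorem graphNormSq_nonneg (m : ℕ) (u : SG → ℂ) : 0 ≤ graphNormSq m u := by
  induction m generalizing u with
  | zero => rw [graphNormSq_zero]; positivity
  | succ m ih => rw [graphNormSq_succ]; exact Finset.sum_nonneg fun i _ => ih _

theorem graphEnergy_self (m : ℕ) (u : SG → ℂ) : graphEnergy m u u = graphNormSq m u := by
  have := graphEnergy_conj_symm m u u
  rw [Complex.conj_eq_iff_re] at this
  exact this.symm

theorem graphNormSq_cell_le (m : ℕ) (u : SG → ℂ) (i : Fin 3) :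
    graphNormSq m (u ∘ cellMap i) ≤ graphNormSq (m + 1) u := by
  rw [graphNormSq_succ]
  exact Finset.single_le_sum (f := fun i => graphNormSq m (u ∘ cellMap i))
    (fun i _ => graphNormSq_nonneg m _) (Finset.mem_univ i)

theorem norm_sub_sq_le_graphNormSq_zero (u : SG → ℂ) (i j : Fin 3) :
    ‖u (corner i) - u (corner j)‖ ^ 2 ≤ graphNormSq 0 u := by
  rw [graphNormSq_zero]
  have h0 := sq_nonneg ‖u (corner 0) - u (corner 1)‖
  have h1 := sq_nonneg ‖u (corner 0) - u (corner 2)‖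
  have h2 := sq_nonneg ‖u (corner 1) - u (corner 2)‖
  fin_cases i <;> fin_cases j <;> simp <;>
    first | positivity | linarith | (rw [norm_sub_rev]; linarith)

/-- For given vertex values the energy of the refined graph is smallest at the harmonic midpoint
values, given by the 2/5–2/5–1/5 rule, where the factor 3/5 is attained. The difference of the two
sides is a sum of squares in the deviations from these values. -/
theorem triangle_energy_le (a b c x y z : ℝ) :
    3 / 5 * ((a - b) ^ 2 + (a - c) ^ 2 + (b - c) ^ 2) ≤
      ((a - x) ^ 2 + (a - y) ^ 2 + (x - y) ^ 2) + ((x - b) ^ 2 + (x - z) ^ 2 + (b - z) ^ 2) +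
      ((y - z) ^ 2 + (y - c) ^ 2 + (z - c) ^ 2) := by
  have h : ((a - x) ^ 2 + (a - y) ^ 2 + (x - y) ^ 2) + ((x - b) ^ 2 + (x - z) ^ 2 + (b - z) ^ 2) +
      ((y - z) ^ 2 + (y - c) ^ 2 + (z - c) ^ 2) -
      3 / 5 * ((a - b) ^ 2 + (a - c) ^ 2 + (b - c) ^ 2) =
      2 * ((x - (2 * a + 2 * b + c) / 5) ^ 2 + (y - (2 * a + b + 2 * c) / 5) ^ 2 +
        (z - (a + 2 * b + 2 * c) / 5) ^ 2) +
      ((x - (2 * a + 2 * b + c) / 5) - (y - (2 * a + b + 2 * c) / 5)) ^ 2 +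
      ((x - (2 * a + 2 * b + c) / 5) - (z - (a + 2 * b + 2 * c) / 5)) ^ 2 +
      ((y - (2 * a + b + 2 * c) / 5) - (z - (a + 2 * b + 2 * c) / 5)) ^ 2 := by
    ring
  have : 0 ≤ 2 * ((x - (2 * a + 2 * b + c) / 5) ^ 2 + (y - (2 * a + b + 2 * c) / 5) ^ 2 +
        (z - (a + 2 * b + 2 * c) / 5) ^ 2) +
      ((x - (2 * a + 2 * b + c) / 5) - (y - (2 * a + b + 2 * c) / 5)) ^ 2 +
      ((x - (2 * a + 2 * b + c) / 5) - (z - (a + 2 * b + 2 * c) / 5)) ^ 2 +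
      ((y - (2 * a + b + 2 * c) / 5) - (z - (a + 2 * b + 2 * c) / 5)) ^ 2 := by positivity
  linarith

theorem norm_sub_sq (z w : ℂ) : ‖z - w‖ ^ 2 = (z.re - w.re) ^ 2 + (z.im - w.im) ^ 2 := by
  rw [← Complex.normSq_eq_norm_sq, Complex.normSq_apply, Complex.sub_re, Complex.sub_im]
  ring

theorem graphNormSq_zero_le (u : SG → ℂ) : 3 / 5 * graphNormSq 0 u ≤ graphNormSq 1 u := by
  rw [graphNormSq_succ, Fin.sum_univ_three]
  simp only [graphNormSq_zero, Function.comp, cellMap_corner_self]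
  rw [cellMap_corner 1 0, cellMap_corner 2 0, cellMap_corner 2 1]
  simp only [norm_sub_sq]
  have h1 := triangle_energy_le (u (corner 0)).re (u (corner 1)).re (u (corner 2)).re
    (u (cellMap 0 (corner 1))).re (u (cellMap 0 (corner 2))).re (u (cellMap 1 (corner 2))).re
  have h2 := triangle_energy_le (u (corner 0)).im (u (corner 1)).im (u (corner 2)).im
    (u (cellMap 0 (corner 1))).im (u (cellMap 0 (corner 2))).im (u (cellMap 1 (corner 2))).im
  linarith

theorem graphNormSq_le_succ (m : ℕ) (u : SG → ℂ) :
    3 / 5 * graphNormSq m u ≤ graphNormSq (m + 1) u := by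
  induction m generalizing u with
  | zero => exact graphNormSq_zero_le u
  | succ m ih =>
    rw [graphNormSq_succ, graphNormSq_succ (m + 1), Finset.mul_sum]
    exact Finset.sum_le_sum fun i _ => ih _

theorem monotone_energy (u : SG → ℂ) : Monotone fun m : ℕ => (5 / 3 : ℝ) ^ m * graphNormSq m u := by
  refine monotone_nat_of_le_succ fun m => ?_
  have h := graphNormSq_le_succ m u
  have : (5 / 3 : ℝ) ^ m * graphNormSq m u = (5 / 3 : ℝ) ^ (m + 1) * (3 / 5 * graphNormSq m u) := by
    rw [pow_succ]; ring
  rw [this]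
  gcongr

/-- The energy of `u` is at most `B`. -/
def EnergyLE (u : SG → ℂ) (B : ℝ) : Prop := ∀ m : ℕ, (5 / 3 : ℝ) ^ m * graphNormSq m u ≤ B

theorem finiteEnergy_iff {u : SG → ℂ} : FiniteEnergy u ↔ Continuous u ∧ ∃ B, EnergyLE u B := by
  refine and_congr_right fun _ => ⟨fun ⟨B, hB⟩ => ⟨B, fun m => hB ⟨m, rfl⟩⟩, fun ⟨B, hB⟩ => ⟨B, ?_⟩⟩
  rintro _ ⟨m, rfl⟩
  exact hB m

theorem EnergyLE.nonneg {u : SG → ℂ} {B : ℝ} (h : EnergyLE u B) : 0 ≤ B :=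
  (mul_nonneg (by positivity) (graphNormSq_nonneg 0 u)).trans (h 0)

/-- Level `m` on the cell is a part of level `m + 1` on the whole gasket, and the renormalizations
differ by one factor 5/3. -/
theorem EnergyLE.comp_cellMap {u : SG → ℂ} {B : ℝ} (h : EnergyLE u B) (i : Fin 3) :
    EnergyLE (u ∘ cellMap i) (3 / 5 * B) := by
  intro m
  have h1 := h (m + 1)
  have h2 := graphNormSq_cell_le m u i
  have h3 : (5 / 3 : ℝ) ^ (m + 1) * graphNormSq m (u ∘ cellMap i) ≤ B :=
    (mul_le_mul_of_nonneg_left h2 (by positivity)).trans h1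
  rw [pow_succ] at h3
  linarith

theorem energyLE_of_comp_cellMap {u : SG → ℂ} {B : Fin 3 → ℝ}
    (h : ∀ i, EnergyLE (u ∘ cellMap i) (B i)) : EnergyLE u (5 / 3 * ∑ i, B i) := by
  intro m
  -- Level `0` does not split over the cells, so every level is first raised by one.
  refine (monotone_energy u (Nat.le_succ m)).trans ?_
  simp only [graphNormSq_succ, pow_succ', mul_assoc]
  rw [Finset.mul_sum]
  gcongr with i
  exact h i m

/-- The digits of `ω` from the `n`-th on are replaced by `0`. -/
def truncate (n : ℕ) (ω : ℕ → Fin 3) : ℕ → Fin 3 := fun k => if k < n then ω k else 0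

theorem truncate_succ (n : ℕ) (ω : ℕ → Fin 3) :
    truncate (n + 1) ω = consAddress (ω 0) (truncate n fun k => ω (k + 1)) := by
  funext k
  cases k with
  | zero => simp [truncate, consAddress]
  | succ k => simp [truncate, consAddress]

theorem codeMap_const (i : Fin 3) : codeMap (fun _ => i) = corner i :=
  Subtype.ext (address_const i)

/-- A rational contraction factor for the oscillation; the constant 4 in the next lemma is the
solution of `4 = (4 + 1) * (4/5)`. -/
theorem sqrt_three_fifths_mul_le (B : ℝ) (hB : 0 ≤ B) :
    Real.sqrt (3 / 5 * B) ≤ 4 / 5 * Real.sqrt B := by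
  rw [Real.sqrt_le_left (by positivity), mul_pow, Real.sq_sqrt hB]
  nlinarith

/-- A truncated address is a vertex of a cell. It is joined to `p₀` through vertices of a nested
sequence of cells, and the jumps decrease geometrically because the energy on the cells does. -/
theorem EnergyLE.norm_sub_truncate_le {u : SG → ℂ} {B : ℝ} (h : EnergyLE u B) (n : ℕ)
    (ω : ℕ → Fin 3) : ‖u (codeMap (truncate n ω)) - u (corner 0)‖ ≤ 4 * Real.sqrt B := by
  induction n generalizing u B ω with
  | zero =>
    have : truncate 0 ω = fun _ => 0 := by funext k; simp [truncate]
    rw [this, codeMap_const, sub_self, norm_zero]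
    positivity
  | succ n ih =>
    rw [truncate_succ, ← cellMap_codeMap]
    have h1 := ih (h.comp_cellMap (ω 0)) (fun k => ω (k + 1))
    have h2 := sqrt_three_fifths_mul_le B h.nonneg
    have h3 : ‖u (cellMap (ω 0) (corner 0)) - u (corner 0)‖ ≤ Real.sqrt (3 / 5 * B) := by
      -- Both points are vertices of the cell `F₀(SG)`, so their difference is bounded by the graph
      -- energy of level zero on that cell.
      rw [cellMap_corner, show u (corner 0) = u (cellMap 0 (corner 0)) by rw [cellMap_corner_self]]
      apply Real.le_sqrt_of_sq_le
      have h4 := (h.comp_cellMap 0) 0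
      rw [pow_zero, one_mul] at h4
      exact (norm_sub_sq_le_graphNormSq_zero (u ∘ cellMap 0) (ω 0) 0).trans h4
    have h5 := norm_sub_le_norm_sub_add_norm_sub
      (u (cellMap (ω 0) (codeMap (truncate n fun k => ω (k + 1))))) (u (cellMap (ω 0) (corner 0)))
      (u (corner 0))
    simp only [Function.comp] at h1
    linarith

theorem EnergyLE.norm_sub_corner_le {u : SG → ℂ} {B : ℝ} (h : EnergyLE u B) (hu : Continuous u)
    (x : SG) : ‖u x - u (corner 0)‖ ≤ 4 * Real.sqrt B := by
  obtain ⟨_, ω, rfl⟩ := x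
  have h1 : Filter.Tendsto (fun n => truncate n ω) Filter.atTop (nhds ω) := by
    rw [tendsto_pi_nhds]
    intro k
    refine tendsto_const_nhds.congr' ?_
    filter_upwards [Filter.eventually_gt_atTop k] with n hn
    simp [truncate, hn]
  have h2 : Filter.Tendsto (fun n => ‖u (codeMap (truncate n ω)) - u (corner 0)‖) Filter.atTop
      (nhds ‖u (codeMap ω) - u (corner 0)‖) :=
    (((hu.comp continuous_codeMap).tendsto ω).comp h1 |>.sub_const _).norm
  exact le_of_tendsto' h2 fun n => h.norm_sub_truncate_le n ω

theorem EnergyLE.norm_sub_le {u : SG → ℂ} {B : ℝ} (h : EnergyLE u B) (hu : Continuous u)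
    (x y : SG) : ‖u x - u y‖ ≤ 8 * Real.sqrt B := by
  have h1 := h.norm_sub_corner_le hu x
  have h2 := h.norm_sub_corner_le hu y
  rw [norm_sub_rev] at h2
  have := norm_sub_le_norm_sub_add_norm_sub (u x) (u (corner 0)) (u y)
  linarith

/-! ### Cells of higher level -/

/-- The map `F_w = F_{w_1} ∘ ⋯ ∘ F_{w_m}`. -/
def wordMap : List (Fin 3) → SG → SG
  | [] => id
  | i :: w => cellMap i ∘ wordMap w

theorem continuous_wordMap (w : List (Fin 3)) : Continuous (wordMap w) := by
  induction w with
  | nil => exact continuous_id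
  | cons i w ih => exact (continuous_cellMap i).comp ih

theorem exists_wordMap (m : ℕ) (x : SG) : ∃ w : List (Fin 3), w.length = m ∧ ∃ y, wordMap w y = x := by
  induction m generalizing x with
  | zero => exact ⟨[], rfl, x, rfl⟩
  | succ m ih =>
    obtain ⟨i, y, rfl⟩ := exists_cellMap x
    obtain ⟨w, hw, z, rfl⟩ := ih y
    exact ⟨i :: w, by simp [hw], z, rfl⟩

/-- A neighbourhood of `x` avoids the finitely many closed cells of level `m` that do not contain
`x`; any cell of a nearby `y` must then contain `x`. The cell depends on `y`, as `x` may lie in two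
cells. -/
theorem eventually_common_cell (m : ℕ) (x : SG) : ∀ᶠ y in nhds x, ∃ w : List (Fin 3),
    w.length = m ∧ x ∈ Set.range (wordMap w) ∧ y ∈ Set.range (wordMap w) := by
  have hfin : {w : List (Fin 3) | w.length = m}.Finite := List.finite_length_eq _ _
  have h : ∀ᶠ y in nhds x, ∀ w ∈ {w : List (Fin 3) | w.length = m},
      x ∉ Set.range (wordMap w) → y ∉ Set.range (wordMap w) := by
    rw [Filter.eventually_all_finite hfin]
    intro w _
    by_cases hx : x ∈ Set.range (wordMap w)
    · exact Filter.Eventually.of_forall fun y h => absurd hx h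
    · have : IsClosed (Set.range (wordMap w)) := (isCompact_range (continuous_wordMap w)).isClosed
      filter_upwards [this.isOpen_compl.mem_nhds hx] with y hy _
      exact hy
  filter_upwards [h] with y hy
  obtain ⟨w, hw, hyw⟩ := exists_wordMap m y
  exact ⟨w, hw, by_contra fun hx => hy w hw hx hyw, hyw⟩

theorem EnergyLE.comp_wordMap {u : SG → ℂ} {B : ℝ} (h : EnergyLE u B) (w : List (Fin 3)) :
    EnergyLE (u ∘ wordMap w) ((3 / 5) ^ w.length * B) := by
  induction w generalizing u B with
  | nil => simpa [wordMap] using h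
  | cons i w ih =>
    have := ih (h.comp_cellMap i)
    rw [← mul_assoc, ← pow_succ] at this
    exact this

/-- Functions with a common bound of the energy are equicontinuous. -/
theorem eventually_norm_sub_lt (B : ℝ) {ε : ℝ} (hε : 0 < ε) (x : SG) : ∀ᶠ y in nhds x,
    ∀ u : SG → ℂ, Continuous u → EnergyLE u B → ‖u x - u y‖ < ε := by
  -- This is the bound for the oscillation on a cell of level `m`, the same for all functions with
  -- energy at most `B`.
  have ht : Filter.Tendsto (fun m : ℕ => 8 * Real.sqrt ((3 / 5 : ℝ) ^ m * B)) Filter.atTop (nhds 0) := by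
    have h0 : Filter.Tendsto (fun m : ℕ => (3 / 5 : ℝ) ^ m * B) Filter.atTop (nhds 0) := by
      simpa using (tendsto_pow_atTop_nhds_zero_of_lt_one (by norm_num)
        (by norm_num : (3 / 5 : ℝ) < 1)).mul_const B
    simpa using ((Real.continuous_sqrt.tendsto 0).comp (by simpa using h0)).const_mul 8
  obtain ⟨m, hm⟩ := (ht.eventually (gt_mem_nhds hε)).exists
  filter_upwards [eventually_common_cell m x] with y ⟨w, hw, ⟨a, ha⟩, ⟨b, hb⟩⟩ u hu hB
  have := (hB.comp_wordMap w).norm_sub_le (hu.comp (continuous_wordMap w)) a b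
  rw [hw] at this
  simp only [Function.comp, ha, hb] at this
  exact this.trans_lt hm

/-! ### Operations on functions of finite energy -/

theorem graphNormSq_add_le (m : ℕ) (u v : SG → ℂ) :
    graphNormSq m (u + v) ≤ 2 * (graphNormSq m u + graphNormSq m v) := by
  have h := graphNormSq_nonneg m (u + (-1 : ℂ) • v)
  simp only [graphNormSq, graphEnergy_add_left, graphEnergy_add_right, graphEnergy_smul_left,
    graphEnergy_smul_right] at h ⊢
  simp at h ⊢
  linarith

theorem EnergyLE.add {u v : SG → ℂ} {A B : ℝ} (hu : EnergyLE u A) (hv : EnergyLE v B) :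
    EnergyLE (u + v) (2 * (A + B)) := by
  intro m
  have h1 := mul_le_mul_of_nonneg_left (graphNormSq_add_le m u v) (show (0 : ℝ) ≤ (5 / 3) ^ m by positivity)
  linarith [hu m, hv m]

theorem graphNormSq_smul (m : ℕ) (c : ℂ) (u : SG → ℂ) :
    graphNormSq m (c • u) = ‖c‖ ^ 2 * graphNormSq m u := by
  rw [graphNormSq, graphEnergy_smul_left, graphEnergy_smul_right, ← mul_assoc, Complex.mul_conj,
    Complex.re_ofReal_mul, Complex.normSq_eq_norm_sq]
  rfl

theorem EnergyLE.smul {u : SG → ℂ} {A : ℝ} (hu : EnergyLE u A) (c : ℂ) :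
    EnergyLE (c • u) (‖c‖ ^ 2 * A) := by
  intro m
  have := mul_le_mul_of_nonneg_left (hu m) (sq_nonneg ‖c‖)
  rw [graphNormSq_smul]
  linarith

theorem graphNormSq_conj (m : ℕ) (u : SG → ℂ) :
    graphNormSq m (fun x => starRingEnd ℂ (u x)) = graphNormSq m u := by
  induction m generalizing u with
  | zero => simp only [graphNormSq_zero, ← map_sub, RCLike.norm_conj]
  | succ m ih =>
    simp only [graphNormSq_succ]
    exact Finset.sum_congr rfl fun i _ => ih _

theorem norm_mul_sub_mul_sq_le {a b : ℝ} {z z' w w' : ℂ} (hz : ‖z‖ ≤ a) (hw : ‖w'‖ ≤ b) :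
    ‖z * w - z' * w'‖ ^ 2 ≤ 2 * (a ^ 2 * ‖w - w'‖ ^ 2 + b ^ 2 * ‖z - z'‖ ^ 2) := by
  have h : z * w - z' * w' = z * (w - w') + (z - z') * w' := by ring
  have h1 : ‖z * w - z' * w'‖ ≤ a * ‖w - w'‖ + b * ‖z - z'‖ := by
    rw [h]
    refine (norm_add_le _ _).trans ?_
    rw [norm_mul, norm_mul, mul_comm ‖z - z'‖]
    gcongr
  calc ‖z * w - z' * w'‖ ^ 2 ≤ (a * ‖w - w'‖ + b * ‖z - z'‖) ^ 2 := by gcongr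
    _ ≤ _ := by nlinarith [sq_nonneg (a * ‖w - w'‖ - b * ‖z - z'‖)]

theorem graphNormSq_mul_le {a b : ℝ} (m : ℕ) {u v : SG → ℂ} (hu : ∀ x, ‖u x‖ ≤ a)
    (hv : ∀ x, ‖v x‖ ≤ b) :
    graphNormSq m (u * v) ≤ 2 * (a ^ 2 * graphNormSq m v + b ^ 2 * graphNormSq m u) := by
  induction m generalizing u v with
  | zero =>
    simp only [graphNormSq_zero, Pi.mul_apply]
    have h1 := norm_mul_sub_mul_sq_le (z' := u (corner 1)) (w := v (corner 0)) (hu (corner 0)) (hv (corner 1))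
    have h2 := norm_mul_sub_mul_sq_le (z' := u (corner 2)) (w := v (corner 0)) (hu (corner 0)) (hv (corner 2))
    have h3 := norm_mul_sub_mul_sq_le (z' := u (corner 2)) (w := v (corner 1)) (hu (corner 1)) (hv (corner 2))
    linarith
  | succ m ih =>
    simp only [graphNormSq_succ, Finset.mul_sum, ← Finset.sum_add_distrib]
    refine Finset.sum_le_sum fun i _ => ?_
    exact ih (fun x => hu _) fun x => hv _

theorem EnergyLE.mul {u v : SG → ℂ} {A B a b : ℝ} (hu : EnergyLE u A) (hv : EnergyLE v B)
    (ha : ∀ x, ‖u x‖ ≤ a) (hb : ∀ x, ‖v x‖ ≤ b) :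
    EnergyLE (u * v) (2 * (a ^ 2 * B + b ^ 2 * A)) := by
  intro m
  have h1 := mul_le_mul_of_nonneg_left (graphNormSq_mul_le m ha hb) (show (0 : ℝ) ≤ (5 / 3) ^ m by positivity)
  have h2 := mul_le_mul_of_nonneg_left (hu m) (sq_nonneg b)
  have h3 := mul_le_mul_of_nonneg_left (hv m) (sq_nonneg a)
  linarith

theorem FiniteEnergy.add {u v : SG → ℂ} (hu : FiniteEnergy u) (hv : FiniteEnergy v) :
    FiniteEnergy (u + v) := by
  obtain ⟨cu, A, hA⟩ := finiteEnergy_iff.mp hu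
  obtain ⟨cv, B, hB⟩ := finiteEnergy_iff.mp hv
  exact finiteEnergy_iff.mpr ⟨cu.add cv, _, hA.add hB⟩

theorem FiniteEnergy.smul {u : SG → ℂ} (hu : FiniteEnergy u) (c : ℂ) : FiniteEnergy (c • u) := by
  obtain ⟨cu, A, hA⟩ := finiteEnergy_iff.mp hu
  exact finiteEnergy_iff.mpr ⟨cu.const_smul c, _, hA.smul c⟩

theorem FiniteEnergy.conj {u : SG → ℂ} (hu : FiniteEnergy u) :
    FiniteEnergy (fun x => starRingEnd ℂ (u x)) := by
  obtain ⟨cu, A, hA⟩ := finiteEnergy_iff.mp hu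
  exact finiteEnergy_iff.mpr ⟨Complex.continuous_conj.comp cu, A, fun m => by
    rw [graphNormSq_conj]; exact hA m⟩

theorem finiteEnergy_zero : FiniteEnergy 0 := by
  refine finiteEnergy_iff.mpr ⟨continuous_const, 0, fun m => ?_⟩
  have := graphNormSq_smul m 0 0
  rw [zero_smul] at this
  rw [this]
  simp

theorem exists_norm_le {u : SG → ℂ} (hu : Continuous u) : ∃ a, ∀ x, ‖u x‖ ≤ a := by
  obtain ⟨a, ha⟩ := isCompact_univ.exists_bound_of_continuousOn (f := u) hu.continuousOn
  exact ⟨a, fun x => ha x (Set.mem_univ x)⟩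

theorem FiniteEnergy.mul {u v : SG → ℂ} (hu : FiniteEnergy u) (hv : FiniteEnergy v) :
    FiniteEnergy (u * v) := by
  obtain ⟨cu, A, hA⟩ := finiteEnergy_iff.mp hu
  obtain ⟨cv, B, hB⟩ := finiteEnergy_iff.mp hv
  obtain ⟨a, ha⟩ := exists_norm_le cu
  obtain ⟨b, hb⟩ := exists_norm_le cv
  exact finiteEnergy_iff.mpr ⟨cu.mul cv, _, hA.mul hB ha hb⟩

theorem finiteEnergy_of_comp_cellMap {u : SG → ℂ} (h : ∀ i, FiniteEnergy (u ∘ cellMap i)) :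
    FiniteEnergy u := by
  choose hc B hB using fun i => finiteEnergy_iff.mp (h i)
  exact finiteEnergy_iff.mpr ⟨continuous_of_comp_cellMap hc, _, energyLE_of_comp_cellMap hB⟩

theorem FiniteEnergy.comp_cellMap {u : SG → ℂ} (hu : FiniteEnergy u) (i : Fin 3) :
    FiniteEnergy (u ∘ cellMap i) := by
  obtain ⟨cu, A, hA⟩ := finiteEnergy_iff.mp hu
  exact finiteEnergy_iff.mpr ⟨cu.comp (continuous_cellMap i), _, hA.comp_cellMap i⟩

/-! ### The energy form -/

theorem FiniteEnergy.exists_hasEnergy_self {u : SG → ℂ} (hu : FiniteEnergy u) :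
    ∃ e, HasEnergy u u e := by
  obtain ⟨cu, A, hA⟩ := finiteEnergy_iff.mp hu
  have h := tendsto_atTop_ciSup (monotone_energy u) ⟨A, by rintro _ ⟨m, rfl⟩; exact hA m⟩
  refine ⟨_, ((Complex.continuous_ofReal.tendsto _).comp h).congr fun m => ?_⟩
  simp [graphEnergy_self]

theorem graphEnergy_polarization (m : ℕ) (u v : SG → ℂ) :
    graphEnergy m u v = (1 / 4 : ℂ) * (graphEnergy m (u + v) (u + v)
      - graphEnergy m (u + (-1 : ℂ) • v) (u + (-1 : ℂ) • v)
      + Complex.I * graphEnergy m (u + Complex.I • v) (u + Complex.I • v)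
      - Complex.I * graphEnergy m (u + (-Complex.I) • v) (u + (-Complex.I) • v)) := by
  simp only [graphEnergy_add_left, graphEnergy_add_right, graphEnergy_smul_left,
    graphEnergy_smul_right, map_neg, Complex.conj_I, map_one]
  ring_nf
  simp only [Complex.I_sq]
  ring

theorem FiniteEnergy.exists_hasEnergy {u v : SG → ℂ} (hu : FiniteEnergy u) (hv : FiniteEnergy v) :
    ∃ e, HasEnergy u v e := by
  obtain ⟨e1, h1⟩ := (hu.add hv).exists_hasEnergy_self
  obtain ⟨e2, h2⟩ := (hu.add (hv.smul (-1))).exists_hasEnergy_self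
  obtain ⟨e3, h3⟩ := (hu.add (hv.smul Complex.I)).exists_hasEnergy_self
  obtain ⟨e4, h4⟩ := (hu.add (hv.smul (-Complex.I))).exists_hasEnergy_self
  refine ⟨_, (((h1.sub h2).add (h3.const_mul Complex.I)).sub (h4.const_mul Complex.I)
    |>.const_mul (1 / 4)).congr fun m => ?_⟩
  rw [graphEnergy_polarization m u v]
  ring

theorem HasEnergy.unique {u v : SG → ℂ} {e e' : ℂ} (h : HasEnergy u v e) (h' : HasEnergy u v e') :
    e = e' := tendsto_nhds_unique h h'

theorem HasEnergy.add_left {u u' v : SG → ℂ} {e e' : ℂ} (h : HasEnergy u v e)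
    (h' : HasEnergy u' v e') : HasEnergy (u + u') v (e + e') :=
  (Filter.Tendsto.add h h').congr fun m => by rw [graphEnergy_add_left, mul_add]

theorem HasEnergy.smul_left {u v : SG → ℂ} {e : ℂ} (h : HasEnergy u v e) (c : ℂ) :
    HasEnergy (c • u) v (c * e) :=
  (Filter.Tendsto.const_mul c h).congr fun m => by rw [graphEnergy_smul_left]; ring

theorem HasEnergy.symm {u v : SG → ℂ} {e : ℂ} (h : HasEnergy u v e) :
    HasEnergy v u (starRingEnd ℂ e) :=
  ((Complex.continuous_conj.tendsto _).comp h).congr fun m => by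
    simp only [Function.comp, map_mul, map_pow, map_div₀, map_ofNat, graphEnergy_conj_symm]

theorem HasEnergy.energyLE {u : SG → ℂ} {e : ℂ} (h : HasEnergy u u e) : EnergyLE u e.re := by
  intro m
  have h1 : Filter.Tendsto (fun m : ℕ => (5 / 3 : ℝ) ^ m * graphNormSq m u) Filter.atTop
      (nhds e.re) := by
    refine ((Complex.continuous_re.tendsto _).comp h).congr fun m => ?_
    simp only [graphEnergy_self, Function.comp]
    rw [show (5 / 3 : ℂ) = ((5 / 3 : ℝ) : ℂ) by push_cast; rfl, ← Complex.ofReal_pow,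
      ← Complex.ofReal_mul, Complex.ofReal_re]
  exact (monotone_energy u).ge_of_tendsto h1 m

theorem HasEnergy.re_le {u : SG → ℂ} {e : ℂ} {B : ℝ} (h : HasEnergy u u e) (hB : EnergyLE u B) :
    e.re ≤ B := by
  refine le_of_tendsto' ((Complex.continuous_re.tendsto _).comp h) fun m => ?_
  simp only [graphEnergy_self, Function.comp]
  rw [show (5 / 3 : ℂ) = ((5 / 3 : ℝ) : ℂ) by push_cast; rfl, ← Complex.ofReal_pow,
    ← Complex.ofReal_mul, Complex.ofReal_re]
  exact hB m

/-! ### Harmonic functions -/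

/-- The values at the vertices of the cell `F_i(SG)` of the harmonic function with boundary
values `a`. -/
def harmonicCell (i : Fin 3) (a : Fin 3 → ℝ) (j : Fin 3) : ℝ :=
  if i = j then a i else (∑ k, a k + a i + a j) / 5

theorem harmonicCell_symm (i j : Fin 3) (a : Fin 3 → ℝ) :
    harmonicCell i a j = harmonicCell j a i := by
  unfold harmonicCell
  by_cases h : i = j
  · rw [if_pos h, if_pos h.symm, h]
  · rw [if_neg h, if_neg (Ne.symm h)]; ring

/-- The contraction factor 3/5 is what makes `harmonicApprox` converge uniformly. -/
theorem harmonicCell_osc {a : Fin 3 → ℝ} {r : ℝ} (h : ∀ i j, |a i - a j| ≤ r) (i j k : Fin 3) :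
    |harmonicCell i a j - harmonicCell i a k| ≤ 3 / 5 * r := by
  have h01 := abs_le.mp (h 0 1)
  have h02 := abs_le.mp (h 0 2)
  have h12 := abs_le.mp (h 1 2)
  rw [abs_le]
  fin_cases i <;> fin_cases j <;> fin_cases k <;>
    simp [harmonicCell, Fin.sum_univ_three] <;>
    first | linarith | (constructor <;> linarith)

/-- The approximations of the harmonic function with boundary values `a`. -/
def harmonicApprox : ℕ → (Fin 3 → ℝ) → SG → ℝ
  | 0, a => fun x => ∑ i, bary i x * a i
  | n + 1, a => glue fun i => harmonicApprox n (harmonicCell i a)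

theorem harmonicApprox_corner (n : ℕ) (a : Fin 3 → ℝ) (i : Fin 3) :
    harmonicApprox n a (corner i) = a i := by
  induction n generalizing a i with
  | zero =>
    change ∑ j, bary j (vertex i) * a j = a i
    simp [bary_vertex]
  | succ n ih =>
    rw [harmonicApprox, glue_corner]
    · rw [ih, harmonicCell, if_pos rfl]
    · intro i j
      rw [ih, ih, harmonicCell_symm]

theorem harmonicApprox_cellMap (n : ℕ) (a : Fin 3 → ℝ) (i : Fin 3) :
    harmonicApprox (n + 1) a ∘ cellMap i = harmonicApprox n (harmonicCell i a) := by
  rw [harmonicApprox, glue_comp (f := fun i => harmonicApprox n (harmonicCell i a))]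
  intro i j
  simp only [harmonicApprox_corner, harmonicCell_symm i j]

theorem continuous_harmonicApprox (n : ℕ) (a : Fin 3 → ℝ) : Continuous (harmonicApprox n a) := by
  induction n generalizing a with
  | zero =>
    exact continuous_finsetSum _ fun i _ =>
      ((continuous_bary i).comp continuous_subtype_val).mul continuous_const
  | succ n ih =>
    refine continuous_of_comp_cellMap fun i => ?_
    rw [harmonicApprox_cellMap]
    exact ih _

theorem harmonicApprox_zero_sub_le {a : Fin 3 → ℝ} {r : ℝ} (h : ∀ i j, |a i - a j| ≤ r)
    (i : Fin 3) (x : SG) : |harmonicApprox 0 a x - a i| ≤ r := by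
  have h1 : harmonicApprox 0 a x - a i = ∑ j, bary j x * (a j - a i) := by
    simp only [harmonicApprox, mul_sub, Finset.sum_sub_distrib, ← Finset.sum_mul, sum_bary, one_mul]
  rw [h1]
  calc |∑ j, bary j x * (a j - a i)| ≤ ∑ j, |bary j x * (a j - a i)| := Finset.abs_sum_le_sum_abs _ _
    _ ≤ ∑ j, bary j x * r := by
      refine Finset.sum_le_sum fun j _ => ?_
      rw [abs_mul, abs_of_nonneg (bary_nonneg j x)]
      exact mul_le_mul_of_nonneg_left (h j i) (bary_nonneg j x)
    _ = r := by rw [← Finset.sum_mul, sum_bary, one_mul]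

/-- On a cell of level `n` both approximations stay close to a common vertex value, within the
oscillation of the vertex values, which has shrunk to `(3/5)^n r`. -/
theorem harmonicApprox_succ_sub_le (n : ℕ) {a : Fin 3 → ℝ} {r : ℝ} (h : ∀ i j, |a i - a j| ≤ r)
    (x : SG) : |harmonicApprox (n + 1) a x - harmonicApprox n a x| ≤ 3 * r * (3 / 5) ^ n := by
  have hr : 0 ≤ r := (abs_nonneg _).trans (h 0 0)
  obtain ⟨i, y, rfl⟩ := exists_cellMap x
  have e := congrFun (harmonicApprox_cellMap n a i) y
  rw [Function.comp] at e
  rw [e]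
  induction n generalizing a r i y with
  | zero =>
    have h1 := harmonicApprox_zero_sub_le (harmonicCell_osc h i) i y
    have h2 := harmonicApprox_zero_sub_le h i (cellMap i y)
    rw [harmonicCell, if_pos rfl] at h1
    rw [abs_le] at h1 h2 ⊢
    constructor <;> linarith
  | succ n ih =>
    have e' := congrFun (harmonicApprox_cellMap n a i) y
    rw [Function.comp] at e'
    rw [e']
    obtain ⟨j, z, rfl⟩ := exists_cellMap y
    have e'' := congrFun (harmonicApprox_cellMap n (harmonicCell i a) j) z
    rw [Function.comp] at e''
    rw [e'']
    refine (ih (harmonicCell_osc h i) (by positivity) j z e'').trans (le_of_eq ?_)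
    ring

theorem exists_harmonic : ∃ H : (Fin 3 → ℝ) → SG → ℝ, (∀ a, Continuous (H a)) ∧
    (∀ a i, H a (corner i) = a i) ∧ ∀ a i, H a ∘ cellMap i = H (harmonicCell i a) := by
  have key : ∀ a : Fin 3 → ℝ, ∃ g : C(SG, ℝ), ∀ x,
      Filter.Tendsto (fun n => harmonicApprox n a x) Filter.atTop (nhds (g x)) := by
    intro a
    set f : ℕ → C(SG, ℝ) := fun n => ⟨harmonicApprox n a, continuous_harmonicApprox n a⟩
    have hr : ∀ i j, |a i - a j| ≤ ∑ i, ∑ j, |a i - a j| := fun i j =>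
      (Finset.single_le_sum (f := fun j => |a i - a j|) (fun _ _ => abs_nonneg _)
        (Finset.mem_univ j)).trans
      (Finset.single_le_sum (f := fun i => ∑ j, |a i - a j|)
        (fun _ _ => Finset.sum_nonneg fun _ _ => abs_nonneg _) (Finset.mem_univ i))
    have hc : CauchySeq f := by
      refine cauchySeq_of_le_geometric (3 / 5) (3 * ∑ i, ∑ j, |a i - a j|) (by norm_num) fun n => ?_
      rw [dist_comm, ContinuousMap.dist_le]
      · intro x
        exact harmonicApprox_succ_sub_le n hr x
      · have := (abs_nonneg _).trans (hr 0 0)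
        positivity
    obtain ⟨g, hg⟩ := cauchySeq_tendsto_of_complete hc
    exact ⟨g, fun x => ((continuous_eval_const x).tendsto g).comp hg⟩
  choose H hH using key
  refine ⟨fun a => H a, fun a => (H a).continuous, fun a i => ?_, fun a i => ?_⟩
  · refine tendsto_nhds_unique (hH a (corner i)) ?_
    simp only [harmonicApprox_corner]
    exact tendsto_const_nhds
  · funext x
    refine tendsto_nhds_unique ((Filter.tendsto_add_atTop_iff_nat 1).mpr (hH a (cellMap i x))) ?_
    exact (hH (harmonicCell i a) x).congr fun n => (congrFun (harmonicApprox_cellMap n a i) x).symm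

/-- There are functions of finite energy with given values at the vertices. -/
theorem exists_finiteEnergy_corner (a : Fin 3 → ℝ) :
    ∃ h : SG → ℂ, FiniteEnergy h ∧ ∀ i, h (corner i) = a i := by
  obtain ⟨H, hc, hv, hs⟩ := exists_harmonic
  -- The renormalized energy of a harmonic function is the same at all levels, so its value at level
  -- zero serves as the bound.
  refine ⟨fun x => (H a x : ℂ), finiteEnergy_iff.mpr
    ⟨Complex.continuous_ofReal.comp (hc a), graphNormSq 0 fun x => (H a x : ℂ), fun m => le_of_eq ?_⟩,
    fun i => by simp [hv]⟩
  have hsc : ∀ a i, (fun x => (H a x : ℂ)) ∘ cellMap i = fun x => (H (harmonicCell i a) x : ℂ) := by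
    intro a i
    rw [← hs]
    rfl
  have h0 : ∀ a : Fin 3 → ℝ, graphNormSq 0 (fun x => (H a x : ℂ)) =
      (a 0 - a 1) ^ 2 + (a 0 - a 2) ^ 2 + (a 1 - a 2) ^ 2 := by
    intro a
    simp [graphNormSq_zero, hv, norm_sub_sq]
  induction m generalizing a with
  | zero => simp
  | succ m ih =>
    rw [graphNormSq_succ, pow_succ', mul_assoc, Finset.mul_sum]
    simp only [hsc, ih, h0]
    simp [harmonicCell, Fin.sum_univ_three]
    ring

/-! ### Density of the functions of finite energy -/

theorem dist_cellMap (i : Fin 3) (x y : SG) : dist (cellMap i x) (cellMap i y) = 1 / 2 * dist x y := by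
  rw [Subtype.dist_eq, Subtype.dist_eq, dist_eq_norm, dist_eq_norm]
  have : ‖(1 / 2 : ℝ)‖ = 1 / 2 := by norm_num
  rw [← this, ← norm_smul]
  congr 1
  simp only [cellMap, contraction]
  module

theorem dist_wordMap (w : List (Fin 3)) (x y : SG) :
    dist (wordMap w x) (wordMap w y) = (1 / 2) ^ w.length * dist x y := by
  induction w with
  | nil => simp [wordMap]
  | cons i w ih =>
    change dist (cellMap i (wordMap w x)) (cellMap i (wordMap w y)) = _
    rw [dist_cellMap, ih, List.length_cons, pow_succ]
    ring

theorem finiteEnergy_const (c : ℂ) : FiniteEnergy fun _ => c := by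
  refine finiteEnergy_iff.mpr ⟨continuous_const, 0, fun m => ?_⟩
  have : graphNormSq m (fun _ => c) = 0 := by
    induction m with
    | zero => simp [graphNormSq_zero]
    | succ m ih =>
      rw [graphNormSq_succ]
      exact Finset.sum_eq_zero fun i _ => ih
  rw [this, mul_zero]

/-- The approximation is the interpolation of `f` that is harmonic on every cell of level `m`. It
keeps the values of `f` at the vertices, which is what allows the pieces to be glued, and its
constant does not depend on `m`. -/
theorem exists_finiteEnergy_approx_of_osc : ∃ C : ℝ, ∀ (m : ℕ) (f : SG → ℂ) (r : ℝ),
    (∀ w : List (Fin 3), w.length = m → ∀ x y, ‖f (wordMap w x) - f (wordMap w y)‖ ≤ r) →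
    ∃ g, FiniteEnergy g ∧ (∀ i, g (corner i) = f (corner i)) ∧ ∀ x, ‖g x - f x‖ ≤ C * r := by
  choose h hF hv using fun k : Fin 3 => exists_finiteEnergy_corner (Pi.single k 1)
  choose K hK using fun k => exists_norm_le (hF k).1
  -- The interpolation is written relative to the value at `p₀`, so `h 0` does not occur; its
  -- coefficients and the error of that value are each at most `r`.
  refine ⟨1 + (K 1 + K 2), fun m => ?_⟩
  induction m with
  | zero =>
    intro f r hr
    have hr' : ∀ x y, ‖f x - f y‖ ≤ r := hr [] rfl
    have hr0 : 0 ≤ r := (norm_nonneg _).trans (hr' (corner 0) (corner 0))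
    refine ⟨(fun _ => f (corner 0)) + ((f (corner 1) - f (corner 0)) • h 1 +
      (f (corner 2) - f (corner 0)) • h 2),
      (finiteEnergy_const _).add (((hF 1).smul _).add ((hF 2).smul _)), fun i => ?_, fun x => ?_⟩
    · simp only [Pi.add_apply, Pi.smul_apply, hv, smul_eq_mul]
      fin_cases i <;> simp
    · have e : ((fun _ => f (corner 0)) + ((f (corner 1) - f (corner 0)) • h 1 +
          (f (corner 2) - f (corner 0)) • h 2) : SG → ℂ) x - f x = (f (corner 0) - f x) +
          ((f (corner 1) - f (corner 0)) * h 1 x + (f (corner 2) - f (corner 0)) * h 2 x) := by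
        simp only [Pi.add_apply, Pi.smul_apply, smul_eq_mul]
        ring
      rw [e]
      refine (norm_add_le _ _).trans ?_
      have e1 : ‖(f (corner 1) - f (corner 0)) * h 1 x‖ ≤ r * K 1 := by
        rw [norm_mul]
        exact mul_le_mul (hr' _ _) (hK 1 x) (norm_nonneg _) hr0
      have e2 : ‖(f (corner 2) - f (corner 0)) * h 2 x‖ ≤ r * K 2 := by
        rw [norm_mul]
        exact mul_le_mul (hr' _ _) (hK 2 x) (norm_nonneg _) hr0
      have e3 := norm_add_le ((f (corner 1) - f (corner 0)) * h 1 x)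
        ((f (corner 2) - f (corner 0)) * h 2 x)
      have e4 := hr' (corner 0) x
      linarith
  | succ m ih =>
    intro f r hr
    choose g hg hgc hgb using fun i => ih (f ∘ cellMap i) r fun w hw x y =>
      hr (i :: w) (by simp [hw]) x y
    have hcompat : ∀ i j, g i (corner j) = g j (corner i) := fun i j => by
      rw [hgc, hgc, Function.comp, Function.comp, cellMap_corner]
    refine ⟨glue g, finiteEnergy_of_comp_cellMap fun i => by rw [glue_comp hcompat]; exact hg i,
      fun i => ?_, fun x => ?_⟩
    · rw [glue_corner hcompat, hgc, Function.comp, cellMap_corner_self]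
    · obtain ⟨i, y, rfl⟩ := exists_cellMap x
      have := hgb i y
      rwa [← glue_comp hcompat i] at this

theorem exists_finiteEnergy_approx {f : SG → ℂ} (hf : Continuous f) {ε : ℝ} (hε : 0 < ε) :
    ∃ g, FiniteEnergy g ∧ ∀ x, ‖g x - f x‖ < ε := by
  obtain ⟨C, hC⟩ := exists_finiteEnergy_approx_of_osc
  have hu := CompactSpace.uniformContinuous_of_continuous hf
  rw [Metric.uniformContinuous_iff] at hu
  obtain ⟨δ, hδ, h⟩ := hu (ε / (|C| + 1)) (by positivity)
  obtain ⟨D, hD⟩ := Metric.isBounded_iff.mp (isCompact_univ (X := SG)).isBounded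
  obtain ⟨m, hm⟩ := exists_pow_lt_of_lt_one (show 0 < δ / (|D| + 1) by positivity)
    (by norm_num : (1 / 2 : ℝ) < 1)
  obtain ⟨g, hg, -, hb⟩ := hC m f (ε / (|C| + 1)) fun w hw x y => by
    rw [← dist_eq_norm]
    refine (h ?_).le
    rw [dist_wordMap, hw]
    have h1 : dist x y ≤ |D| := (hD (Set.mem_univ x) (Set.mem_univ y)).trans (le_abs_self D)
    calc (1 / 2 : ℝ) ^ m * dist x y ≤ (1 / 2) ^ m * (|D| + 1) := by gcongr; linarith
      _ < δ := by rwa [← lt_div_iff₀ (by positivity)]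
  refine ⟨g, hg, fun x => (hb x).trans_lt ?_⟩
  calc C * (ε / (|C| + 1)) ≤ |C| * (ε / (|C| + 1)) := by gcongr; exact le_abs_self C
    _ < (|C| + 1) * (ε / (|C| + 1)) := by gcongr; linarith
    _ = ε := by field_simp

/-! ### The Hilbert space of functions of finite energy -/

/-- The functions of finite energy, as a subspace of all functions. -/
def finiteEnergySubmodule : Submodule ℂ (SG → ℂ) where
  carrier := {u | FiniteEnergy u}
  add_mem' := FiniteEnergy.add
  zero_mem' := finiteEnergy_zero
  smul_mem' c _ hu := hu.smul c

/-- The space `ℱ` of functions of finite energy, with the inner product `ℰ(u, v) + ⟨u, v⟩`. -/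
def Dom : Type := finiteEnergySubmodule

namespace Dom

instance : AddCommGroup Dom := inferInstanceAs (AddCommGroup finiteEnergySubmodule)
instance : Module ℂ Dom := inferInstanceAs (Module ℂ finiteEnergySubmodule)
instance : CoeFun Dom (fun _ => SG → ℂ) := ⟨fun u => u.1⟩

theorem finiteEnergy (u : Dom) : FiniteEnergy u := u.2
theorem continuous (u : Dom) : Continuous u := u.2.1

@[ext] theorem ext {u v : Dom} (h : ∀ x, u x = v x) : u = v := Subtype.ext (funext h)

theorem coe_add (u v : Dom) : ((u + v : Dom) : SG → ℂ) = (u : SG → ℂ) + v := rfl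
theorem coe_smul (c : ℂ) (u : Dom) : ((c • u : Dom) : SG → ℂ) = c • (u : SG → ℂ) := rfl

/-- The energy form. -/
def form (u v : Dom) : ℂ := (u.finiteEnergy.exists_hasEnergy v.finiteEnergy).choose

theorem hasEnergy_form (u v : Dom) : HasEnergy u v (form u v) :=
  (u.finiteEnergy.exists_hasEnergy v.finiteEnergy).choose_spec

theorem integrable_mul_conj (u v : Dom) :
    Integrable (fun x => u x * starRingEnd ℂ (v x)) sgMeasure :=
  (u.continuous.mul (Complex.continuous_conj.comp v.continuous)).integrable_of_hasCompactSupport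
    (HasCompactSupport.of_compactSpace _)

theorem integrable_norm_sq (u : Dom) : Integrable (fun x => ‖u x‖ ^ 2) sgMeasure :=
  (u.continuous.norm.pow 2).integrable_of_hasCompactSupport (HasCompactSupport.of_compactSpace _)

theorem integral_mul_conj_self (u : Dom) :
    ∫ x, u x * starRingEnd ℂ (u x) ∂sgMeasure = (∫ x, ‖u x‖ ^ 2 ∂sgMeasure : ℝ) := by
  rw [← integral_complex_ofReal]
  refine integral_congr_ae (Filter.Eventually.of_forall fun x => ?_)
  simp only [Complex.mul_conj, Complex.normSq_eq_norm_sq]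

theorem form_re_nonneg (u : Dom) : 0 ≤ (form u u).re :=
  (hasEnergy_form u u).energyLE.nonneg

instance core : InnerProductSpace.Core ℂ Dom where
  -- The arguments are swapped because `form` is linear in its first argument, whereas the inner
  -- product is conjugate linear there.
  inner u v := form v u + ∫ x, v x * starRingEnd ℂ (u x) ∂sgMeasure
  conj_inner_symm u v := by
    rw [map_add, (hasEnergy_form u v).symm.unique (hasEnergy_form v u), ← integral_conj]
    congr 1
    refine integral_congr_ae (Filter.Eventually.of_forall fun x => ?_)
    simp [mul_comm]
  re_inner_nonneg u := by
    rw [integral_mul_conj_self, map_add]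
    refine add_nonneg (form_re_nonneg u) ?_
    simp only [RCLike.re_to_complex, Complex.ofReal_re]
    exact integral_nonneg fun x => sq_nonneg _
  add_left u v w := by
    have h : form w (u + v) = form w u + form w v := by
      have := ((hasEnergy_form w u).symm.add_left (hasEnergy_form w v).symm).symm
      rw [map_add, Complex.conj_conj, Complex.conj_conj] at this
      exact (hasEnergy_form w (u + v)).unique this
    rw [h]
    have : ∫ x, w x * starRingEnd ℂ ((u + v) x) ∂sgMeasure =
        ∫ x, w x * starRingEnd ℂ (u x) ∂sgMeasure + ∫ x, w x * starRingEnd ℂ (v x) ∂sgMeasure := by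
      rw [← integral_add (integrable_mul_conj w u) (integrable_mul_conj w v)]
      refine integral_congr_ae (Filter.Eventually.of_forall fun x => ?_)
      simp only [coe_add, Pi.add_apply, map_add, mul_add]
    rw [this]
    ring
  smul_left u v c := by
    have h : form v (c • u) = starRingEnd ℂ c * form v u := by
      have := ((hasEnergy_form v u).symm.smul_left c).symm
      rw [map_mul, Complex.conj_conj] at this
      exact (hasEnergy_form v (c • u)).unique this
    rw [h, mul_add, ← integral_const_mul]
    congr 1
    refine integral_congr_ae (Filter.Eventually.of_forall fun x => ?_)
    simp only [coe_smul, Pi.smul_apply, smul_eq_mul, map_mul]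
    ring
  definite u h := by
    rw [integral_mul_conj_self] at h
    have h1 := congrArg Complex.re h
    rw [Complex.add_re, Complex.ofReal_re, Complex.zero_re] at h1
    have h2 := form_re_nonneg u
    have h3 : 0 ≤ ∫ x, ‖u x‖ ^ 2 ∂sgMeasure := integral_nonneg fun x => sq_nonneg _
    have h4 : ∫ x, ‖u x‖ ^ 2 ∂sgMeasure = 0 := by linarith
    rw [integral_eq_zero_iff_of_nonneg (fun x => sq_nonneg _) (integrable_norm_sq u)] at h4
    -- Equality almost everywhere becomes equality everywhere, since `u` is continuous and the
    -- measure charges every nonempty open set.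
    have h5 : (fun x => ‖u x‖ ^ 2) = fun _ => 0 :=
      ((u.continuous.norm.pow 2).ae_eq_iff_eq sgMeasure continuous_const).mp h4
    ext x
    have := congrFun h5 x
    change u x = 0
    simpa using this

instance : NormedAddCommGroup Dom := core.toNormedAddCommGroup
instance : InnerProductSpace ℂ Dom := InnerProductSpace.ofCore core.toCore

theorem inner_eq (u v : Dom) :
    inner ℂ u v = form v u + ∫ x, v x * starRingEnd ℂ (u x) ∂sgMeasure := rfl

theorem norm_sq_eq (u : Dom) : ‖u‖ ^ 2 = (form u u).re + ∫ x, ‖u x‖ ^ 2 ∂sgMeasure := by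
  rw [@norm_sq_eq_re_inner ℂ, inner_eq, integral_mul_conj_self]
  simp

theorem energyLE (u : Dom) : EnergyLE u (‖u‖ ^ 2) := by
  intro m
  refine ((hasEnergy_form u u).energyLE m).trans ?_
  rw [norm_sq_eq]
  have : 0 ≤ ∫ x, ‖u x‖ ^ 2 ∂sgMeasure := integral_nonneg fun x => sq_nonneg _
  linarith

theorem norm_sq_le {u : Dom} {A a : ℝ} (hA : EnergyLE u A) (ha : ∀ x, ‖u x‖ ≤ a) :
    ‖u‖ ^ 2 ≤ A + a ^ 2 := by
  rw [norm_sq_eq]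
  refine add_le_add ((hasEnergy_form u u).re_le hA) ?_
  calc ∫ x, ‖u x‖ ^ 2 ∂sgMeasure ≤ ∫ _, a ^ 2 ∂sgMeasure := by
        refine integral_mono (integrable_norm_sq u) (integrable_const _) fun x => ?_
        exact pow_le_pow_left₀ (norm_nonneg _) (ha x) 2
    _ = a ^ 2 := by simp

/-- The sup norm is controlled by the norm of `ℱ`. -/
theorem norm_apply_le (u : Dom) (x : SG) : ‖u x‖ ≤ 9 * ‖u‖ := by
  -- At some point `|u|²` is at most its mean, hence `|u|` is at most `‖u‖` there; the oscillation
  -- adds 8 to give the constant 9.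
  obtain ⟨y, hy⟩ := exists_le_integral (integrable_norm_sq u)
  have h1 : ‖u y‖ ^ 2 ≤ ‖u‖ ^ 2 := by
    rw [norm_sq_eq]
    linarith [form_re_nonneg u]
  have h2 : ‖u y‖ ≤ ‖u‖ := (pow_le_pow_iff_left₀ (norm_nonneg _) (norm_nonneg _) two_ne_zero).mp h1
  have h3 := u.energyLE.norm_sub_le u.continuous x y
  rw [Real.sqrt_sq (norm_nonneg _)] at h3
  have h4 := norm_sub_norm_le (u x) (u y)
  linarith

/-- The embedding of `ℱ` into the continuous functions. -/
def toC : Dom →L[ℂ] C(SG, ℂ) :=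
  LinearMap.mkContinuous
    { toFun := fun u => ⟨u, u.continuous⟩
      map_add' := fun _ _ => rfl
      map_smul' := fun _ _ => rfl } 9 fun u => by
    rw [ContinuousMap.norm_le _ (by positivity)]
    exact fun x => u.norm_apply_le x

theorem toC_apply (u : Dom) (x : SG) : toC u x = u x := rfl

theorem _root_.SierpinskiNLS.tendsto_graphNormSq (m : ℕ) {ι : Type*} {l : Filter ι}
    {f : ι → SG → ℂ} {u : SG → ℂ} (h : ∀ x, Filter.Tendsto (fun n => f n x) l (nhds (u x))) :
    Filter.Tendsto (fun n => graphNormSq m (f n)) l (nhds (graphNormSq m u)) := by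
  induction m generalizing f u with
  | zero =>
    simp only [graphNormSq_zero]
    exact (((((h _).sub (h _)).norm.pow 2).add (((h _).sub (h _)).norm.pow 2))).add
      (((h _).sub (h _)).norm.pow 2)
  | succ m ih =>
    simp only [graphNormSq_succ]
    exact tendsto_finsetSum _ fun i _ => ih fun x => h _

theorem _root_.SierpinskiNLS.EnergyLE.of_tendsto {ι : Type*} {l : Filter ι} [l.NeBot]
    {f : ι → SG → ℂ} {u : SG → ℂ} {B : ℝ} (h : ∀ x, Filter.Tendsto (fun n => f n x) l (nhds (u x)))
    (hB : ∀ᶠ n in l, EnergyLE (f n) B) : EnergyLE u B := fun m =>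
  le_of_tendsto ((tendsto_graphNormSq m h).const_mul _) (hB.mono fun _ h => h m)

/-- A Cauchy sequence converges uniformly. Each graph energy is continuous under pointwise
convergence, so energy bounds survive in the limit, both for the limit itself and for its distance
to the sequence. -/
instance : CompleteSpace Dom := by
  refine Metric.complete_of_cauchySeq_tendsto fun f hf => ?_
  obtain ⟨g, hg⟩ := cauchySeq_tendsto_of_complete (toC.uniformContinuous.comp_cauchySeq hf)
  have hp : ∀ x, Filter.Tendsto (fun n => f n x) Filter.atTop (nhds (g x)) := fun x =>
    ((continuous_eval_const x).tendsto g).comp hg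
  obtain ⟨M, hM⟩ := hf.norm_bddAbove
  have hM' : ∀ n, ‖f n‖ ≤ M := fun n => hM ⟨n, rfl⟩
  have hgE : EnergyLE g (M ^ 2) := EnergyLE.of_tendsto hp (Filter.Eventually.of_forall fun n m =>
    ((f n).energyLE m).trans (pow_le_pow_left₀ (norm_nonneg _) (hM' n) 2))
  set G : Dom := ⟨g, finiteEnergy_iff.mpr ⟨g.continuous, _, hgE⟩⟩ with hG
  refine ⟨G, ?_⟩
  rw [Metric.tendsto_atTop]
  intro ε hε
  -- The squared distance is at most `(ε/10)² + (9ε/10)²`, which is less than `ε²`.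
  obtain ⟨N, hN⟩ := Metric.cauchySeq_iff.mp hf (ε / 10) (by positivity)
  refine ⟨N, fun n hn => ?_⟩
  have hs : ∀ k ≥ N, ‖f n - f k‖ ≤ ε / 10 := fun k hk => by
    rw [← dist_eq_norm]; exact (hN n hn k hk).le
  have hp' : ∀ x, Filter.Tendsto (fun k => (f n - f k) x) Filter.atTop (nhds ((f n - G) x)) :=
    fun x => tendsto_const_nhds.sub (hp x)
  have h1 : EnergyLE (f n - G : Dom) ((ε / 10) ^ 2) := by
    refine EnergyLE.of_tendsto hp' ?_
    filter_upwards [Filter.eventually_ge_atTop N] with k hk m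
    exact ((f n - f k).energyLE m).trans (pow_le_pow_left₀ (norm_nonneg _) (hs k hk) 2)
  have h2 : ∀ x, ‖(f n - G) x‖ ≤ 9 * (ε / 10) := fun x => by
    refine le_of_tendsto (hp' x).norm ?_
    filter_upwards [Filter.eventually_ge_atTop N] with k hk
    exact ((f n - f k).norm_apply_le x).trans (by gcongr; exact hs k hk)
  have h3 := norm_sq_le h1 h2
  rw [dist_eq_norm]
  refine lt_of_pow_lt_pow_left₀ 2 hε.le (h3.trans_lt ?_)
  nlinarith

/-- The embedding of `ℱ` into `L²`. -/
def toL2 : Dom →L[ℂ] L2 := (ContinuousMap.toLp (E := ℂ) 2 sgMeasure ℂ).comp toC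

theorem coeFn_toL2 (u : Dom) : toL2 u =ᵐ[sgMeasure] u :=
  ContinuousMap.coeFn_toLp (p := 2) (𝕜 := ℂ) sgMeasure (toC u)

theorem inner_toL2 (u v : Dom) :
    inner ℂ (toL2 u) (toL2 v) = ∫ x, v x * starRingEnd ℂ (u x) ∂sgMeasure :=
  ContinuousMap.inner_toLp sgMeasure (toC u) (toC v)

theorem toL2_injective : Function.Injective toL2 := by
  intro u v h
  have := ContinuousMap.toLp_injective (p := 2) (𝕜 := ℂ) sgMeasure h
  ext x
  exact congrArg (fun f : C(SG, ℂ) => f x) this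

theorem denseRange_toL2 : DenseRange toL2 := by
  have h : DenseRange toC := by
    intro f
    rw [Metric.mem_closure_iff]
    intro ε hε
    obtain ⟨g, hg, hb⟩ := exists_finiteEnergy_approx f.continuous (half_pos hε)
    refine ⟨toC ⟨g, hg⟩, ⟨_, rfl⟩, ?_⟩
    rw [dist_comm]
    refine lt_of_le_of_lt ((ContinuousMap.dist_le (half_pos hε).le).mpr fun x => ?_) (half_lt_self hε)
    rw [dist_eq_norm]
    exact (hb x).le
  exact (ContinuousMap.toLp_denseRange ℂ sgMeasure ℂ (by norm_num)).comp h
    (ContinuousMap.toLp (E := ℂ) 2 sgMeasure ℂ).continuous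

/-- The unit ball of `ℱ` is uniformly bounded and equicontinuous, so by Arzelà–Ascoli it is
relatively compact already in the sup norm. -/
theorem isCompactOperator_toL2 : IsCompactOperator toL2 := by
  rw [isCompactOperator_iff_exists_mem_nhds_image_subset_compact]
  refine ⟨Metric.closedBall 0 1, Metric.closedBall_mem_nhds _ one_pos, ?_⟩
  set e := ContinuousMap.linearIsometryBoundedOfCompact SG ℂ ℂ
  set A : Set (BoundedContinuousFunction SG ℂ) := (fun u => e (toC u)) '' Metric.closedBall (0 : Dom) 1
  have hA : IsCompact (closure A) := by
    refine BoundedContinuousFunction.arzela_ascoli (Metric.closedBall 0 9)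
      (isCompact_closedBall _ _) A ?_ ?_
    · rintro _ x ⟨u, hu, rfl⟩
      rw [mem_closedBall_zero_iff] at hu ⊢
      have := u.norm_apply_le x
      exact this.trans (by linarith)
    · intro x
      rw [Metric.equicontinuousAt_iff]
      intro ε hε
      obtain ⟨δ, hδ, h⟩ := Metric.eventually_nhds_iff.mp (eventually_norm_sub_lt 1 hε x)
      refine ⟨δ, hδ, fun y hy => ?_⟩
      rintro ⟨_, u, hu, rfl⟩
      rw [dist_eq_norm]
      rw [mem_closedBall_zero_iff] at hu
      exact h hy u u.continuous fun m => (u.energyLE m).trans (pow_le_one₀ (norm_nonneg _) hu)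
  refine ⟨_, (hA.image e.symm.continuous).image
    (ContinuousMap.toLp (E := ℂ) 2 sgMeasure ℂ).continuous, ?_⟩
  rintro _ ⟨u, hu, rfl⟩
  refine ⟨toC u, ⟨e (toC u), subset_closure ⟨u, hu, rfl⟩, by simp⟩, rfl⟩

end Dom

/-! ### Eigenfunctions -/

/-- `u` is zero or an eigenfunction of `-Δ` with eigenvalue `lam`. -/
def Dom.IsEigen (lam : ℝ) (u : Dom) : Prop :=
  ∀ v : Dom, inner ℂ v u = (1 + lam : ℂ) * inner ℂ v.toL2 u.toL2

theorem Dom.isEigen_iff {lam : ℝ} {u : Dom} : u.IsEigen lam ↔ IsNeumannEigenfunction lam u := by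
  constructor
  · refine fun h => ⟨u.finiteEnergy, fun v hv => ?_⟩
    let w : Dom := ⟨v, hv⟩
    have h1 := h w
    rw [Dom.inner_eq, Dom.inner_toL2] at h1
    have h2 : Dom.form u w = lam * ∫ x, u x * starRingEnd ℂ (w x) ∂sgMeasure := by
      linear_combination h1
    have h3 := Dom.hasEnergy_form u w
    rw [h2] at h3
    exact h3
  · intro h v
    rw [Dom.inner_eq, Dom.inner_toL2, (Dom.hasEnergy_form u v).unique (h.2 v v.finiteEnergy)]
    ring

theorem Dom.IsEigen.add {lam : ℝ} {u v : Dom} (hu : u.IsEigen lam) (hv : v.IsEigen lam) :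
    (u + v).IsEigen lam := fun w => by
  rw [inner_add_right, map_add, inner_add_right, hu w, hv w, mul_add]

theorem Dom.IsEigen.smul {lam : ℝ} {u : Dom} (hu : u.IsEigen lam) (c : ℂ) :
    (c • u).IsEigen lam := fun w => by
  rw [inner_smul_right, map_smul, inner_smul_right, hu w]
  ring

/-- The usual symmetry argument: testing each eigenfunction against the other evaluates the same
inner product with two different factors. -/
theorem Dom.IsEigen.inner_eq_zero {lam mu : ℝ} (h : lam ≠ mu) {u v : Dom} (hu : u.IsEigen lam)
    (hv : v.IsEigen mu) : inner ℂ u.toL2 v.toL2 = 0 := by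
  have h1 := hv u
  have h2 := hu v
  rw [← inner_conj_symm, h1, map_mul, inner_conj_symm] at h2
  have h3 : ((mu : ℂ) - lam) * inner ℂ v.toL2 u.toL2 = 0 := by
    simp only [map_add, map_one, Complex.conj_ofReal] at h2
    linear_combination h2
  rw [← inner_conj_symm, (mul_eq_zero.mp h3).resolve_left ?_, map_zero]
  exact fun h' => h (Complex.ofReal_injective (sub_eq_zero.mp h')).symm

theorem Dom.norm_toL2_le (u : Dom) : ‖u.toL2‖ ≤ ‖u‖ := by
  refine (pow_le_pow_iff_left₀ (norm_nonneg _) (norm_nonneg _) two_ne_zero).mp ?_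
  rw [@norm_sq_eq_re_inner ℂ _ _ _ _ u.toL2, Dom.inner_toL2, Dom.integral_mul_conj_self,
    Dom.norm_sq_eq]
  simp [Dom.form_re_nonneg]

theorem Dom.IsEigen.norm_sq {lam : ℝ} {u : Dom} (hu : u.IsEigen lam) :
    ‖u‖ ^ 2 = (1 + lam) * ‖u.toL2‖ ^ 2 := by
  rw [@norm_sq_eq_re_inner ℂ _ _ _ _ u, hu u, inner_self_eq_norm_sq_to_K]
  have h : (1 + lam : ℂ) * (‖u.toL2‖ : ℂ) ^ 2 = (((1 + lam) * ‖u.toL2‖ ^ 2 : ℝ) : ℂ) := by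
    push_cast
    ring
  exact (congrArg Complex.re h).trans (Complex.ofReal_re _)

theorem Dom.IsEigen.nonneg {lam : ℝ} {u : Dom} (hu : u.IsEigen lam) (h0 : u.toL2 ≠ 0) : 0 ≤ lam := by
  have h1 := hu.norm_sq
  have h2 := pow_le_pow_left₀ (norm_nonneg _) u.norm_toL2_le 2
  have h3 : 0 < ‖u.toL2‖ ^ 2 := by positivity
  nlinarith

/-! ### The resolvent -/

/-- The resolvent `(I - Δ)⁻¹`. -/
def resolvent : L2 →L[ℂ] L2 := Dom.toL2.comp (ContinuousLinearMap.adjoint Dom.toL2)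

/-- The adjoint of the embedding `ℱ → L²` sends `f` to the weak solution `u` of `(I - Δ) u = f`, by
the Riesz representation; the resolvent inherits compactness from the embedding. -/
theorem isCompactOperator_resolvent : IsCompactOperator resolvent :=
  Dom.isCompactOperator_toL2.comp_clm _

theorem isSymmetric_resolvent : (resolvent : L2 →ₗ[ℂ] L2).IsSymmetric := by
  intro f g
  change inner ℂ (Dom.toL2 (ContinuousLinearMap.adjoint Dom.toL2 f)) g =
    inner ℂ f (Dom.toL2 (ContinuousLinearMap.adjoint Dom.toL2 g))
  rw [← ContinuousLinearMap.adjoint_inner_right Dom.toL2,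
    ← ContinuousLinearMap.adjoint_inner_left Dom.toL2]

theorem adjoint_toL2_eq_zero {f : L2} (h : ContinuousLinearMap.adjoint Dom.toL2 f = 0) : f = 0 := by
  have h1 : (fun g : L2 => inner ℂ g f) = fun _ => (0 : ℂ) := by
    refine Dom.denseRange_toL2.equalizer (continuous_id.inner continuous_const) continuous_const ?_
    funext u
    change inner ℂ (Dom.toL2 u) f = 0
    rw [← ContinuousLinearMap.adjoint_inner_right, h, inner_zero_right]
  exact inner_self_eq_zero.mp (congrFun h1 f)

/-- An eigenvector of the resolvent is an eigenfunction of `-Δ`. -/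
theorem exists_eigen_of_resolvent {μ : ℂ} {f : L2} (h : resolvent f = μ • f) (hf : f ≠ 0) :
    ∃ (lam : ℝ) (u : Dom), u.toL2 = f ∧ u.IsEigen lam ∧ 0 ≤ lam := by
  have h1 : inner ℂ f (resolvent f) = ((‖ContinuousLinearMap.adjoint Dom.toL2 f‖ ^ 2 : ℝ) : ℂ) := by
    change inner ℂ f (Dom.toL2 (ContinuousLinearMap.adjoint Dom.toL2 f)) = _
    rw [← ContinuousLinearMap.adjoint_inner_left, inner_self_eq_norm_sq_to_K]
    norm_cast
  have h2 : ‖ContinuousLinearMap.adjoint Dom.toL2 f‖ ≠ 0 := by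
    rw [norm_ne_zero_iff]
    exact fun h => hf (adjoint_toL2_eq_zero h)
  rw [h, inner_smul_right, inner_self_eq_norm_sq_to_K] at h1
  have hf' : ‖f‖ ≠ 0 := norm_ne_zero_iff.mpr hf
  -- The eigenvalue `μ` is a Rayleigh quotient, hence real and positive; it corresponds to the
  -- eigenvalue `r⁻¹ - 1` of `-Δ`.
  set r : ℝ := ‖ContinuousLinearMap.adjoint Dom.toL2 f‖ ^ 2 / ‖f‖ ^ 2 with hr
  have hμ : μ = r := by
    rw [hr, Complex.ofReal_div, eq_div_iff (by exact_mod_cast pow_ne_zero 2 hf'), ← h1]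
    norm_cast
  have hr0 : r ≠ 0 := div_ne_zero (pow_ne_zero 2 h2) (pow_ne_zero 2 hf')
  have hu : Dom.toL2 ((r⁻¹ : ℂ) • ContinuousLinearMap.adjoint Dom.toL2 f) = f := by
    rw [map_smul]
    change (r⁻¹ : ℂ) • resolvent f = f
    rw [h, hμ, smul_smul, inv_mul_cancel₀ (by exact_mod_cast hr0), one_smul]
  have he : Dom.IsEigen (r⁻¹ - 1) ((r⁻¹ : ℂ) • ContinuousLinearMap.adjoint Dom.toL2 f) := by
    intro v
    rw [hu, inner_smul_right, ContinuousLinearMap.adjoint_inner_right]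
    push_cast
    ring
  exact ⟨r⁻¹ - 1, _, hu, he, he.nonneg (by rwa [hu])⟩

/-- An orthonormal basis of `L²` of eigenfunctions. -/
structure SpectralBasis where
  /-- the index set -/
  Idx : Type
  /-- the eigenvalues -/
  eigVal : Idx → ℝ
  /-- the eigenfunctions -/
  eigFun : Idx → Dom
  /-- the eigenfunctions as a basis -/
  basis : HilbertBasis Idx ℂ L2
  toL2_eigFun : ∀ i, (eigFun i).toL2 = basis i
  isEigen : ∀ i, (eigFun i).IsEigen (eigVal i)
  nonneg : ∀ i, 0 ≤ eigVal i

/-- The spectral theorem for the compact symmetric resolvent: orthonormal bases of its eigenspaces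
together span a dense subspace, and each of their vectors is nonzero and therefore an eigenfunction
of `-Δ`. -/
theorem nonempty_spectralBasis : Nonempty SpectralBasis := by
  set V : ℂ → Submodule ℂ L2 := fun μ => Module.End.eigenspace (resolvent : Module.End ℂ L2) μ with hV
  have hcl : ∀ μ, IsClosed (V μ : Set L2) := fun μ => by
    have : (V μ : Set L2) = {f | resolvent f = μ • f} := by
      ext f
      exact Module.End.mem_eigenspace_iff
    rw [this]
    exact isClosed_eq resolvent.continuous (continuous_const_smul μ)
  have : ∀ μ, CompleteSpace (V μ) := fun μ => (hcl μ).completeSpace_coe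
  choose w b hb using fun μ => exists_hilbertBasis ℂ (V μ)
  have hO := isSymmetric_resolvent.orthogonalFamily_eigenspaces.orthonormal_sigma_orthonormal
    (v_family := fun μ => b μ) fun μ => (b μ).orthonormal
  set v : (Σ μ, w μ) → L2 := fun a => (b a.1 a.2 : L2) with hv
  have hO' : Orthonormal ℂ v := hO
  have htot : (Submodule.span ℂ (Set.range v))ᗮ = ⊥ := by
    rw [eq_bot_iff, ← ContinuousLinearMap.orthogonalComplement_iSup_eigenspaces_eq_bot
      isCompactOperator_resolvent isSymmetric_resolvent]
    intro f hf
    rw [← Submodule.iInf_orthogonal, Submodule.mem_iInf]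
    intro μ
    rw [Submodule.mem_orthogonal']
    intro g hg
    have h1 := (b μ).hasSum_repr ⟨g, hg⟩
    have h2 := (innerSL ℂ f).hasSum ((V μ).subtypeL.hasSum h1)
    have h3 : ∀ i, innerSL ℂ f ((V μ).subtypeL ((b μ).repr ⟨g, hg⟩ i • b μ i)) = 0 := by
      intro i
      rw [map_smul, map_smul, innerSL_apply_apply]
      have : inner ℂ f (v ⟨μ, i⟩) = 0 :=
        (Submodule.mem_orthogonal' _ _).mp hf _ (Submodule.subset_span ⟨⟨μ, i⟩, rfl⟩)
      change _ • inner ℂ f (v ⟨μ, i⟩) = 0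
      rw [this, smul_zero]
    simp only [h3] at h2
    exact h2.unique hasSum_zero
  have key : ∀ a : Σ μ, w μ, ∃ (lam : ℝ) (u : Dom), u.toL2 = v a ∧ u.IsEigen lam ∧ 0 ≤ lam :=
    fun a => exists_eigen_of_resolvent (Module.End.mem_eigenspace_iff.mp (b a.1 a.2).2)
      (hO'.ne_zero a)
  choose lam u h1 h2 h3 using key
  exact ⟨⟨Σ μ, w μ, lam, u, HilbertBasis.mkOfOrthogonalEqBot hO' htot, fun i => by
    rw [h1, HilbertBasis.coe_mkOfOrthogonalEqBot], h2, h3⟩⟩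

/-- A fixed orthonormal basis of eigenfunctions. -/
def spectral : SpectralBasis := Classical.choice nonempty_spectralBasis

/-- The index set of the basis of eigenfunctions. -/
abbrev Idx : Type := spectral.Idx

/-- The eigenvalues of `-Δ`, with multiplicities. -/
abbrev eigVal : Idx → ℝ := spectral.eigVal

/-- The eigenfunctions of `-Δ`. -/
abbrev eigFun : Idx → Dom := spectral.eigFun

/-- The eigenfunctions as a basis of `L²`. -/
abbrev eigBasis : HilbertBasis Idx ℂ L2 := spectral.basis

theorem one_add_eigVal_pos (i : Idx) : 0 < 1 + eigVal i := by
  linarith [spectral.nonneg i]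

theorem inner_eigFun (i : Idx) (u : Dom) :
    inner ℂ (eigFun i) u = (1 + eigVal i : ℂ) * eigBasis.repr u.toL2 i := by
  rw [← inner_conj_symm, spectral.isEigen i u, map_mul, inner_conj_symm, HilbertBasis.repr_apply_apply,
    ← spectral.toL2_eigFun]
  simp

theorem rpow_half_mul_self {x : ℝ} (hx : 0 < x) : x ^ (-(1 / 2) : ℝ) * x = x ^ (1 / 2 : ℝ) := by
  nth_rewrite 2 [← Real.rpow_one x]
  rw [← Real.rpow_add hx]
  norm_num

/-- The normalized eigenfunctions in `ℱ`. -/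
def domVec (i : Idx) : Dom := (((1 + eigVal i) ^ (-(1 / 2) : ℝ) : ℝ) : ℂ) • eigFun i

theorem inner_domVec (i : Idx) (u : Dom) :
    inner ℂ (domVec i) u = (((1 + eigVal i) ^ (1 / 2 : ℝ) : ℝ) : ℂ) * eigBasis.repr u.toL2 i := by
  rw [domVec, inner_smul_left, inner_eigFun, ← mul_assoc, ← rpow_half_mul_self (one_add_eigVal_pos i)]
  simp

theorem orthonormal_domVec : Orthonormal ℂ domVec := by
  classical
  rw [orthonormal_iff_ite]
  intro i j
  rw [inner_domVec, domVec, map_smul, spectral.toL2_eigFun, map_smul, HilbertBasis.repr_self]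
  simp only [lp.coeFn_smul, Pi.smul_apply, smul_eq_mul]
  rw [lp.single_apply, Pi.single_apply]
  split_ifs with h
  · rw [h, mul_one, ← Complex.ofReal_mul, ← Real.rpow_add (one_add_eigVal_pos j)]
    norm_num
  · simp

theorem eq_of_repr_eq {f g : L2} (h : ∀ i, eigBasis.repr f i = eigBasis.repr g i) : f = g :=
  eigBasis.repr.injective (lp.ext (funext h))

theorem span_domVec_orthogonal : (Submodule.span ℂ (Set.range domVec))ᗮ = ⊥ := by
  rw [eq_bot_iff]
  intro u hu
  rw [Submodule.mem_bot]
  apply Dom.toL2_injective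
  rw [map_zero]
  refine eq_of_repr_eq fun i => ?_
  have h : inner ℂ (domVec i) u = 0 :=
    (Submodule.mem_orthogonal _ _).mp hu _ (Submodule.subset_span ⟨i, rfl⟩)
  rw [inner_domVec] at h
  have h2 : (((1 + eigVal i) ^ (1 / 2 : ℝ) : ℝ) : ℂ) ≠ 0 := by
    exact_mod_cast (Real.rpow_pos_of_pos (one_add_eigVal_pos i) _).ne'
  rw [(mul_eq_zero.mp h).resolve_left h2, map_zero]
  rfl

/-- The normalized eigenfunctions as a basis of `ℱ`. -/
def domBasis : HilbertBasis Idx ℂ Dom :=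
  HilbertBasis.mkOfOrthogonalEqBot orthonormal_domVec span_domVec_orthogonal

theorem domBasis_apply (i : Idx) : domBasis i = domVec i := by
  rw [domBasis, HilbertBasis.coe_mkOfOrthogonalEqBot]

theorem domBasis_repr (u : Dom) (i : Idx) : domBasis.repr u i =
    (((1 + eigVal i) ^ (1 / 2 : ℝ) : ℝ) : ℂ) * eigBasis.repr u.toL2 i := by
  rw [HilbertBasis.repr_apply_apply, domBasis_apply, inner_domVec]

/-! ### Diagonal operators -/

/-- The operator that multiplies the coefficients by `m`. -/
def diagOp {I H H' : Type*} [NormedAddCommGroup H] [InnerProductSpace ℂ H] [NormedAddCommGroup H']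
    [InnerProductSpace ℂ H'] (b : HilbertBasis I ℂ H) (b' : HilbertBasis I ℂ H') (m : I → ℂ)
    (hm : ∀ i, ‖m i‖ ≤ 1) : H →L[ℂ] H' :=
  (b'.repr.symm : _ →L[ℂ] H').comp
    ((lp.mapCLM 2 (fun i => m i • ContinuousLinearMap.id ℂ ℂ) zero_le_one fun i => by
      rw [norm_smul, ContinuousLinearMap.norm_id, mul_one]; exact hm i).comp
    (b.repr : H →L[ℂ] _))

theorem repr_diagOp {I H H' : Type*} [NormedAddCommGroup H] [InnerProductSpace ℂ H]
    [NormedAddCommGroup H'] [InnerProductSpace ℂ H'] (b : HilbertBasis I ℂ H)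
    (b' : HilbertBasis I ℂ H') (m : I → ℂ) (hm : ∀ i, ‖m i‖ ≤ 1) (x : H) (i : I) :
    b'.repr (diagOp b b' m hm x) i = m i * b.repr x i := by
  have : b'.repr (diagOp b b' m hm x) = lp.mapCLM 2 (fun i => m i • ContinuousLinearMap.id ℂ ℂ)
      zero_le_one (fun i => by
        rw [norm_smul, ContinuousLinearMap.norm_id, mul_one]; exact hm i) (b.repr x) :=
    b'.repr.apply_symm_apply _
  rw [this]
  rfl

/-! ### Bessel potentials -/

theorem basis_mem_eigenspace (i : Idx) : eigBasis i ∈ eigenspace (eigVal i) := by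
  refine Submodule.le_topologicalClosure _ (Submodule.subset_span
    ⟨eigFun i, Dom.isEigen_iff.mp (spectral.isEigen i), ?_⟩)
  rw [← spectral.toL2_eigFun]
  exact Dom.coeFn_toL2 _

theorem inner_eq_zero_of_mem_eigenspace {lam mu : ℝ} (h : lam ≠ mu) {u : Dom} (hu : u.IsEigen lam)
    {f : L2} (hf : f ∈ eigenspace mu) : inner ℂ u.toL2 f = 0 := by
  have : eigenspace mu ≤ (Submodule.span ℂ {u.toL2})ᗮ := by
    refine Submodule.topologicalClosure_minimal _ ?_ (Submodule.isClosed_orthogonal _)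
    rw [Submodule.span_le]
    rintro g ⟨φ, hφ, hg⟩
    have h1 : g = Dom.toL2 ⟨φ, hφ.1⟩ := Lp.ext (hg.trans (Dom.coeFn_toL2 ⟨φ, hφ.1⟩).symm)
    rw [SetLike.mem_coe, Submodule.mem_orthogonal_singleton_iff_inner_right, h1]
    exact hu.inner_eq_zero h (Dom.isEigen_iff.mpr hφ)
  exact Submodule.mem_orthogonal_singleton_iff_inner_right.mp (this hf)

theorem eigenProjection_basis (lam : ℝ) (i : Idx) :
    eigenProjection lam (eigBasis i) = if eigVal i = lam then eigBasis i else 0 := by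
  have : CompleteSpace (eigenspace lam) := Submodule.topologicalClosure.completeSpace _
  unfold eigenProjection
  split_ifs with h
  · rw [Submodule.starProjection_eq_self_iff, ← h]
    exact basis_mem_eigenspace i
  · rw [Submodule.starProjection_apply_eq_zero_iff, Submodule.mem_orthogonal']
    intro f hf
    rw [← spectral.toL2_eigFun]
    exact inner_eq_zero_of_mem_eigenspace h (spectral.isEigen i) hf

theorem hasSum_eigenProjection (lam : ℝ) (f : L2) :
    HasSum (fun i : {i : Idx // eigVal i = lam} => eigBasis.repr f i • eigBasis i)
      (eigenProjection lam f) := by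
  have h := (eigenProjection lam).hasSum (eigBasis.hasSum_repr f)
  have e : ∀ i, eigenProjection lam (eigBasis.repr f i • eigBasis i) =
      Set.indicator {i | eigVal i = lam} (fun i => eigBasis.repr f i • eigBasis i) i := by
    intro i
    rw [map_smul, eigenProjection_basis, Set.indicator_apply]
    by_cases hi : eigVal i = lam
    · rw [if_pos hi, if_pos (by exact hi)]
    · rw [if_neg hi, if_neg (by exact hi), smul_zero]
  simp only [e] at h
  exact hasSum_subtype_iff_indicator.mpr h

theorem norm_bessel_le {s : ℝ} (hs : 0 ≤ s) (i : Idx) :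
    ‖(((1 + eigVal i) ^ (-s / 2) : ℝ) : ℂ)‖ ≤ 1 := by
  rw [Complex.norm_real, Real.norm_of_nonneg (Real.rpow_nonneg (one_add_eigVal_pos i).le _)]
  exact Real.rpow_le_one_of_one_le_of_nonpos (by linarith [spectral.nonneg i]) (by linarith)

/-- The sum over all real `lam` is the basis expansion grouped by eigenvalues; a `lam` that is no
eigenvalue has an empty group and contributes zero. -/
theorem hasSum_besselPotential {s : ℝ} (hs : 0 ≤ s) (f : L2) :
    HasSum (fun lam : ℝ => (((1 + lam) ^ (-s / 2) : ℝ) : ℂ) • eigenProjection lam f)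
      (diagOp eigBasis eigBasis _ (norm_bessel_le hs) f) := by
  have h := (Equiv.sigmaFiberEquiv eigVal).hasSum_iff.mpr
    (eigBasis.hasSum_repr (diagOp eigBasis eigBasis _ (norm_bessel_le hs) f))
  refine h.sigma fun lam => ?_
  have e : ∀ i : {i : Idx // eigVal i = lam},
      (((1 + lam) ^ (-s / 2) : ℝ) : ℂ) • eigBasis.repr f i • eigBasis i =
      eigBasis.repr (diagOp eigBasis eigBasis _ (norm_bessel_le hs) f) i • eigBasis i := by
    rintro ⟨i, rfl⟩
    rw [repr_diagOp, smul_smul]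
  have h2 := (hasSum_eigenProjection lam f).const_smul (((1 + lam) ^ (-s / 2) : ℝ) : ℂ)
  simp only [e] at h2
  exact h2

theorem besselPotential_eq {s : ℝ} (hs : 0 ≤ s) (f : L2) :
    besselPotential s f = diagOp eigBasis eigBasis _ (norm_bessel_le hs) f :=
  (hasSum_besselPotential hs f).tsum_eq

theorem repr_besselPotential {s : ℝ} (hs : 0 ≤ s) (f : L2) (i : Idx) :
    eigBasis.repr (besselPotential s f) i =
      (((1 + eigVal i) ^ (-s / 2) : ℝ) : ℂ) * eigBasis.repr f i := by
  rw [besselPotential_eq hs, repr_diagOp]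

theorem besselPotential_injective {s : ℝ} (hs : 0 ≤ s) : Function.Injective (besselPotential s) := by
  intro f g h
  refine eq_of_repr_eq fun i => ?_
  have h1 := congrArg (fun f => eigBasis.repr f i) h
  simp only [repr_besselPotential hs] at h1
  refine mul_left_cancel₀ ?_ h1
  exact Complex.ofReal_ne_zero.mpr (Real.rpow_pos_of_pos (one_add_eigVal_pos i) (-s / 2)).ne'

/-! ### Complex conjugation and symmetries in `ℱ` -/

theorem graphEnergy_conj (m : ℕ) (u v : SG → ℂ) :
    graphEnergy m (fun x => starRingEnd ℂ (u x)) (fun x => starRingEnd ℂ (v x)) =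
      starRingEnd ℂ (graphEnergy m u v) := by
  induction m generalizing u v with
  | zero =>
    simp only [graphEnergy, Fin.sum_univ_three, map_mul, map_add, map_sub, map_div₀, map_one,
      map_ofNat]
  | succ m ih =>
    simp only [graphEnergy, map_sum]
    exact Finset.sum_congr rfl fun i _ => ih _ _

theorem graphEnergy_comp_sym (π : Equiv.Perm (Fin 3)) (m : ℕ) (u v : SG → ℂ) :
    graphEnergy m (u ∘ sym π) (v ∘ sym π) = graphEnergy m u v := by
  induction m generalizing u v with
  | zero =>
    simp only [graphEnergy, Function.comp, sym_corner]
    congr 1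
    conv_rhs => rw [← Equiv.sum_comp π]
    refine Finset.sum_congr rfl fun i _ => ?_
    exact Equiv.sum_comp π fun j => (u (corner (π i)) - u (corner j)) *
      starRingEnd ℂ (v (corner (π i)) - v (corner j))
  | succ m ih =>
    simp only [graphEnergy]
    conv_rhs => rw [← Equiv.sum_comp π]
    refine Finset.sum_congr rfl fun i _ => ?_
    rw [← ih (u ∘ cellMap (π i)) (v ∘ cellMap (π i))]
    have h : ∀ w : SG → ℂ, (w ∘ sym π) ∘ cellMap i = (w ∘ cellMap (π i)) ∘ sym π := by
      intro w
      funext x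
      simp only [Function.comp, sym_cellMap]
    rw [h, h]

namespace Dom

/-- The complex conjugate. -/
def conj (u : Dom) : Dom := ⟨fun x => starRingEnd ℂ (u x), u.finiteEnergy.conj⟩

theorem conj_apply (u : Dom) (x : SG) : conj u x = starRingEnd ℂ (u x) := rfl

theorem inner_conj_conj (u v : Dom) :
    inner ℂ (conj u) (conj v) = starRingEnd ℂ (inner ℂ u v) := by
  rw [inner_eq, inner_eq, map_add, ← integral_conj]
  congr 1
  · refine (hasEnergy_form (conj v) (conj u)).unique ?_
    refine ((Complex.continuous_conj.tendsto _).comp (hasEnergy_form v u)).congr fun m => ?_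
    rw [Function.comp, map_mul, ← graphEnergy_conj, map_pow, map_div₀, map_ofNat, map_ofNat]
    rfl
  · refine integral_congr_ae (Filter.Eventually.of_forall fun x => ?_)
    simp only [conj_apply, map_mul]

theorem inner_toL2_conj_conj (u v : Dom) :
    inner ℂ (conj u).toL2 (conj v).toL2 = starRingEnd ℂ (inner ℂ u.toL2 v.toL2) := by
  rw [inner_toL2, inner_toL2, ← integral_conj]
  refine integral_congr_ae (Filter.Eventually.of_forall fun x => ?_)
  simp only [conj_apply, map_mul]

theorem conj_conj (u : Dom) : conj (conj u) = u := by
  ext x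
  simp only [conj_apply, Complex.conj_conj]

theorem norm_conj (u : Dom) : ‖conj u‖ = ‖u‖ := by
  rw [@norm_eq_sqrt_re_inner ℂ, @norm_eq_sqrt_re_inner ℂ _ _ _ _ u, inner_conj_conj]
  simp

theorem IsEigen.conj {lam : ℝ} {u : Dom} (hu : u.IsEigen lam) : (conj u).IsEigen lam := by
  intro v
  have h := congrArg (starRingEnd ℂ) (hu (Dom.conj v))
  rw [map_mul, ← inner_conj_conj, ← inner_toL2_conj_conj, conj_conj] at h
  simpa using h

/-- The composition with a symmetry of the gasket. -/
def compSym (π : Equiv.Perm (Fin 3)) (u : Dom) : Dom :=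
  ⟨u ∘ sym π, u.continuous.comp (continuous_sym π), by
    simp only [graphEnergy_comp_sym]
    exact u.finiteEnergy.2⟩

theorem compSym_apply (π : Equiv.Perm (Fin 3)) (u : Dom) (x : SG) : compSym π u x = u (sym π x) :=
  rfl

theorem _root_.SierpinskiNLS.integral_comp_sym (π : Equiv.Perm (Fin 3)) {g : SG → ℂ}
    (hg : Continuous g) : ∫ x, g (sym π x) ∂sgMeasure = ∫ x, g x ∂sgMeasure := by
  conv_rhs => rw [← map_sym π]
  rw [integral_map (continuous_sym π).aemeasurable hg.aestronglyMeasurable]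

theorem inner_toL2_compSym (π : Equiv.Perm (Fin 3)) (u v : Dom) :
    inner ℂ (compSym π u).toL2 (compSym π v).toL2 = inner ℂ u.toL2 v.toL2 := by
  rw [inner_toL2, inner_toL2]
  exact integral_comp_sym π (g := fun x => v x * starRingEnd ℂ (u x))
    (v.continuous.mul (Complex.continuous_conj.comp u.continuous))

theorem inner_compSym (π : Equiv.Perm (Fin 3)) (u v : Dom) :
    inner ℂ (compSym π u) (compSym π v) = inner ℂ u v := by
  have h := inner_toL2_compSym π u v
  rw [inner_toL2, inner_toL2] at h
  rw [inner_eq, inner_eq, h]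
  congr 1
  refine (hasEnergy_form _ _).unique ((hasEnergy_form v u).congr fun m => ?_)
  congr 1
  exact (graphEnergy_comp_sym π m v u).symm

theorem compSym_compSym_inv (π : Equiv.Perm (Fin 3)) (u : Dom) :
    compSym π (compSym π⁻¹ u) = u := by
  ext x
  rw [compSym_apply, compSym_apply, ← sym_mul, inv_mul_cancel, sym_one]

theorem IsEigen.compSym {lam : ℝ} {u : Dom} (hu : u.IsEigen lam) (π : Equiv.Perm (Fin 3)) :
    (compSym π u).IsEigen lam := by
  intro v
  rw [← compSym_compSym_inv π v, inner_compSym, inner_toL2_compSym]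
  exact hu _

/-- The eigenspace, as a subspace of `ℱ`. -/
def eigenSubmodule (lam : ℝ) : Submodule ℂ Dom where
  carrier := {u | u.IsEigen lam}
  add_mem' := IsEigen.add
  zero_mem' v := by rw [map_zero, inner_zero_right, inner_zero_right, mul_zero]
  smul_mem' c _ hu := hu.smul c

/-- The alternating part (times six) with respect to the symmetries of the gasket. -/
def alternate (u : Dom) : Dom :=
  ∑ π : Equiv.Perm (Fin 3), ((Equiv.Perm.sign π : ℤ) : ℂ) • compSym π u

theorem IsEigen.alternate {lam : ℝ} {u : Dom} (hu : u.IsEigen lam) : (alternate u).IsEigen lam :=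
  (eigenSubmodule lam).sum_mem fun π _ => (hu.compSym π).smul _

theorem alternate_apply (u : Dom) (x : SG) :
    alternate u x = ∑ π : Equiv.Perm (Fin 3), ((Equiv.Perm.sign π : ℤ) : ℂ) * u (sym π x) := by
  rw [← toC_apply, alternate, map_sum, ContinuousMap.sum_apply]
  rfl

theorem alternate_sym (u : Dom) (τ : Equiv.Perm (Fin 3)) (x : SG) :
    ((Equiv.Perm.sign τ : ℤ) : ℂ) * alternate u (sym τ x) = alternate u x := by
  rw [alternate_apply, alternate_apply, Finset.mul_sum]
  conv_rhs => rw [← Equiv.sum_comp (Equiv.mulRight τ)]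
  refine Finset.sum_congr rfl fun π _ => ?_
  rw [Equiv.coe_mulRight, Equiv.Perm.sign_mul, sym_mul]
  push_cast
  ring

/-- The transposition of the other two vertices fixes this one and is odd, so the value is its own
negative. -/
theorem alternate_corner (u : Dom) (i : Fin 3) : alternate u (corner i) = 0 := by
  obtain ⟨τ, h1, h2⟩ : ∃ τ : Equiv.Perm (Fin 3), Equiv.Perm.sign τ = -1 ∧ τ i = i := by
    revert i; decide
  have h := alternate_sym u τ (corner i)
  rw [h1, sym_corner, h2] at h
  simp only [Units.val_neg, Units.val_one, Int.cast_neg, Int.cast_one, neg_mul, one_mul] at h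
  linear_combination -(1 / 2 : ℂ) * h

end Dom

/-! ### An eigenfunction with both boundary conditions -/

theorem bary_sum_smul_vertex (c : Fin 3 → ℝ) (hc : ∑ j, c j = 1) (i : Fin 3) :
    bary i (∑ j, c j • vertex j) = c i := by
  have h : Real.sqrt 3 ≠ 0 := by positivity
  rw [Fin.sum_univ_three] at hc
  fin_cases i <;> simp [bary, vertex, Fin.sum_univ_three] <;> field_simp <;> linarith

theorem bary_sym (π : Equiv.Perm (Fin 3)) (i : Fin 3) (x : SG) :
    bary i (sym π x) = bary (π⁻¹ i) x := by
  have h : (sym π x : Plane) = ∑ j, bary (π⁻¹ j) x • vertex j := by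
    rw [← Equiv.sum_comp π]
    change ∑ i, bary i (x : Plane) • vertex (π i) = _
    refine Finset.sum_congr rfl fun j _ => ?_
    simp
  rw [h, bary_sum_smul_vertex]
  rw [Equiv.sum_comp π⁻¹ fun j => bary j (x : Plane), sum_bary]

/-- An alternating function. -/
def vandermondeFun (x : SG) : ℝ := (Matrix.vandermonde fun i => bary i x).det

theorem continuous_vandermondeFun : Continuous vandermondeFun := by
  refine Continuous.matrix_det (continuous_pi fun i => continuous_pi fun j => ?_)
  exact ((continuous_bary i).comp continuous_subtype_val).pow _

theorem vandermondeFun_sym (π : Equiv.Perm (Fin 3)) (x : SG) :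
    vandermondeFun (sym π x) = (Equiv.Perm.sign π : ℤ) * vandermondeFun x := by
  unfold vandermondeFun
  simp only [bary_sym]
  have := Matrix.det_permute π⁻¹ (Matrix.vandermonde fun i => bary i (x : Plane))
  rw [Equiv.Perm.sign_inv] at this
  rw [← this]
  rfl

theorem exists_vandermondeFun_ne_zero : ∃ x, vandermondeFun x ≠ 0 := by
  -- This point has the distinct barycentric coordinates 3/4, 1/4 and 0.
  refine ⟨cellMap 0 (cellMap 1 (corner 0)), ?_⟩
  rw [vandermondeFun, Matrix.det_vandermonde_ne_zero_iff]
  have h : ∀ i, bary i (corner 0 : SG) = if i = 0 then 1 else 0 := fun i => bary_vertex i 0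
  intro i j hij
  simp only [bary_cellMap, h] at hij
  fin_cases i <;> fin_cases j <;> simp at hij ⊢ <;> norm_num at hij

/-- Otherwise every eigenfunction would be orthogonal to the alternating function `vandermondeFun`,
because an integral against an alternating function sees only the alternating part. By completeness
that function would be zero. -/
theorem exists_alternate_ne_zero : ∃ i : Idx, (eigFun i).alternate ≠ 0 := by
  by_contra! hall
  set g : C(SG, ℂ) := ⟨fun x => (vandermondeFun x : ℂ),
    Complex.continuous_ofReal.comp continuous_vandermondeFun⟩ with hg
  have h0 : ∀ i, eigBasis.repr (ContinuousMap.toLp (E := ℂ) 2 sgMeasure ℂ g) i = 0 := by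
    intro i
    rw [HilbertBasis.repr_apply_apply, ← spectral.toL2_eigFun]
    have h1 : inner ℂ (spectral.eigFun i).toL2 (ContinuousMap.toLp (E := ℂ) 2 sgMeasure ℂ g) =
        ∫ x, g x * starRingEnd ℂ (eigFun i x) ∂sgMeasure :=
      ContinuousMap.inner_toLp sgMeasure (Dom.toC (eigFun i)) g
    rw [h1]
    -- A change of variables turns each signed summand of the alternating part into the same
    -- integral, so that `h3` says that six times this integral is zero.
    have h2 : ∀ π : Equiv.Perm (Fin 3), ∫ x, ((Equiv.Perm.sign π : ℤ) : ℂ) *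
        (g x * starRingEnd ℂ (eigFun i (sym π x))) ∂sgMeasure =
        ∫ x, g x * starRingEnd ℂ (eigFun i x) ∂sgMeasure := by
      intro π
      rw [← integral_comp_sym π (g := fun x => g x * starRingEnd ℂ (eigFun i x))
        (g.continuous.mul (Complex.continuous_conj.comp (eigFun i).continuous))]
      refine integral_congr_ae (Filter.Eventually.of_forall fun x => ?_)
      simp only [hg, ContinuousMap.coe_mk, vandermondeFun_sym]
      push_cast
      ring
    have h3 : ∑ π : Equiv.Perm (Fin 3), ∫ x, ((Equiv.Perm.sign π : ℤ) : ℂ) *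
        (g x * starRingEnd ℂ (eigFun i (sym π x))) ∂sgMeasure = 0 := by
      rw [← integral_finsetSum]
      · have : ∀ x, ∑ π : Equiv.Perm (Fin 3), ((Equiv.Perm.sign π : ℤ) : ℂ) *
            (g x * starRingEnd ℂ (eigFun i (sym π x))) = 0 := by
          intro x
          have h4 : (eigFun i).alternate x = 0 := by rw [hall i]; rfl
          rw [Dom.alternate_apply] at h4
          have h5 := congrArg (fun z => g x * starRingEnd ℂ z) h4
          simp only [map_sum, map_mul, map_zero, mul_zero, map_intCast, Finset.mul_sum] at h5
          rw [← h5]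
          exact Finset.sum_congr rfl fun π _ => by ring
        simp only [this, integral_zero]
      · intro π _
        exact (continuous_const.mul (g.continuous.mul (Complex.continuous_conj.comp
          ((eigFun i).continuous.comp (continuous_sym π))))).integrable_of_hasCompactSupport
          (HasCompactSupport.of_compactSpace _)
    simp only [h2, Finset.sum_const, nsmul_eq_mul] at h3
    refine (mul_eq_zero.mp h3).resolve_left ?_
    simp [Fintype.card_perm, Nat.factorial]
  have h1 : ContinuousMap.toLp (E := ℂ) 2 sgMeasure ℂ g = ContinuousMap.toLp (E := ℂ) 2 sgMeasure ℂ 0 :=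
    eq_of_repr_eq fun i => by rw [h0, map_zero, map_zero]; rfl
  have h2 := ContinuousMap.toLp_injective (p := 2) (𝕜 := ℂ) sgMeasure h1
  obtain ⟨x, hx⟩ := exists_vandermondeFun_ne_zero
  apply hx
  have h3 := congrArg (fun f : C(SG, ℂ) => f x) h2
  exact Complex.ofReal_eq_zero.mp h3

/-- An eigenfunction with eigenvalue zero has energy zero and is constant, which a zero at a vertex
excludes. -/
theorem Dom.IsEigen.pos {lam : ℝ} {u : Dom} (hu : u.IsEigen lam) (h0 : u ≠ 0)
    (hc : u (corner 0) = 0) : 0 < lam := by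
  have hne : u.toL2 ≠ 0 := fun h => h0 (Dom.toL2_injective (by rw [h, map_zero]))
  refine lt_of_le_of_ne (hu.nonneg hne) fun h => h0 ?_
  have h1 := hasEnergy_form u u
  have h2 := (isEigen_iff.mp hu).2 u u.finiteEnergy
  rw [← h, Complex.ofReal_zero, zero_mul] at h2
  have h3 := h2.energyLE
  ext x
  have h4 := h3.norm_sub_corner_le u.continuous x
  rw [hc] at h4
  change u x = 0
  simpa using h4

/-- There is an eigenfunction of `-Δ` which satisfies both the Neumann and the Dirichlet boundary
condition. -/
theorem exists_dirichlet_neumann : ∃ (lam : ℝ) (φ : SG → ℝ), 0 < lam ∧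
    IsNeumannEigenfunction lam (fun x => (φ x : ℂ)) ∧ φ ≠ 0 ∧ ∀ i, φ (corner i) = 0 := by
  obtain ⟨i, hi⟩ := exists_alternate_ne_zero
  set u := (eigFun i).alternate with hu
  have he : u.IsEigen (eigVal i) := (spectral.isEigen i).alternate
  have hc : ∀ i, u (corner i) = 0 := Dom.alternate_corner _
  obtain ⟨w, hw, hw0, hwc, hwr⟩ : ∃ w : Dom, w.IsEigen (eigVal i) ∧ w ≠ 0 ∧
      (∀ i, w (corner i) = 0) ∧ ∀ x, starRingEnd ℂ (w x) = w x := by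
    -- Twice the real part serves unless it vanishes identically; then `u` is purely imaginary and
    -- `i u` is real.
    by_cases h : u + u.conj = 0
    · refine ⟨Complex.I • u, he.smul _, ?_, fun i => ?_, fun x => ?_⟩
      · exact smul_ne_zero Complex.I_ne_zero hi
      · rw [Dom.coe_smul, Pi.smul_apply, hc, smul_zero]
      · have h1 : u x + starRingEnd ℂ (u x) = 0 := congrArg (fun u : Dom => u x) h
        rw [Dom.coe_smul, Pi.smul_apply, smul_eq_mul, map_mul, Complex.conj_I]
        linear_combination (-Complex.I) * h1
    · refine ⟨u + u.conj, he.add he.conj, h, fun i => ?_, fun x => ?_⟩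
      · rw [Dom.coe_add, Pi.add_apply, Dom.conj_apply, hc, map_zero, add_zero]
      · rw [Dom.coe_add, Pi.add_apply, Dom.conj_apply, map_add, Complex.conj_conj, add_comm]
  have hre : ∀ x, ((w x).re : ℂ) = w x := fun x => Complex.conj_eq_iff_re.mp (hwr x)
  refine ⟨eigVal i, fun x => (w x).re, hw.pos hw0 (hwc 0), ?_, fun h => hw0 ?_, fun i => ?_⟩
  · simp only [hre]
    exact Dom.isEigen_iff.mp hw
  · ext x
    rw [← hre, show (w x).re = 0 from congrFun h x]
    rfl
  · change (w (corner i)).re = 0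
    rw [hwc]
    rfl

/-! ### Copies of functions on smaller cells -/

/-- The copy of `f` on the cell `F_i(SG)`, extended by zero. -/
def copy {E : Type*} [Zero E] (i : Fin 3) (f : SG → E) : SG → E := Function.extend (cellMap i) f 0

theorem copy_comp_self {E : Type*} [Zero E] (i : Fin 3) (f : SG → E) : copy i f ∘ cellMap i = f :=
  funext fun x => (cellMap_injective i).extend_apply f 0 x

theorem copy_comp_of_ne {E : Type*} [Zero E] {i j : Fin 3} (h : j ≠ i) {f : SG → E}
    (hf : ∀ k, f (corner k) = 0) : copy i f ∘ cellMap j = 0 := by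
  funext x
  by_cases hx : ∃ y, cellMap i y = cellMap j x
  · obtain ⟨y, hy⟩ := hx
    rw [Function.comp, ← hy, copy, (cellMap_injective i).extend_apply,
      (cellMap_eq_cellMap h.symm hy).1, hf]
    rfl
  · exact Function.extend_apply' _ _ _ hx

theorem copy_corner {E : Type*} [Zero E] (i : Fin 3) {f : SG → E} (hf : ∀ k, f (corner k) = 0)
    (k : Fin 3) : copy i f (corner k) = 0 := by
  rw [← cellMap_corner_self k]
  by_cases h : k = i
  · rw [h]
    exact (congrFun (copy_comp_self i f) _).trans (hf i)
  · exact congrFun (copy_comp_of_ne h hf) _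

theorem continuous_copy {E : Type*} [Zero E] [TopologicalSpace E] (i : Fin 3) {f : SG → E}
    (hc : Continuous f) (hf : ∀ k, f (corner k) = 0) : Continuous (copy i f) := by
  refine continuous_of_comp_cellMap fun j => ?_
  by_cases h : j = i
  · rw [h, copy_comp_self]; exact hc
  · rw [copy_comp_of_ne h hf]; exact continuous_const

theorem copy_ofReal (i : Fin 3) (f : SG → ℝ) :
    (fun x => ((copy i f x : ℝ) : ℂ)) = copy i fun x => (f x : ℂ) := by
  funext x
  by_cases hx : ∃ y, cellMap i y = x
  · obtain ⟨y, rfl⟩ := hx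
    simp only [copy, (cellMap_injective i).extend_apply]
  · simp [copy, Function.extend_apply' _ _ _ hx]

theorem support_copy {E : Type*} [Zero E] (i : Fin 3) (f : SG → E) :
    Function.support (copy i f) = cellMap i '' Function.support f := by
  ext x
  by_cases hx : ∃ y, cellMap i y = x
  · obtain ⟨y, rfl⟩ := hx
    rw [(cellMap_injective i).mem_set_image]
    simp only [copy, Function.mem_support, (cellMap_injective i).extend_apply]
  · simp only [copy, Function.mem_support, Function.extend_apply' _ _ _ hx, Pi.zero_apply,
      ne_eq, not_true_eq_false, false_iff]
    exact fun ⟨y, _, hy⟩ => hx ⟨y, hy⟩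

theorem tsupport_copy {E : Type*} [Zero E] (i : Fin 3) (f : SG → E) :
    tsupport (copy i f) = cellMap i '' tsupport f := by
  rw [tsupport, support_copy, tsupport, (isClosedEmbedding_cellMap i).closure_image_eq]

theorem finiteEnergy_copy (i : Fin 3) {f : SG → ℂ} (h : FiniteEnergy f)
    (hf : ∀ k, f (corner k) = 0) : FiniteEnergy (copy i f) := by
  refine finiteEnergy_of_comp_cellMap fun j => ?_
  by_cases hj : j = i
  · rw [hj, copy_comp_self]; exact h
  · rw [copy_comp_of_ne hj hf]; exact finiteEnergy_zero

theorem graphEnergy_zero_left (m : ℕ) (v : SG → ℂ) : graphEnergy m 0 v = 0 := by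
  have := graphEnergy_smul_left m 0 0 v
  rwa [zero_smul, zero_mul] at this

/-- Against a test function `v`, the copy has 5/3 times the energy of `f` against `v ∘ F_i`, and a
third of the inner product; the quotient is 5. The zeros of `f` at the vertices make the extension
continuous. The Neumann condition lets `v ∘ F_i` be arbitrary at the vertices, so no flux through
the boundary of the cell appears. -/
theorem IsNeumannEigenfunction.copy {lam : ℝ} {f : SG → ℂ} (h : IsNeumannEigenfunction lam f)
    (hf : ∀ k, f (corner k) = 0) (i : Fin 3) :
    IsNeumannEigenfunction (5 * lam) (copy i f) := by
  refine ⟨finiteEnergy_copy i h.1 hf, fun v hv => ?_⟩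
  have h1 := h.2 _ (hv.comp_cellMap i)
  have h2 : ∀ m, (5 / 3 : ℂ) ^ (m + 1) * graphEnergy (m + 1) (SierpinskiNLS.copy i f) v =
      5 / 3 * ((5 / 3 : ℂ) ^ m * graphEnergy m f (v ∘ cellMap i)) := by
    intro m
    rw [graphEnergy, Finset.sum_eq_single i]
    · rw [copy_comp_self]; ring
    · intro j _ hj
      rw [copy_comp_of_ne hj hf, graphEnergy_zero_left]
    · simp
  have h3 : ∫ x, SierpinskiNLS.copy i f x * starRingEnd ℂ (v x) ∂sgMeasure =
      (1 / 3 : ℝ) • ∫ x, f x * starRingEnd ℂ (v (cellMap i x)) ∂sgMeasure := by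
    rw [integral_eq_sum_cells (g := fun x => SierpinskiNLS.copy i f x * starRingEnd ℂ (v x))
      ((continuous_copy i h.1.1 hf).mul
      (Complex.continuous_conj.comp hv.1)), Finset.sum_eq_single i]
    · refine congrArg _ (integral_congr_ae (Filter.Eventually.of_forall fun x => ?_))
      simp only [← congrFun (copy_comp_self i f) x, Function.comp]
    · intro j _ hj
      have : ∀ x, SierpinskiNLS.copy i f (cellMap j x) = 0 := congrFun (copy_comp_of_ne hj hf)
      simp [this]
    · simp
  rw [HasEnergy, ← Filter.tendsto_add_atTop_iff_nat 1]
  simp only [h2]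
  have h4 := Filter.Tendsto.const_mul (5 / 3 : ℂ) h1
  rw [h3]
  convert h4 using 2
  rw [Complex.real_smul]
  simp only [Function.comp]
  push_cast
  ring

theorem integral_copy_pow (i : Fin 3) {f : SG → ℝ} (hc : Continuous f) (hf : ∀ k, f (corner k) = 0)
    {n : ℕ} (hn : n ≠ 0) :
    ∫ x, copy i f x ^ n ∂sgMeasure = 1 / 3 * ∫ x, f x ^ n ∂sgMeasure := by
  rw [integral_eq_sum_cells (g := fun x => copy i f x ^ n) ((continuous_copy i hc hf).pow n), Finset.sum_eq_single i, smul_eq_mul]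
  · refine congrArg _ (integral_congr_ae (Filter.Eventually.of_forall fun x => ?_))
    simp only [← congrFun (copy_comp_self i f) x, Function.comp]
  · intro j _ hj
    have : ∀ x, copy i f (cellMap j x) = 0 := congrFun (copy_comp_of_ne hj hf)
    simp [this, hn]
  · simp

/-! ### Localized eigenfunctions -/

/-- The copies of `φ` on smaller and smaller cells near the vertex `p₀`, normalized in `L²`. -/
def localized (φ : SG → ℝ) : ℕ → SG → ℝ
  | 0 => φ
  | n + 1 => Real.sqrt 3 • copy (if n = 0 then 1 else 0) (localized φ n)

section localized

variable {φ : SG → ℝ} (hφ : ∀ k, φ (corner k) = 0)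
include hφ

theorem localized_corner (n : ℕ) (k : Fin 3) : localized φ n (corner k) = 0 := by
  induction n generalizing k with
  | zero => exact hφ k
  | succ n ih => rw [localized, Pi.smul_apply, copy_corner _ ih, smul_zero]

theorem continuous_localized (hc : Continuous φ) (n : ℕ) : Continuous (localized φ n) := by
  induction n with
  | zero => exact hc
  | succ n ih => exact (continuous_copy _ ih (localized_corner hφ n)).const_smul _

theorem localized_eigenfunction {lam : ℝ} (h : IsNeumannEigenfunction lam fun x => (φ x : ℂ))
    (n : ℕ) : IsNeumannEigenfunction (lam * 5 ^ n) fun x => (localized φ n x : ℂ) := by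
  induction n with
  | zero => simpa [localized] using h
  | succ n ih =>
    have h1 := ih.copy (fun k => by rw [localized_corner hφ, Complex.ofReal_zero])
      (if n = 0 then 1 else 0)
    rw [← copy_ofReal] at h1
    have h2 := Dom.isEigen_iff.mp ((Dom.isEigen_iff (u := ⟨_, h1.1⟩)).mpr h1 |>.smul
      ((Real.sqrt 3 : ℝ) : ℂ))
    rw [pow_succ', mul_left_comm]
    have e : (fun x => (localized φ (n + 1) x : ℂ)) = ((Real.sqrt 3 : ℝ) : ℂ) •
        fun x => ((copy (if n = 0 then 1 else 0) (localized φ n) x : ℝ) : ℂ) := by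
      funext x
      simp [localized]
    rw [e]
    exact h2

/-- Each step contributes `(√3)^(2k+2)` from the normalization and 1/3 from the measure, in total
`3^k`. For `k = 0` the L² norm is preserved. -/
theorem integral_localized_pow (hc : Continuous φ) (k n : ℕ) :
    ∫ x, localized φ n x ^ (2 * k + 2) ∂sgMeasure =
      3 ^ (k * n) * ∫ x, φ x ^ (2 * k + 2) ∂sgMeasure := by
  induction n with
  | zero => simp [localized]
  | succ n ih =>
    have e : ∀ x, localized φ (n + 1) x ^ (2 * k + 2) =
        3 ^ (k + 1) * copy (if n = 0 then 1 else 0) (localized φ n) x ^ (2 * k + 2) := by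
      intro x
      rw [localized, Pi.smul_apply, smul_eq_mul, mul_pow, show 2 * k + 2 = 2 * (k + 1) by ring,
        pow_mul (Real.sqrt 3), Real.sq_sqrt (by norm_num)]
    simp only [e]
    rw [integral_const_mul, integral_copy_pow _ (continuous_localized hφ hc n)
      (localized_corner hφ n) (by omega), ih, Nat.mul_succ, pow_add 3 (k * n), pow_succ 3 k]
    ring

omit hφ in
theorem tsupport_localized (n : ℕ) : tsupport (localized φ (n + 1)) =
    cellMap (if n = 0 then 1 else 0) '' tsupport (localized φ n) := by
  rw [← tsupport_copy, tsupport, tsupport, localized, Function.support_const_smul_of_ne_zero]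
  positivity

omit hφ in
theorem measure_tsupport_localized (n : ℕ) :
    sgMeasure.real (tsupport (localized φ n)) = sgMeasure.real (tsupport φ) * (3 ^ n)⁻¹ := by
  induction n with
  | zero => simp [localized]
  | succ n ih =>
    rw [Measure.real, tsupport_localized, measure_image_cellMap (isClosed_tsupport _).measurableSet,
      ENNReal.toReal_mul, ← Measure.real, ih, pow_succ, mul_inv]
    simp
    ring

omit hφ in
-- The first copy is put into cell 1, away from `p₀`; the later ones go into cell 0, away from `p₁`
-- and `p₂`. A copy in cell 0 contains `p₀` in its support only if its predecessor does, so from the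
-- second step on all three vertices are avoided.
theorem corner_notMem_tsupport_localized (n : ℕ) (i : Fin 3) :
    corner i ∉ tsupport (localized φ (n + 2)) := by
  have h0 : ∀ n, corner 0 ∉ tsupport (localized φ (n + 1)) := by
    intro n
    induction n with
    | zero =>
      rw [tsupport_localized]
      rintro ⟨x, -, hx⟩
      exact absurd (corner_eq_cellMap hx).1 (by simp)
    | succ n ih =>
      rw [tsupport_localized]
      rintro ⟨x, hx, h⟩
      rw [(corner_eq_cellMap h).2] at hx
      exact ih hx
  rw [tsupport_localized, if_neg (by omega)]
  rintro ⟨x, hx, h⟩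
  obtain ⟨rfl, rfl⟩ := corner_eq_cellMap h
  exact h0 n hx

end localized

/-- The localized eigenfunctions. -/
theorem exists_localized_eigenfunctions : ∃ (c a : ℝ) (ψ : ℕ → SG → ℝ), 0 < c ∧ 0 < a ∧
    (∀ j ≥ 2, IsLocalizedEigenfunction (c * 5 ^ j) (ψ j)) ∧
    (∀ j, Continuous (ψ j)) ∧
    (∀ j, ∫ x, ψ j x ^ 2 ∂sgMeasure = 1) ∧
    (∀ j, sgMeasure.real (tsupport (ψ j)) = a * ((3 : ℝ) ^ j)⁻¹) ∧
    ∀ k : ℕ, ∃ q > 0, ∀ j, ∫ x, ψ j x ^ (2 * k + 2) ∂sgMeasure = 3 ^ (k * j) * q := by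
  obtain ⟨lam, φ₀, hlam, he₀, h0, hc₀⟩ := exists_dirichlet_neumann
  have hcont₀ : Continuous φ₀ := Complex.continuous_re.comp he₀.1.1
  have hpos : ∀ {φ : SG → ℝ}, Continuous φ → φ ≠ 0 → ∀ k : ℕ,
      0 < ∫ x, φ x ^ (2 * k + 2) ∂sgMeasure := by
    intro φ hc h0 k
    refine (hc.pow _).integral_pos_of_hasCompactSupport_nonneg_nonzero
      (HasCompactSupport.of_compactSpace _) (fun x => ?_) (x := (Function.ne_iff.mp h0).choose) ?_
    · exact Even.pow_nonneg ⟨k + 1, by ring⟩ _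
    · exact pow_ne_zero _ (Function.ne_iff.mp h0).choose_spec
  set N := ∫ x, φ₀ x ^ 2 ∂sgMeasure with hN
  have hNpos : 0 < N := hpos hcont₀ h0 0
  set φ : SG → ℝ := (Real.sqrt N)⁻¹ • φ₀ with hφ
  have hr : (Real.sqrt N)⁻¹ ≠ 0 := inv_ne_zero (Real.sqrt_pos.mpr hNpos).ne'
  have hc : ∀ k, φ (corner k) = 0 := fun k => by rw [hφ, Pi.smul_apply, hc₀, smul_zero]
  have hcont : Continuous φ := hcont₀.const_smul _
  have hne : φ ≠ 0 := smul_ne_zero hr h0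
  have hone : ∫ x, φ x ^ 2 ∂sgMeasure = 1 := by
    simp only [hφ, Pi.smul_apply, smul_eq_mul, mul_pow]
    rw [integral_const_mul, inv_pow, Real.sq_sqrt hNpos.le, ← hN, inv_mul_cancel₀ hNpos.ne']
  have he : IsNeumannEigenfunction lam fun x => (φ x : ℂ) := by
    have := Dom.isEigen_iff.mp ((Dom.isEigen_iff (u := ⟨_, he₀.1⟩)).mpr he₀ |>.smul
      (((Real.sqrt N)⁻¹ : ℝ) : ℂ))
    have e : (fun x => (φ x : ℂ)) = (((Real.sqrt N)⁻¹ : ℝ) : ℂ) • fun x => (φ₀ x : ℂ) := by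
      funext x
      simp [hφ]
    rw [e]
    exact this
  have hint := integral_localized_pow hc hcont
  refine ⟨lam, sgMeasure.real (tsupport φ), localized φ, hlam, ?_, fun j hj => ⟨?_, ?_, ?_⟩,
    continuous_localized hc hcont, fun j => ?_, measure_tsupport_localized, fun k => ?_⟩
  · have hopen : IsOpen (Function.support φ) := hcont.isOpen_support
    have h1 : 0 < sgMeasure (Function.support φ) :=
      hopen.measure_pos _ (Function.support_nonempty_iff.mpr hne)
    exact ENNReal.toReal_pos (h1.trans_le (measure_mono subset_closure)).ne' (measure_ne_top _ _)
  · exact localized_eigenfunction hc he j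
  · intro h
    have := hint 0 j
    simp only [h] at this
    simp [hone] at this
  · obtain ⟨n, rfl⟩ := Nat.exists_eq_add_of_le hj
    rw [add_comm]
    exact corner_notMem_tsupport_localized n
  · simpa [hone] using hint 0 j
  · exact ⟨_, hpos hcont hne k, hint k⟩

/-! ### The algebra structure of `ℱ` and the nonlinearity -/

namespace Dom

/-- The pointwise product. -/
def mul (u v : Dom) : Dom := ⟨(u : SG → ℂ) * v, u.finiteEnergy.mul v.finiteEnergy⟩

theorem mul_apply (u v : Dom) (x : SG) : mul u v x = u x * v x := rfl

/-- The sup norm bound makes `ℱ` an algebra. The energy contributes `2(81 + 81) = 324` and the sup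
norm `81² = 6561`, together less than `100²`. -/
theorem norm_mul_le (u v : Dom) : ‖mul u v‖ ≤ 100 * ‖u‖ * ‖v‖ := by
  refine le_of_sq_le_sq ?_ (by positivity)
  have h := norm_sq_le (u := mul u v)
    (u.energyLE.mul v.energyLE u.norm_apply_le v.norm_apply_le) (a := 9 * ‖u‖ * (9 * ‖v‖))
    fun x => by
      rw [mul_apply, norm_mul]
      exact mul_le_mul (u.norm_apply_le x) (v.norm_apply_le x) (norm_nonneg _) (by positivity)
  refine h.trans ?_
  have : 0 ≤ ‖u‖ ^ 2 * ‖v‖ ^ 2 := by positivity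
  nlinarith

/-- The pointwise product as a bounded bilinear map. -/
def mulL : Dom →L[ℝ] Dom →L[ℝ] Dom :=
  LinearMap.mkContinuous₂
    (LinearMap.mk₂ ℝ mul
      (fun u v w => by ext x; exact add_mul (u x) (v x) (w x))
      (fun c u v => by ext x; exact mul_assoc (c : ℂ) (u x) (v x))
      (fun u v w => by ext x; exact mul_add (u x) (v x) (w x))
      (fun c u v => by ext x; exact mul_left_comm (u x) (c : ℂ) (v x))) 100 norm_mul_le

theorem mulL_apply (u v : Dom) (x : SG) : mulL u v x = u x * v x := rfl

theorem norm_mulL_le (u v : Dom) : ‖mulL u v‖ ≤ 100 * ‖u‖ * ‖v‖ := norm_mul_le u v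

/-- Complex conjugation as a bounded operator. -/
def conjL : Dom →L[ℝ] Dom :=
  LinearMap.mkContinuous
    { toFun := conj
      map_add' := fun u v => by ext x; exact map_add (starRingEnd ℂ) (u x) (v x)
      map_smul' := fun c u => by
        ext x
        change starRingEnd ℂ ((c : ℂ) * u x) = (c : ℂ) * starRingEnd ℂ (u x)
        rw [map_mul, Complex.conj_ofReal] } 1 fun u => by
    change ‖conj u‖ ≤ _
    rw [norm_conj, one_mul]

theorem conjL_apply (u : Dom) (x : SG) : conjL u x = starRingEnd ℂ (u x) := rfl

theorem norm_conjL (u : Dom) : ‖conjL u‖ = ‖u‖ := norm_conj u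

/-- The nonlinearity `|u|^{2k} u`. -/
def nl : ℕ → Dom → Dom
  | 0, u => u
  | k + 1, u => mulL u (mulL (conjL u) (nl k u))

theorem nl_apply (k : ℕ) (u : Dom) (x : SG) :
    nl k u x = ((‖u x‖ ^ (2 * k) : ℝ) : ℂ) * u x := by
  induction k with
  | zero => simp [nl]
  | succ k ih =>
    rw [nl, mulL_apply, mulL_apply, conjL_apply, ih, ← mul_assoc, Complex.mul_conj,
      Complex.normSq_eq_norm_sq, ← mul_assoc, ← Complex.ofReal_mul]
    congr 2
    ring

theorem nl_smul (k : ℕ) (γ : ℝ) (u : Dom) : nl k (γ • u) = γ ^ (2 * k + 1) • nl k u := by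
  induction k with
  | zero => simp [nl]
  | succ k ih =>
    rw [nl, ih]
    simp only [map_smul, nl, smul_smul, FunLike.coe_smul, Pi.smul_apply]
    congr 1

theorem nl_unit_smul (k : ℕ) {z : ℂ} (hz : ‖z‖ = 1) (u : Dom) : nl k (z • u) = z • nl k u := by
  ext x
  rw [nl_apply, coe_smul, coe_smul, Pi.smul_apply, Pi.smul_apply, nl_apply, smul_eq_mul,
    smul_eq_mul, norm_mul, hz, one_mul]
  ring

/-- Bound and Lipschitz constant are found together, since in the telescoped difference of products
each term has one factor replaced by a difference and the others bounded. -/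
theorem nl_lipschitz (k : ℕ) {R : ℝ} (hR : 0 ≤ R) : ∃ M K : ℝ, 0 ≤ M ∧ 0 ≤ K ∧
    ∀ u v : Dom, ‖u‖ ≤ R → ‖v‖ ≤ R → ‖nl k u‖ ≤ M ∧ ‖nl k u - nl k v‖ ≤ K * ‖u - v‖ := by
  induction k with
  | zero => exact ⟨R, 1, hR, zero_le_one, fun u v hu _ => ⟨hu, by rw [one_mul]; rfl⟩⟩
  | succ k ih =>
    obtain ⟨M, K, hM, hK, h⟩ := ih
    have key : ∀ {a b : Dom} {A B : ℝ}, 0 ≤ A → ‖a‖ ≤ A → ‖b‖ ≤ B →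
        ‖mulL a b‖ ≤ 100 * A * B := fun hA ha hb => (norm_mulL_le _ _).trans (by gcongr)
    refine ⟨100 * R * (100 * R * M), 100 * R * (100 * R * K) + 100 * R * (100 * M) + 100 * (100 * R * M),
      by positivity, by positivity, fun u v hu hv => ⟨?_, ?_⟩⟩
    · exact key hR hu (key hR (by rwa [norm_conjL]) (h u v hu hv).1)
    · have e : nl (k + 1) u - nl (k + 1) v = mulL u (mulL (conjL u) (nl k u - nl k v)) +
          mulL u (mulL (conjL (u - v)) (nl k v)) + mulL (u - v) (mulL (conjL v) (nl k v)) := by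
        simp only [nl, map_sub, FunLike.coe_sub, Pi.sub_apply]
        abel
      rw [e, add_mul, add_mul]
      refine (norm_add_le _ _).trans (add_le_add ((norm_add_le _ _).trans (add_le_add ?_ ?_)) ?_)
      · refine (key hR hu (key hR (by rwa [norm_conjL]) (h u v hu hv).2)).trans_eq (by ring)
      · refine (key hR hu (key (norm_nonneg _) (norm_conjL _).le (h v u hv hu).1)).trans_eq (by ring)
      · refine (key (norm_nonneg _) le_rfl (key hR (by rwa [norm_conjL]) (h v u hv hu).1)).trans_eq
          (by ring)

end Dom

/-! ### The nonlinearity on curves -/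

section curves

variable {I : Type*} [TopologicalSpace I]

/-- The pointwise product of curves. -/
def mulC (f g : C(I, Dom)) : C(I, Dom) :=
  ⟨fun t => Dom.mulL (f t) (g t), (Dom.mulL.continuous.comp f.continuous).clm_apply g.continuous⟩

theorem mulC_apply (f g : C(I, Dom)) (t : I) : mulC f g t = Dom.mulL (f t) (g t) := rfl

/-- The complex conjugate of a curve. -/
def conjC : C(I, Dom) →L[ℝ] C(I, Dom) := Dom.conjL.compLeftContinuous ℝ I

theorem conjC_apply (f : C(I, Dom)) (t : I) : conjC f t = Dom.conjL (f t) := rfl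

/-- The nonlinearity `|u|^{2k} u` on curves. -/
def nlC : ℕ → C(I, Dom) → C(I, Dom)
  | 0, u => u
  | k + 1, u => mulC u (mulC (conjC u) (nlC k u))

theorem nlC_apply (k : ℕ) (u : C(I, Dom)) (t : I) : nlC k u t = Dom.nl k (u t) := by
  induction k with
  | zero => rfl
  | succ k ih => rw [nlC, mulC_apply, mulC_apply, conjC_apply, ih]; rfl

theorem nlC_smul (k : ℕ) (γ : ℝ) (u : C(I, Dom)) :
    nlC k (γ • u) = γ ^ (2 * k + 1) • nlC k u := by
  ext1 t
  rw [ContinuousMap.smul_apply, nlC_apply, nlC_apply, ContinuousMap.smul_apply, Dom.nl_smul]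

variable [CompactSpace I]

theorem norm_mulC_le (f g : C(I, Dom)) : ‖mulC f g‖ ≤ 100 * ‖f‖ * ‖g‖ := by
  rw [ContinuousMap.norm_le _ (by positivity)]
  intro t
  refine (Dom.norm_mulL_le _ _).trans ?_
  gcongr
  · exact f.norm_coe_le_norm t
  · exact g.norm_coe_le_norm t

theorem isBoundedBilinearMap_mulC :
    IsBoundedBilinearMap ℝ fun p : C(I, Dom) × C(I, Dom) => mulC p.1 p.2 where
  add_left f g h := by ext1 t; simp [mulC_apply]
  smul_left c f g := by ext1 t; simp [mulC_apply]
  add_right f g h := by ext1 t; simp [mulC_apply]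
  smul_right c f g := by ext1 t; simp [mulC_apply]
  bound := ⟨100, by norm_num, norm_mulC_le⟩

theorem norm_conjC_le (f : C(I, Dom)) : ‖conjC f‖ ≤ ‖f‖ := by
  rw [ContinuousMap.norm_le _ (norm_nonneg _)]
  intro t
  rw [conjC_apply, Dom.norm_conjL]
  exact f.norm_coe_le_norm t

theorem contDiff_nlC (k : ℕ) {n : WithTop ℕ∞} : ContDiff ℝ n (nlC (I := I) k) := by
  induction k with
  | zero => exact contDiff_id
  | succ k ih =>
    exact isBoundedBilinearMap_mulC.contDiff.comp₂ contDiff_id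
      (isBoundedBilinearMap_mulC.contDiff.comp₂ conjC.contDiff ih)

theorem norm_nlC_le (k : ℕ) : ∃ M : ℝ, 0 ≤ M ∧ ∀ u : C(I, Dom), ‖nlC k u‖ ≤ M * ‖u‖ ^ (2 * k + 1) := by
  induction k with
  | zero => exact ⟨1, zero_le_one, fun u => by simp [nlC]⟩
  | succ k ih =>
    obtain ⟨M, hM, h⟩ := ih
    refine ⟨100 * (100 * M), by positivity, fun u => ?_⟩
    calc ‖nlC (k + 1) u‖ ≤ 100 * ‖u‖ * (100 * ‖u‖ * (M * ‖u‖ ^ (2 * k + 1))) := by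
          refine (norm_mulC_le _ _).trans ?_
          gcongr
          refine (norm_mulC_le _ _).trans ?_
          gcongr
          · exact norm_conjC_le u
          · exact h u
      _ = _ := by ring

/-- The nonlinearity is of order `2k + 1 > 1` at the origin. -/
theorem hasFDerivAt_nlC_zero {k : ℕ} (hk : 1 ≤ k) :
    HasFDerivAt (nlC k) (0 : C(I, Dom) →L[ℝ] C(I, Dom)) 0 := by
  obtain ⟨M, -, hM⟩ := norm_nlC_le (I := I) k
  refine Asymptotics.IsBigO.hasFDerivAt (n := 2 * k + 1) ?_ (by lia)
  refine Asymptotics.IsBigO.of_bound M (Filter.Eventually.of_forall fun u => ?_)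
  rw [sub_zero, norm_pow, norm_norm]
  exact hM u

end curves

/-! ### The propagator -/

theorem norm_diagOp_apply_le {I H H' : Type*} [NormedAddCommGroup H] [InnerProductSpace ℂ H]
    [NormedAddCommGroup H'] [InnerProductSpace ℂ H'] (b : HilbertBasis I ℂ H)
    (b' : HilbertBasis I ℂ H') (m : I → ℂ) (hm : ∀ i, ‖m i‖ ≤ 1) (x : H) :
    ‖diagOp b b' m hm x‖ ≤ ‖x‖ := by
  have h := (lp.mapCLM 2 (fun i => m i • ContinuousLinearMap.id ℂ ℂ) zero_le_one fun i => by
      rw [norm_smul, ContinuousLinearMap.norm_id, mul_one]; exact hm i).le_of_opNorm_le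
    (lp.norm_mapCLM_le 2 (fun i => m i • ContinuousLinearMap.id ℂ ℂ) zero_le_one fun i => by
      rw [norm_smul, ContinuousLinearMap.norm_id, mul_one]; exact hm i) (b.repr x)
  rw [one_mul, LinearIsometryEquiv.norm_map] at h
  exact (b'.repr.symm.norm_map _).trans_le h

/-- The factor by which `e^{itΔ}` multiplies eigenfunctions with eigenvalue `lam`. -/
def phase (t lam : ℝ) : ℂ := Complex.exp (-(Complex.I * t * lam))

theorem norm_phase (t lam : ℝ) : ‖phase t lam‖ = 1 := by
  have : -(Complex.I * t * lam) = ((-(t * lam) : ℝ) : ℂ) * Complex.I := by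
    push_cast
    ring
  rw [phase, this, Complex.norm_exp_ofReal_mul_I]

theorem phase_add (t t' lam : ℝ) : phase (t + t') lam = phase t lam * phase t' lam := by
  rw [phase, phase, phase, ← Complex.exp_add]
  push_cast
  ring_nf

theorem phase_zero (lam : ℝ) : phase 0 lam = 1 := by simp [phase]

theorem continuous_phase (lam : ℝ) : Continuous fun t => phase t lam := by
  unfold phase
  fun_prop

/-- The unitary group `e^{itΔ}` on `ℱ`. -/
def propagator (t : ℝ) : Dom →L[ℂ] Dom :=
  diagOp domBasis domBasis (fun i => phase t (eigVal i)) fun _ => (norm_phase _ _).le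

theorem Dom.eq_of_repr_eq {u v : Dom} (h : ∀ i, domBasis.repr u i = domBasis.repr v i) : u = v :=
  domBasis.repr.injective (lp.ext (funext h))

theorem domBasis_repr_propagator (t : ℝ) (u : Dom) (i : Idx) :
    domBasis.repr (propagator t u) i = phase t (eigVal i) * domBasis.repr u i := repr_diagOp _ _ _ _ _ _

theorem norm_propagator_le (t : ℝ) (u : Dom) : ‖propagator t u‖ ≤ ‖u‖ :=
  norm_diagOp_apply_le _ _ _ _ _

theorem propagator_add (t t' : ℝ) (u : Dom) :
    propagator (t + t') u = propagator t (propagator t' u) :=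
  Dom.eq_of_repr_eq fun i => by
    rw [domBasis_repr_propagator, domBasis_repr_propagator, domBasis_repr_propagator, phase_add,
      mul_assoc]

theorem propagator_zero (u : Dom) : propagator 0 u = u :=
  Dom.eq_of_repr_eq fun i => by rw [domBasis_repr_propagator, phase_zero, one_mul]

theorem propagator_neg_propagator (t : ℝ) (u : Dom) : propagator (-t) (propagator t u) = u := by
  rw [← propagator_add, neg_add_cancel, propagator_zero]

theorem propagator_domBasis (t : ℝ) (i : Idx) :
    propagator t (domBasis i) = phase t (eigVal i) • domBasis i := by
  classical
  refine Dom.eq_of_repr_eq fun j => ?_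
  rw [domBasis_repr_propagator, map_smul, HilbertBasis.repr_self]
  simp only [lp.coeFn_smul, Pi.smul_apply, smul_eq_mul]
  rw [lp.single_apply, Pi.single_apply]
  split_ifs with h
  · rw [h]
  · simp

/-- The vectors with a continuous orbit form a subspace, closed because the propagators do not
increase norms and limits of orbits are thus uniform in time. It contains the basis, on which the
propagator is a phase. -/
theorem continuous_propagator_apply (u : Dom) : Continuous fun t => propagator t u := by
  let V : Submodule ℂ Dom :=
    { carrier := {u | Continuous fun t => propagator t u}
      add_mem' := fun {u v} hu hv => by
        simp only [Set.mem_ofPred_eq, map_add]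
        exact Continuous.add hu hv
      zero_mem' := by simpa using continuous_const
      smul_mem' := fun c u hu => by
        simp only [Set.mem_ofPred_eq, map_smul]
        exact Continuous.const_smul hu c }
  have hcl : IsClosed (V : Set Dom) := by
    rw [← closure_subset_iff_isClosed]
    intro v hv
    refine continuous_of_uniform_approx_of_continuous fun U hU => ?_
    obtain ⟨ε, hε, hU⟩ := Metric.mem_uniformity_dist.mp hU
    obtain ⟨w, hw, hd⟩ := Metric.mem_closure_iff.mp hv ε hε
    refine ⟨fun t => propagator t w, hw, fun t => hU ?_⟩
    rw [dist_eq_norm, ← map_sub]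
    exact (norm_propagator_le _ _).trans_lt (by rwa [← dist_eq_norm])
  have hV : (⊤ : Submodule ℂ Dom) ≤ V := by
    rw [← domBasis.dense_span]
    refine Submodule.topologicalClosure_minimal _ (Submodule.span_le.mpr ?_) hcl
    rintro _ ⟨i, rfl⟩
    change Continuous fun t => propagator t (domBasis i)
    simp only [propagator_domBasis]
    exact (continuous_phase _).smul continuous_const
  exact hV (Submodule.mem_top (x := u))

theorem continuous_propagator : Continuous fun p : ℝ × Dom => propagator p.1 p.2 := by
  rw [continuous_iff_continuousAt]
  rintro ⟨t, u⟩
  rw [ContinuousAt, tendsto_iff_norm_sub_tendsto_zero]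
  have h1 : Filter.Tendsto (fun p : ℝ × Dom => ‖p.2 - u‖ + ‖propagator p.1 u - propagator t u‖)
      (nhds (t, u)) (nhds 0) := by
    have : Continuous (fun p : ℝ × Dom => ‖p.2 - u‖ + ‖propagator p.1 u - propagator t u‖) :=
      (continuous_snd.sub continuous_const).norm.add
        (((continuous_propagator_apply u).comp continuous_fst).sub continuous_const).norm
    simpa using this.tendsto (t, u)
  refine squeeze_zero (fun _ => norm_nonneg _) (fun p => ?_) h1
  have e : propagator p.1 p.2 - propagator t u =
      propagator p.1 (p.2 - u) + (propagator p.1 u - propagator t u) := by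
    rw [map_sub]
    abel
  rw [e]
  exact (norm_add_le _ _).trans (add_le_add_left (norm_propagator_le _ _) _)

theorem eigBasis_repr_propagator (t : ℝ) (u : Dom) (i : Idx) :
    eigBasis.repr (propagator t u).toL2 i = phase t (eigVal i) * eigBasis.repr u.toL2 i := by
  have h := domBasis_repr_propagator t u i
  rw [domBasis_repr, domBasis_repr, mul_left_comm] at h
  exact mul_left_cancel₀
    (Complex.ofReal_ne_zero.mpr (Real.rpow_pos_of_pos (one_add_eigVal_pos i) _).ne') h

/-- An eigenfunction has no coefficients at the other eigenvalues. -/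
theorem Dom.IsEigen.eigVal_eq {lam : ℝ} {p : Dom} (hp : p.IsEigen lam) {i : Idx}
    (h : eigBasis.repr p.toL2 i ≠ 0) : eigVal i = lam := by
  by_contra hne
  refine h ?_
  rw [HilbertBasis.repr_apply_apply, ← spectral.toL2_eigFun]
  exact (spectral.isEigen i).inner_eq_zero hne hp

/-- Spectral multipliers act on the coefficient of an eigenfunction. -/
theorem Dom.IsEigen.inner_multiplier {lam : ℝ} {p : Dom} (hp : p.IsEigen lam) {m : ℝ → ℂ}
    {f g : L2} (h : ∀ i, eigBasis.repr g i = m (eigVal i) * eigBasis.repr f i) :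
    inner ℂ p.toL2 g = m lam * inner ℂ p.toL2 f := by
  refine (eigBasis.hasSum_inner_mul_inner p.toL2 g).unique ?_
  refine ((eigBasis.hasSum_inner_mul_inner p.toL2 f).mul_left (m lam)).congr_fun ?_
  intro i
  rw [← HilbertBasis.repr_apply_apply, ← HilbertBasis.repr_apply_apply, h,
    ← inner_conj_symm, ← HilbertBasis.repr_apply_apply]
  by_cases h0 : eigBasis.repr p.toL2 i = 0
  · simp [h0]
  · rw [hp.eigVal_eq h0]
    ring

theorem Dom.IsEigen.inner_propagator {lam : ℝ} {p : Dom} (hp : p.IsEigen lam) (t : ℝ) (u : Dom) :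
    inner ℂ p.toL2 (propagator t u).toL2 = phase t lam * inner ℂ p.toL2 u.toL2 :=
  hp.inner_multiplier (m := phase t) (eigBasis_repr_propagator t u)

theorem Dom.IsEigen.propagator_apply {lam : ℝ} {p : Dom} (hp : p.IsEigen lam) (t : ℝ) :
    propagator t p = phase t lam • p := by
  apply Dom.toL2_injective
  refine SierpinskiNLS.eq_of_repr_eq fun i => ?_
  rw [eigBasis_repr_propagator, map_smul, map_smul]
  simp only [lp.coeFn_smul, Pi.smul_apply, smul_eq_mul]
  by_cases h0 : eigBasis.repr p.toL2 i = 0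
  · simp [h0]
  · rw [hp.eigVal_eq h0]

/-! ### The Duhamel operator -/

/-- The integrand in Duhamel's formula. -/
def duhamelIntegrand (κ : ℝ) {T : ℝ} (hT : -T ≤ T) (g : C(Set.Icc (-T) T, Dom)) (τ : ℝ) : Dom :=
  propagator (-τ) ((-(Complex.I * κ)) • Set.IccExtend hT g τ)

section duhamel

variable (κ : ℝ) {T : ℝ} (hT : -T ≤ T)

theorem continuous_duhamelIntegrand (g : C(Set.Icc (-T) T, Dom)) :
    Continuous (duhamelIntegrand κ hT g) := by
  have h1 : Continuous (Set.IccExtend hT g) := g.continuous.Icc_extend'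
  have h2 : Continuous fun τ => (-(Complex.I * κ)) • Set.IccExtend hT g τ :=
    h1.const_smul (-(Complex.I * (κ : ℂ)))
  have h3 : Continuous fun τ : ℝ => (-τ, (-(Complex.I * κ)) • Set.IccExtend hT g τ) :=
    continuous_neg.prodMk h2
  have h4 := continuous_propagator.comp h3
  simp only [Function.comp_def] at h4
  exact h4

theorem duhamelIntegrand_add (f g : C(Set.Icc (-T) T, Dom)) (τ : ℝ) :
    duhamelIntegrand κ hT (f + g) τ = duhamelIntegrand κ hT f τ + duhamelIntegrand κ hT g τ := by
  simp only [duhamelIntegrand, Set.IccExtend, Function.comp, ContinuousMap.add_apply, smul_add,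
    map_add]

theorem duhamelIntegrand_smul (c : ℝ) (g : C(Set.Icc (-T) T, Dom)) (τ : ℝ) :
    duhamelIntegrand κ hT (c • g) τ = c • duhamelIntegrand κ hT g τ := by
  simp only [duhamelIntegrand, Set.IccExtend, Function.comp, ContinuousMap.smul_apply]
  rw [← ContinuousLinearMap.map_smul_of_tower, smul_comm]

/-- The integral in Duhamel's formula, as a curve. -/
def duhamelCurve (g : C(Set.Icc (-T) T, Dom)) : C(Set.Icc (-T) T, Dom) where
  -- By the group law `e^{itΔ}` is taken out of the integral, so that the integrand does not depend
  -- on `t` and a primitive of a continuous function remains.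
  toFun t := propagator t (∫ τ in (0 : ℝ)..t, duhamelIntegrand κ hT g τ)
  continuous_toFun := by
    have h1 : Continuous fun t => ∫ τ in (0 : ℝ)..t, duhamelIntegrand κ hT g τ :=
      intervalIntegral.continuous_primitive (fun a b =>
        (continuous_duhamelIntegrand κ hT g).intervalIntegrable a b) 0
    have h2 : Continuous fun t : ℝ => (t, ∫ τ in (0 : ℝ)..t, duhamelIntegrand κ hT g τ) :=
      continuous_id.prodMk h1
    exact (continuous_propagator.comp h2).comp continuous_subtype_val

theorem norm_duhamelIntegrand_le (g : C(Set.Icc (-T) T, Dom)) (τ : ℝ) :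
    ‖duhamelIntegrand κ hT g τ‖ ≤ |κ| * ‖g‖ := by
  refine (norm_propagator_le _ _).trans ?_
  rw [norm_smul, norm_neg, norm_mul, Complex.norm_I, one_mul, Complex.norm_real, Real.norm_eq_abs]
  gcongr
  exact g.norm_coe_le_norm _

/-- The curve `t ↦ -iκ ∫_0^t e^{i(t-τ)Δ} g(τ) dτ` as a bounded operator. -/
def duhamel : C(Set.Icc (-T) T, Dom) →L[ℝ] C(Set.Icc (-T) T, Dom) :=
  LinearMap.mkContinuous
    { toFun := duhamelCurve κ hT
      map_add' := fun f g => by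
        ext1 t
        change propagator t _ = propagator t _ + propagator t _
        rw [← map_add, ← intervalIntegral.integral_add
          ((continuous_duhamelIntegrand κ hT f).intervalIntegrable _ _)
          ((continuous_duhamelIntegrand κ hT g).intervalIntegrable _ _)]
        simp only [duhamelIntegrand_add]
      map_smul' := fun c g => by
        ext1 t
        change propagator t _ = c • propagator t _
        rw [← ContinuousLinearMap.map_smul_of_tower, ← intervalIntegral.integral_smul]
        simp only [duhamelIntegrand_smul] } (|κ| * T) fun g => by
    have hT0 : 0 ≤ T := by linarith
    rw [ContinuousMap.norm_le _ (by positivity)]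
    intro t
    refine (norm_propagator_le _ _).trans ?_
    refine (intervalIntegral.norm_integral_le_of_norm_le_const fun τ _ =>
      norm_duhamelIntegrand_le κ hT g τ).trans ?_
    rw [sub_zero]
    have : |(t : ℝ)| ≤ T := abs_le.mpr t.2
    calc |κ| * ‖g‖ * |(t : ℝ)| ≤ |κ| * ‖g‖ * T := by gcongr
      _ = _ := by ring

theorem duhamel_apply (g : C(Set.Icc (-T) T, Dom)) (t : Set.Icc (-T) T) :
    duhamel κ hT g t = propagator t (∫ τ in (0 : ℝ)..t, duhamelIntegrand κ hT g τ) := rfl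

end duhamel

/-- The linear evolution `t ↦ e^{itΔ} w`. -/
def linearFlow (T : ℝ) (w : Dom) : C(Set.Icc (-T) T, Dom) :=
  ⟨fun t => propagator t w, (continuous_propagator_apply w).comp continuous_subtype_val⟩

theorem linearFlow_apply (T : ℝ) (w : Dom) (t : Set.Icc (-T) T) :
    linearFlow T w t = propagator t w := rfl

theorem linearFlow_smul (T γ : ℝ) (w : Dom) : linearFlow T (γ • w) = γ • linearFlow T w := by
  ext1 t
  rw [ContinuousMap.smul_apply, linearFlow_apply, linearFlow_apply,
    ContinuousLinearMap.map_smul_of_tower]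

/-! ### Uniqueness for Duhamel's equation -/

/-- In the interaction picture `y(t) = e^{-itΔ} u(t)` the unbounded generator disappears, and `y`
solves an ordinary differential equation in `ℱ` whose right side is Lipschitz on balls. Since the
propagators do not increase norms, both solutions stay in the ball of radius `R`. -/
theorem duhamel_unique (k : ℕ) (κ : ℝ) {T : ℝ} (hT : 0 < T) {w : Dom} {u v : C(Set.Icc (-T) T, Dom)}
    (hu : u = linearFlow T w + duhamel κ (neg_le_self hT.le) (nlC k u))
    (hv : v = linearFlow T w + duhamel κ (neg_le_self hT.le) (nlC k v)) : u = v := by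
  set h := neg_le_self hT.le
  set y : C(Set.Icc (-T) T, Dom) → ℝ → Dom := fun u t =>
    w + ∫ τ in (0 : ℝ)..t, duhamelIntegrand κ h (nlC k u) τ with hy
  set R := max ‖u‖ ‖v‖ with hR
  have hR0 : 0 ≤ R := (norm_nonneg u).trans (le_max_left _ _)
  obtain ⟨M, K, hM, hK, hL⟩ := Dom.nl_lipschitz k hR0
  set F : ℝ → Dom → Dom := fun t z =>
    propagator (-t) ((-(Complex.I * κ)) • Dom.nl k (propagator t z)) with hF
  have hval : ∀ u : C(Set.Icc (-T) T, Dom), u = linearFlow T w + duhamel κ h (nlC k u) →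
      ∀ t : Set.Icc (-T) T, u t = propagator t (y u t) := by
    intro u hu t
    conv_lhs => rw [hu]
    rw [ContinuousMap.add_apply, linearFlow_apply, duhamel_apply, ← map_add]
  have hval' : ∀ u : C(Set.Icc (-T) T, Dom), u = linearFlow T w + duhamel κ h (nlC k u) →
      ∀ t : Set.Icc (-T) T, y u t = propagator (-t) (u t) := by
    intro u hu t
    rw [hval u hu t, propagator_neg_propagator]
  have hder : ∀ u : C(Set.Icc (-T) T, Dom), u = linearFlow T w + duhamel κ h (nlC k u) →
      ∀ t ∈ Set.Ioo (-T) T, HasDerivAt (y u) (F t (y u t)) t := by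
    intro u hu t ht
    have ht' := Set.Ioo_subset_Icc_self ht
    have e : F t (y u t) = duhamelIntegrand κ h (nlC k u) t := by
      simp only [hF, duhamelIntegrand]
      rw [Set.IccExtend_of_mem h _ ht', nlC_apply, hval u hu ⟨t, ht'⟩]
    rw [e]
    exact ((continuous_duhamelIntegrand κ h (nlC k u)).integral_hasStrictDerivAt 0 t).hasDerivAt.const_add w
  have hcont : ∀ u, Continuous (y u) := fun u => continuous_const.add
    (intervalIntegral.continuous_primitive (fun a b =>
      (continuous_duhamelIntegrand κ h (nlC k u)).intervalIntegrable a b) 0)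
  have hball : ∀ u : C(Set.Icc (-T) T, Dom), u = linearFlow T w + duhamel κ h (nlC k u) → ‖u‖ ≤ R →
      ∀ t ∈ Set.Ioo (-T) T, y u t ∈ Metric.closedBall (0 : Dom) R := by
    intro u hu hn t ht
    rw [mem_closedBall_zero_iff, hval' u hu ⟨t, Set.Ioo_subset_Icc_self ht⟩]
    exact (norm_propagator_le _ _).trans ((u.norm_coe_le_norm _).trans hn)
  have hlip : ∀ t ∈ Set.Ioo (-T) T,
      LipschitzOnWith (Real.toNNReal (|κ| * K)) (F t) (Metric.closedBall (0 : Dom) R) := by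
    intro t _
    refine LipschitzOnWith.of_dist_le_mul fun a ha b hb => ?_
    rw [mem_closedBall_zero_iff] at ha hb
    rw [Real.coe_toNNReal _ (by positivity), dist_eq_norm, dist_eq_norm, ← map_sub, ← smul_sub]
    refine (norm_propagator_le _ _).trans ?_
    rw [norm_smul, norm_neg, norm_mul, Complex.norm_I, one_mul, Complex.norm_real,
      Real.norm_eq_abs, mul_assoc]
    gcongr
    refine (hL _ _ ((norm_propagator_le _ _).trans ha) ((norm_propagator_le _ _).trans hb)).2.trans ?_
    rw [← map_sub]
    gcongr
    exact norm_propagator_le _ _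
  have key := ODE_solution_unique_of_mem_Icc (t₀ := 0) hlip ⟨by linarith, hT⟩
    (hcont u).continuousOn (hder u hu) (hball u hu (le_max_left _ _))
    (hcont v).continuousOn (hder v hv) (hball v hv (le_max_right _ _)) (by simp [hy])
  ext1 t
  rw [hval u hu t, hval v hv t, key t.2]

/-! ### Taylor coefficients -/

/-- The limit at the origin kills the constant coefficient; division by `x` then lowers the degree
by one. -/
theorem eq_zero_of_sum_pow_smul_isLittleO {E : Type*} [NormedAddCommGroup E] [NormedSpace ℝ E]
    (n : ℕ) {c : ℕ → E}
    (h : (fun x : ℝ => ∑ m ∈ Finset.range (n + 1), x ^ m • c m) =o[nhdsWithin 0 {0}ᶜ] fun x => x ^ n) :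
    ∀ m ≤ n, c m = 0 := by
  have hcont : ∀ (n : ℕ) (c : ℕ → E), Filter.Tendsto
      (fun x : ℝ => ∑ m ∈ Finset.range (n + 1), x ^ m • c m) (nhdsWithin 0 {0}ᶜ) (nhds (c 0)) := by
    intro n c
    have h1 : Continuous (fun x : ℝ => ∑ m ∈ Finset.range (n + 1), x ^ m • c m) := by fun_prop
    have h2 := h1.tendsto 0
    rw [Finset.sum_range_succ'] at h2
    simp only [ne_eq, Nat.add_eq_zero_iff, one_ne_zero, and_false, not_false_eq_true, zero_pow,
      zero_smul, Finset.sum_const_zero, pow_zero, one_smul, zero_add] at h2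
    exact h2.mono_left nhdsWithin_le_nhds
  have hzero : ∀ {n : ℕ} {c : ℕ → E}, (fun x : ℝ => ∑ m ∈ Finset.range (n + 1), x ^ m • c m)
      =o[nhdsWithin 0 {0}ᶜ] (fun x => x ^ n) → c 0 = 0 := by
    intro n c h
    have h1 : (fun x : ℝ => x ^ n) =O[nhdsWithin 0 {0}ᶜ] fun _ => (1 : ℝ) :=
      (((continuous_pow n).tendsto (0 : ℝ)).mono_left nhdsWithin_le_nhds).isBigO_one ℝ
    exact tendsto_nhds_unique (hcont n c) ((Asymptotics.isLittleO_one_iff ℝ).mp (h.trans_isBigO h1))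
  induction n generalizing c with
  | zero =>
    intro m hm
    rw [Nat.le_zero.mp hm]
    exact hzero h
  | succ n ih =>
    have h0 := hzero h
    have h1 : ∀ m ≤ n, c (m + 1) = 0 := by
      refine ih (c := fun m => c (m + 1)) ?_
      rw [Asymptotics.isLittleO_iff] at h ⊢
      intro ε hε
      filter_upwards [h hε, self_mem_nhdsWithin] with x hx hx0
      rw [Finset.sum_range_succ', h0, smul_zero, add_zero] at hx
      simp only [pow_succ', mul_smul] at hx
      rw [← Finset.smul_sum, norm_smul, norm_mul, mul_left_comm] at hx
      exact le_of_mul_le_mul_left hx (norm_pos_iff.mpr hx0)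
    intro m hm
    cases m with
    | zero => exact h0
    | succ m => exact h1 m (by lia)

/-- By Taylor's formula with Peano remainder the Taylor polynomial is itself `o(x^n)`, so its
coefficients vanish. -/
theorem iteratedDeriv_eq_zero_of_isLittleO {E : Type*} [NormedAddCommGroup E] [NormedSpace ℝ E]
    {n : ℕ} {f : ℝ → E} (hf : ContDiffAt ℝ n f 0)
    (h : f =o[nhdsWithin 0 {0}ᶜ] fun x => x ^ n) : iteratedDeriv n f 0 = 0 := by
  obtain ⟨u, hu, hfu⟩ := hf.contDiffOn le_rfl (by simp)
  obtain ⟨r, hr, hru⟩ := Metric.mem_nhds_iff.mp hu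
  have h0 : (0 : ℝ) ∈ Metric.ball (0 : ℝ) r := Metric.mem_ball_self hr
  have ht := taylor_isLittleO (convex_ball (0 : ℝ) r) h0 (hfu.mono hru)
  rw [Metric.isOpen_ball.nhdsWithin_eq h0] at ht
  simp only [sub_zero] at ht
  have h2 := (h.sub (ht.mono nhdsWithin_le_nhds))
  simp only [sub_sub_cancel, taylor_within_apply, sub_zero, mul_comm _ (_ ^ _ : ℝ), mul_smul] at h2
  have h3 := eq_zero_of_sum_pow_smul_isLittleO n h2 n le_rfl
  rw [iteratedDerivWithin_of_isOpen Metric.isOpen_ball h0] at h3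
  exact (smul_eq_zero.mp h3).resolve_left (by positivity)

/-- Subtracting the two-term polynomial leaves `o(x^n)`, and the linear term has no derivative of
order `n ≥ 2`. Smoothness of `f` has to be assumed, as an expansion alone does not give derivatives.
-/
theorem iteratedDeriv_eq_of_expansion {E : Type*} [NormedAddCommGroup E] [NormedSpace ℝ E] {n : ℕ}
    (hn : 2 ≤ n) {f g : ℝ → E} {a b : E} (hf : ContDiffAt ℝ n f 0)
    (hg : Filter.Tendsto g (nhdsWithin 0 {0}ᶜ) (nhds b))
    (h : ∀ᶠ x in nhdsWithin (0 : ℝ) {0}ᶜ, f x = x • a + x ^ n • g x) :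
    iteratedDeriv n f 0 = (n.factorial : ℝ) • b := by
  set p : ℝ → E := fun x => x • a + x ^ n • b with hp
  have hpc : ContDiff ℝ n p := by fun_prop
  have h1 : iteratedDeriv n (f - p) 0 = 0 := by
    refine iteratedDeriv_eq_zero_of_isLittleO (hf.sub hpc.contDiffAt) ?_
    rw [Asymptotics.isLittleO_iff]
    intro ε hε
    filter_upwards [h, Metric.tendsto_nhds.mp hg ε hε] with x hx hx2
    rw [Pi.sub_apply, hx, hp, add_sub_add_left_eq_sub, ← smul_sub, norm_smul, mul_comm]
    rw [dist_eq_norm] at hx2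
    gcongr
  have h2 : iteratedDeriv n p 0 = (n.factorial : ℝ) • b := by
    have e : p = (fun x => x ^ 1 • a) + fun x => x ^ n • b := by
      funext x
      simp [hp]
    rw [e, iteratedDeriv_add (by fun_prop) (by fun_prop)]
    have h3 : ∀ (m : ℕ) (c : E), iteratedDeriv n (fun x : ℝ => x ^ m • c) 0 =
        iteratedDeriv n (fun x : ℝ => x ^ m) 0 • c := by
      intro m c
      have := ((ContinuousLinearMap.id ℝ ℝ).smulRight c).iteratedFDeriv_comp_left (f := fun x : ℝ => x ^ m)
        (x := 0) (i := n) (n := n) (by fun_prop) le_rfl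
      simp only [iteratedDeriv_eq_iteratedFDeriv]
      exact congrArg (fun L => L fun _ => 1) this
    rw [h3, h3, iteratedDeriv_fun_pow_zero, iteratedDeriv_fun_pow_zero, if_pos rfl,
      if_neg (by lia), Nat.cast_zero, zero_smul, zero_add]
  rw [iteratedDeriv_sub hf hpc.contDiffAt, h2, sub_eq_zero] at h1
  exact h1

/-! ### Solutions with small data -/

/-- Duhamel's equation reads `Θ u = γ L` with `Θ u = u - D(|u|^{2k} u)` and `L` the linear flow of
`w₀`. The derivative of `Θ` at the origin is the identity whatever `T` is, so the inverse function
theorem gives a smooth branch of solutions for small `γ`. -/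
theorem exists_solutions (n : ℕ) {k : ℕ} (hk : 1 ≤ k) (κ : ℝ) {T : ℝ} (hT : -T ≤ T) (w₀ : Dom) :
    ∃ (w g : ℝ → C(Set.Icc (-T) T, Dom)) (γ₀ : ℝ), 0 < γ₀ ∧
      (∀ γ : ℝ, |γ| < γ₀ → w γ = linearFlow T (γ • w₀) + duhamel κ hT (nlC k (w γ))) ∧
      ContDiffAt ℝ n w 0 ∧
      Filter.Tendsto g (nhdsWithin 0 {0}ᶜ) (nhds (duhamel κ hT (nlC k (linearFlow T w₀)))) ∧
      ∀ᶠ γ in nhdsWithin (0 : ℝ) {0}ᶜ, w γ = γ • linearFlow T w₀ + γ ^ (2 * k + 1) • g γ := by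
  set D := duhamel κ hT
  set L := linearFlow T w₀
  set Θ : C(Set.Icc (-T) T, Dom) → C(Set.Icc (-T) T, Dom) := fun u => u - D (nlC k u) with hΘ
  -- The additional order of smoothness makes the order nonzero for every `n`, as the inverse
  -- function theorem requires.
  have hΘc : ContDiff ℝ (n + 1 : ℕ) Θ := contDiff_id.sub (D.contDiff.comp (contDiff_nlC k))
  have h0 : nlC k (0 : C(Set.Icc (-T) T, Dom)) = 0 := by
    obtain ⟨M, -, h⟩ := norm_nlC_le (I := Set.Icc (-T) T) k
    simpa using h 0
  have hΘ0 : Θ 0 = 0 := by simp only [hΘ, h0, map_zero, sub_zero]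
  have hd : HasFDerivAt Θ ((ContinuousLinearEquiv.refl ℝ C(Set.Icc (-T) T, Dom) :
      C(Set.Icc (-T) T, Dom) ≃L[ℝ] C(Set.Icc (-T) T, Dom)) :
      C(Set.Icc (-T) T, Dom) →L[ℝ] C(Set.Icc (-T) T, Dom)) 0 := by
    have h1 := (hasFDerivAt_id (𝕜 := ℝ) (0 : C(Set.Icc (-T) T, Dom))).sub
      (D.hasFDerivAt.comp 0 (hasFDerivAt_nlC_zero hk))
    rw [ContinuousLinearMap.comp_zero, sub_zero] at h1
    exact h1
  have hne : ((n + 1 : ℕ) : WithTop ℕ∞) ≠ 0 := by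
    exact_mod_cast Nat.succ_ne_zero n
  have hs := hΘc.contDiffAt.hasStrictFDerivAt' hd hne
  set Ψ := hΘc.contDiffAt.localInverse hd hne with hΨ
  have hΨc : ContDiffAt ℝ (n + 1 : ℕ) Ψ 0 := by
    have := hΘc.contDiffAt.to_localInverse hd hne
    rwa [hΘ0] at this
  have hΨ0 : Ψ 0 = 0 := by
    have := hΘc.contDiffAt.localInverse_apply_image hd hne
    rwa [hΘ0] at this
  have hΨr : ∀ᶠ y in nhds 0, Θ (Ψ y) = y := by
    have := hs.eventually_right_inverse
    rwa [hΘ0] at this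
  have hΨd : HasFDerivAt Ψ (ContinuousLinearMap.id ℝ _) 0 := by
    have := hs.to_localInverse.hasFDerivAt
    rwa [hΘ0] at this
  have hl : Filter.Tendsto (fun γ : ℝ => γ • L) (nhds 0) (nhds 0) := by
    have : Continuous fun γ : ℝ => γ • L := by fun_prop
    simpa using this.tendsto 0
  set w : ℝ → C(Set.Icc (-T) T, Dom) := fun γ => Ψ (γ • L) with hw
  have hfix : ∀ᶠ γ in nhds (0 : ℝ), w γ = γ • L + D (nlC k (w γ)) := by
    filter_upwards [hl.eventually hΨr] with γ h
    exact sub_eq_iff_eq_add.mp h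
  obtain ⟨γ₀, hγ₀, hfix'⟩ := Metric.eventually_nhds_iff.mp hfix
  have hwc : ContDiffAt ℝ (n + 1 : ℕ) w 0 := by
    refine ContDiffAt.comp (0 : ℝ) (g := Ψ) (f := fun γ : ℝ => γ • L) ?_ (by fun_prop)
    rwa [zero_smul]
  have hw0 : w 0 = 0 := by simp only [hw, zero_smul, hΨ0]
  have hwd : HasDerivAt w L 0 := by
    have h1 : HasDerivAt (fun γ : ℝ => γ • L) L 0 := by
      simpa using (hasDerivAt_id (0 : ℝ)).smul_const L
    have h2 : HasFDerivAt Ψ (ContinuousLinearMap.id ℝ _) ((0 : ℝ) • L) := by rwa [zero_smul]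
    exact h2.comp_hasDerivAt 0 h1
  -- Homogeneity of degree `2k + 1` takes `γ` out of the nonlinearity, and `γ⁻¹ w(γ)` tends to the
  -- derivative `L` of the branch.
  refine ⟨w, fun γ => D (nlC k (γ⁻¹ • w γ)), γ₀, hγ₀, fun γ hγ => ?_, hwc.of_le ?_, ?_, ?_⟩
  · rw [linearFlow_smul]
    exact hfix' (by rwa [Real.dist_eq, sub_zero])
  · exact_mod_cast Nat.le_succ n
  · have h1 := hasDerivAt_iff_tendsto_slope_zero.mp hwd
    simp only [zero_add, hw0, sub_zero] at h1
    exact ((D.continuous.comp (contDiff_nlC (n := 0) k).continuous).tendsto L).comp h1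
  · filter_upwards [nhdsWithin_le_nhds hfix, self_mem_nhdsWithin] with γ h hγ
    rw [← map_smul, ← nlC_smul, smul_inv_smul₀ hγ]
    exact h

/-! ### Functions of finite energy as elements of Sobolev spaces -/

theorem norm_sobolevFactor_le {s : ℝ} (hs : s ≤ 1) (i : Idx) :
    ‖(((1 + eigVal i) ^ ((s - 1) / 2) : ℝ) : ℂ)‖ ≤ 1 := by
  rw [Complex.norm_real, Real.norm_of_nonneg (Real.rpow_nonneg (one_add_eigVal_pos i).le _)]
  exact Real.rpow_le_one_of_one_le_of_nonpos (by linarith [spectral.nonneg i]) (by linarith)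

/-- The embedding of `ℱ` into `L²` that represents `ℱ ⊂ H^s`. -/
def sobolevMap {s : ℝ} (hs : s ≤ 1) : Dom →L[ℂ] L2 :=
  diagOp domBasis eigBasis _ (norm_sobolevFactor_le hs)

/-- Coefficients with respect to `domBasis` already carry the weight `(1 + λ)^(1/2)`, so the factor
with exponent `(s - 1)/2` leaves the weight of H^s. -/
theorem eigBasis_repr_sobolevMap {s : ℝ} (hs : s ≤ 1) (u : Dom) (i : Idx) :
    eigBasis.repr (sobolevMap hs u) i =
      (((1 + eigVal i) ^ (s / 2) : ℝ) : ℂ) * eigBasis.repr u.toL2 i := by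
  rw [sobolevMap, repr_diagOp, domBasis_repr, ← mul_assoc, ← Complex.ofReal_mul,
    ← Real.rpow_add (one_add_eigVal_pos i)]
  congr 4
  ring

theorem besselPotential_sobolevMap {s : ℝ} (h0 : 0 ≤ s) (hs : s ≤ 1) (u : Dom) :
    besselPotential s (sobolevMap hs u) = u.toL2 := by
  refine eq_of_repr_eq fun i => ?_
  rw [repr_besselPotential h0, eigBasis_repr_sobolevMap, ← mul_assoc, ← Complex.ofReal_mul,
    ← Real.rpow_add (one_add_eigVal_pos i), neg_div, neg_add_cancel, Real.rpow_zero,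
    Complex.ofReal_one, one_mul]

/-- The inverse of the isometry from `ℱ` onto `H¹`. -/
def ofSobolevOne : L2 →L[ℂ] Dom :=
  diagOp eigBasis domBasis (fun _ => 1) fun _ => norm_one.le

/-- This identifies H¹ with `ℱ`: every curve in H¹ becomes a curve in `ℱ`, where the algebra
structure and uniqueness are available. -/
theorem toL2_ofSobolevOne (f : L2) : (ofSobolevOne f).toL2 = besselPotential 1 f := by
  refine eq_of_repr_eq fun i => ?_
  have h : domBasis.repr (ofSobolevOne f) i = 1 * eigBasis.repr f i := repr_diagOp _ _ _ _ _ _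
  rw [domBasis_repr, one_mul] at h
  rw [repr_besselPotential zero_le_one, ← h, ← mul_assoc, ← Complex.ofReal_mul,
    ← Real.rpow_add (one_add_eigVal_pos i), neg_div, neg_add_cancel, Real.rpow_zero,
    Complex.ofReal_one, one_mul]

theorem Dom.IsEigen.sobolevMap_eq {lam : ℝ} {p : Dom} (hp : p.IsEigen lam) {s : ℝ} (hs : s ≤ 1) :
    sobolevMap hs p = (((1 + lam) ^ (s / 2) : ℝ) : ℂ) • p.toL2 := by
  refine SierpinskiNLS.eq_of_repr_eq fun i => ?_
  rw [eigBasis_repr_sobolevMap, map_smul]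
  simp only [lp.coeFn_smul, Pi.smul_apply, smul_eq_mul]
  by_cases h0 : eigBasis.repr p.toL2 i = 0
  · simp [h0]
  · rw [hp.eigVal_eq h0]

theorem Dom.IsEigen.inner_sobolevMap {lam : ℝ} {p : Dom} (hp : p.IsEigen lam) {s : ℝ} (hs : s ≤ 1)
    (u : Dom) : inner ℂ p.toL2 (sobolevMap hs u) =
      (((1 + lam) ^ (s / 2) : ℝ) : ℂ) * inner ℂ p.toL2 u.toL2 :=
  hp.inner_multiplier (m := fun lam => (((1 + lam) ^ (s / 2) : ℝ) : ℂ)) (eigBasis_repr_sobolevMap hs u)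

/-- Elements of `ℱ` as elements of `H^s`. -/
def toSobolev {s : ℝ} (hs : s ≤ 1) : Dom →L[ℝ] Sobolev s :=
  ((sobolevMap hs).restrictScalars ℝ : Dom →L[ℝ] L2)

theorem toL2_toSobolev {s : ℝ} (h0 : 0 ≤ s) (hs : s ≤ 1) (u : Dom) :
    (toSobolev hs u).toL2 = u.toL2 := besselPotential_sobolevMap h0 hs u

theorem Sobolev.toL2_injective {s : ℝ} (h0 : 0 ≤ s) :
    Function.Injective (Sobolev.toL2 (s := s)) := besselPotential_injective h0

/-- Curves in `ℱ` as curves in `H^s`. -/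
def toCurve {s : ℝ} (hs : s ≤ 1) (T : ℝ) : C(Set.Icc (-T) T, Dom) →L[ℝ] Curve s T :=
  (toSobolev hs).compLeftContinuous ℝ _

theorem toL2_toCurve {s : ℝ} (h0 : 0 ≤ s) (hs : s ≤ 1) {T : ℝ} (W : C(Set.Icc (-T) T, Dom))
    (t : Set.Icc (-T) T) : (toCurve hs T W t).toL2 = (W t).toL2 := toL2_toSobolev h0 hs (W t)

/-- Curves in `H¹` as curves in `ℱ`. -/
def ofCurveOne {T : ℝ} (v : Curve 1 T) : C(Set.Icc (-T) T, Dom) :=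
  ⟨fun t => ofSobolevOne (v t), ofSobolevOne.continuous.comp v.continuous⟩

theorem toL2_ofCurveOne {T : ℝ} (v : Curve 1 T) (t : Set.Icc (-T) T) :
    (ofCurveOne v t).toL2 = (v t).toL2 := toL2_ofSobolevOne _

/-! ### Duhamel's formula on coefficients -/

theorem inner_linearFlow_add_duhamel {lam : ℝ} {p : Dom} (hp : p.IsEigen lam) (κ : ℝ) {T : ℝ}
    (hT : -T ≤ T) (w₀ : Dom) (g : C(Set.Icc (-T) T, Dom)) (t : Set.Icc (-T) T) :
    inner ℂ p.toL2 ((linearFlow T w₀ + duhamel κ hT g) t).toL2 =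
      phase t lam * inner ℂ p.toL2 w₀.toL2 - Complex.I * κ *
        ∫ τ in (0 : ℝ)..t, phase (t - τ) lam * inner ℂ p.toL2 (Set.IccExtend hT g τ).toL2 := by
  rw [ContinuousMap.add_apply, linearFlow_apply, duhamel_apply, map_add, inner_add_right,
    hp.inner_propagator, hp.inner_propagator, sub_eq_add_neg, ← neg_mul]
  congr 1
  have h1 := ((innerSL ℂ p.toL2).comp Dom.toL2).intervalIntegral_comp_comm
    ((continuous_duhamelIntegrand κ hT g).intervalIntegrable (μ := volume) 0 t)
  simp only [ContinuousLinearMap.comp_apply, innerSL_apply_apply] at h1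
  rw [← h1, ← intervalIntegral.integral_const_mul, ← intervalIntegral.integral_const_mul]
  refine intervalIntegral.integral_congr fun τ _ => ?_
  simp only [duhamelIntegrand]
  rw [hp.inner_propagator, map_smul, inner_smul_right, sub_eq_add_neg, phase_add]
  ring

theorem Curve.val_of_mem {s T : ℝ} (u : Curve s T) {t : ℝ} (ht : t ∈ Set.Icc (-T) T) :
    u.val t = (u ⟨t, ht⟩).toL2 := dif_pos ht

/-- For data and curves in `ℱ`, the solutions of the Schrödinger equation are the solutions of
Duhamel's equation in `ℱ`. -/
theorem isSolution_iff {s : ℝ} (k : ℕ) (κ : ℝ) {T : ℝ} (hT : -T ≤ T) {u₀ : Sobolev s}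
    {u : Curve s T} {w₀ : Dom} {W : C(Set.Icc (-T) T, Dom)} (h0 : u₀.toL2 = w₀.toL2)
    (hu : ∀ t, (u t).toL2 = (W t).toL2) :
    IsSolution k κ T u₀ u ↔ W = linearFlow T w₀ + duhamel κ hT (nlC k W) := by
  have hval : ∀ t (ht : t ∈ Set.Icc (-T) T), u.val t =ᵐ[sgMeasure] W ⟨t, ht⟩ := fun t ht => by
    rw [u.val_of_mem ht, hu]
    exact Dom.coeFn_toL2 _
  -- Curves in `ℱ` are uniformly bounded functions, which gives the integrability of the
  -- nonlinearity.
  have hfin : (∫⁻ t in Set.Icc (-T) T, ∫⁻ x, ‖u.val t x‖ₑ ^ (2 * k + 1) ∂sgMeasure) < ⊤ := by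
    refine lt_of_le_of_lt (setLIntegral_mono' (g := fun _ => ENNReal.ofReal (9 * ‖W‖) ^ (2 * k + 1))
      measurableSet_Icc fun t ht => ?_) ?_
    · calc ∫⁻ x, ‖u.val t x‖ₑ ^ (2 * k + 1) ∂sgMeasure
          ≤ ∫⁻ _, ENNReal.ofReal (9 * ‖W‖) ^ (2 * k + 1) ∂sgMeasure := by
            refine lintegral_mono_ae ((hval t ht).mono fun x hx => ?_)
            rw [hx, ← ofReal_norm]
            gcongr
            refine ((W ⟨t, ht⟩).norm_apply_le x).trans ?_
            gcongr
            exact W.norm_coe_le_norm _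
        _ = _ := by simp
    · rw [setLIntegral_const]
      exact ENNReal.mul_lt_top (ENNReal.pow_lt_top ENNReal.ofReal_lt_top) (by simp)
  have hlin : ∀ (p : Dom) (t : ℝ) (ht : t ∈ Set.Icc (-T) T),
      ∫ x, u.val t x * starRingEnd ℂ (p x) ∂sgMeasure = inner ℂ p.toL2 (W ⟨t, ht⟩).toL2 := by
    intro p t ht
    rw [Dom.inner_toL2]
    exact integral_congr_ae ((hval t ht).mono fun x hx => by simp only [hx])
  have hdata : ∀ p : Dom,
      ∫ x, u₀.toL2 x * starRingEnd ℂ (p x) ∂sgMeasure = inner ℂ p.toL2 w₀.toL2 := by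
    intro p
    rw [Dom.inner_toL2, h0]
    exact integral_congr_ae ((Dom.coeFn_toL2 w₀).mono fun x hx => by simp only [hx])
  have hnl : ∀ (p : Dom) (lam t : ℝ), t ∈ Set.Icc (-T) T →
      ∫ τ in (0 : ℝ)..t, Complex.exp (-(Complex.I * (t - τ) * lam)) *
          ∫ x, ((‖u.val τ x‖ ^ (2 * k) : ℝ) : ℂ) * u.val τ x * starRingEnd ℂ (p x) ∂sgMeasure =
        ∫ τ in (0 : ℝ)..t, phase (t - τ) lam *
          inner ℂ p.toL2 (Set.IccExtend hT (nlC k W) τ).toL2 := by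
    intro p lam t ht
    refine intervalIntegral.integral_congr fun τ hτ => ?_
    have hmem : τ ∈ Set.Icc (-T) T :=
      Set.uIcc_subset_Icc ⟨by linarith, by linarith⟩ ht hτ
    simp only [phase]
    rw [Set.IccExtend_of_mem hT _ hmem, Dom.inner_toL2, nlC_apply]
    push_cast
    congr 1
    refine integral_congr_ae ((hval τ hmem).mono fun x hx => ?_)
    simp only [hx, Dom.nl_apply]
    push_cast
    rfl
  constructor
  · rintro ⟨-, h⟩
    ext1 t
    apply Dom.toL2_injective
    refine eq_of_repr_eq fun i => ?_
    rw [HilbertBasis.repr_apply_apply, HilbertBasis.repr_apply_apply, ← spectral.toL2_eigFun,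
      inner_linearFlow_add_duhamel (spectral.isEigen i), ← hnl _ _ _ t.2, ← hlin _ _ t.2, ← hdata]
    exact h _ _ (Dom.isEigen_iff.mp (spectral.isEigen i)) t t.2
  · intro h
    refine ⟨hfin, fun lam φ hφ t ht => ?_⟩
    let p : Dom := ⟨φ, hφ.1⟩
    have hp : p.IsEigen lam := Dom.isEigen_iff.mpr hφ
    have h1 := inner_linearFlow_add_duhamel hp κ hT w₀ (nlC k W) ⟨t, ht⟩
    rw [← h, ← hnl _ _ _ ht, ← hlin, ← hdata] at h1
    exact h1

/-! ### The solutions with small multiples of an eigenfunction as data -/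

theorem Sobolev.toL2_smul {s : ℝ} (h0 : 0 ≤ s) (γ : ℝ) (u : Sobolev s) :
    (γ • u).toL2 = γ • u.toL2 := by
  have h : ∀ f : L2, besselPotential s (γ • f) = γ • besselPotential s f := fun f => by
    rw [besselPotential_eq h0, besselPotential_eq h0, ContinuousLinearMap.map_smul_of_tower]
  exact h u

/-- A competing solution needs only to be a curve in H¹, with no smallness: it satisfies Duhamel's
equation in `ℱ`, where `duhamel_unique` applies. -/
theorem IsSolution.eq_of_dom {k : ℕ} {κ T : ℝ} (hT : 0 < T) {w₀ : Dom}
    {W : C(Set.Icc (-T) T, Dom)}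
    (hW : W = linearFlow T w₀ + duhamel κ (neg_le_self hT.le) (nlC k W)) {v₀ : Sobolev 1}
    (h0 : v₀.toL2 = w₀.toL2) {v : Curve 1 T} (hv : IsSolution k κ T v₀ v) :
    v = toCurve le_rfl T W := by
  have h1 := (isSolution_iff k κ (neg_le_self hT.le) h0 (W := ofCurveOne v)
    fun t => (toL2_ofCurveOne v t).symm).mp hv
  ext1 t
  apply Sobolev.toL2_injective zero_le_one
  rw [toL2_toCurve zero_le_one, ← duhamel_unique k κ hT h1 hW, toL2_ofCurveOne]

/-- The first term of the expansion of the flow at the origin, for an eigenfunction `p`. -/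
theorem norm_duhamel_nlC_ge {lam : ℝ} (hlam : 0 ≤ lam) {p : Dom} (hp : p.IsEigen lam)
    (h1 : ‖p.toL2‖ = 1) {s : ℝ} (hs : s ≤ 1) (k : ℕ) {κ : ℝ} (hκ : |κ| = 1) {T : ℝ} (hT : 0 < T)
    (t : Set.Icc (-T) T) (ht : (t : ℝ) = T) :
    (1 + lam) ^ (s / 2) * (T * ‖(inner ℂ p.toL2 (Dom.nl k p).toL2 : ℂ)‖) ≤
      ‖toCurve hs T (duhamel κ (neg_le_self hT.le) (nlC k (linearFlow T p))) t‖ := by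
  set h := neg_le_self hT.le
  set g := nlC k (linearFlow T p) with hg
  have e1 : inner ℂ p.toL2 (duhamel κ h g t).toL2 =
      -(Complex.I * κ * (T * (phase T lam * inner ℂ p.toL2 (Dom.nl k p).toL2))) := by
    have h2 := inner_linearFlow_add_duhamel hp κ h 0 g t
    have h3 : linearFlow T 0 = 0 := by
      ext1 τ
      exact map_zero (propagator τ)
    rw [h3, zero_add, map_zero, inner_zero_right, mul_zero, zero_sub] at h2
    rw [h2, ht]
    congr 2
    -- The resonance: the phase of the nonlinear term at time `τ` and that of the propagator over `T
    -- - τ` combine to the phase at `T`, so the integrand is constant in `τ`.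
    have h4 : ∀ τ ∈ Set.uIcc 0 T, phase (T - τ) lam * inner ℂ p.toL2 (Set.IccExtend h g τ).toL2 =
        phase T lam * inner ℂ p.toL2 (Dom.nl k p).toL2 := by
      intro τ hτ
      rw [Set.uIcc_of_le hT.le] at hτ
      rw [Set.IccExtend_of_mem h _ ⟨by linarith [hτ.1], hτ.2⟩, hg, nlC_apply, linearFlow_apply,
        hp.propagator_apply, Dom.nl_unit_smul k (norm_phase _ _), map_smul, inner_smul_right,
        ← mul_assoc, ← phase_add]
      congr 2
      ring
    rw [intervalIntegral.integral_congr h4, intervalIntegral.integral_const, sub_zero,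
      Complex.real_smul]
  have e2 := hp.inner_sobolevMap hs (duhamel κ h g t)
  -- By Cauchy–Schwarz with the unit vector `p`, the norm is bounded below by the coefficient along
  -- `p`; all other modes are discarded.
  have e3 := norm_inner_le_norm (𝕜 := ℂ) p.toL2 (sobolevMap hs (duhamel κ h g t))
  rw [e2, e1, h1, one_mul, norm_mul, norm_neg, norm_mul, norm_mul, norm_mul, norm_mul, norm_phase,
    Complex.norm_I, Complex.norm_real, Complex.norm_real, Complex.norm_real, one_mul,
    Real.norm_eq_abs κ, hκ, one_mul, one_mul, Real.norm_of_nonneg hT.le,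
    Real.norm_of_nonneg (Real.rpow_nonneg (by linarith) _)] at e3
  exact e3

theorem exists_curves {lam : ℝ} (hlam : 0 ≤ lam) {p : Dom} (hp : p.IsEigen lam)
    (h1 : ‖p.toL2‖ = 1) {s : ℝ} (h0 : 0 ≤ s) (hs : s ≤ 1) {k : ℕ} (hk : 1 ≤ k) {κ : ℝ}
    (hκ : |κ| = 1) {T : ℝ} (hT : 0 < T) :
    ∃ (u : ℝ → Curve s T) (w : ℝ → Curve 1 T) (γ₀ : ℝ), 0 < γ₀ ∧
      (∀ γ : ℝ, |γ| < γ₀ →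
        IsSolution k κ T (γ • toSobolev hs p) (u γ) ∧
        IsSolution k κ T (γ • toSobolev le_rfl p) (w γ) ∧
        (∀ t, (u γ t).toL2 = (w γ t).toL2) ∧
        ∀ v : Curve 1 T, IsSolution k κ T (γ • toSobolev le_rfl p) v → v = w γ) ∧
      ContDiffAt ℝ (2 * k + 1 : ℕ) u 0 ∧
      ∀ t : Set.Icc (-T) T, (t : ℝ) = T →
        (1 + lam) ^ (s / 2) * (T * ‖(inner ℂ p.toL2 (Dom.nl k p).toL2 : ℂ)‖) ≤
          ‖iteratedDeriv (2 * k + 1) u 0 t‖ := by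
  obtain ⟨W, g, γ₀, hγ₀, hW, hWc, hg, hexp⟩ :=
    exists_solutions (2 * k + 1) hk κ (neg_le_self hT.le) p
  have hdata : ∀ {s : ℝ} (_ : 0 ≤ s) (hs : s ≤ 1) (γ : ℝ),
      (γ • toSobolev hs p).toL2 = (γ • p).toL2 := by
    intro s h0 hs γ
    rw [← map_smul, toL2_toSobolev h0]
  have hc : ContDiffAt ℝ (2 * k + 1 : ℕ) (fun γ => toCurve hs T (W γ)) 0 :=
    (toCurve hs T).contDiff.comp_contDiffAt 0 hWc
  refine ⟨fun γ => toCurve hs T (W γ), fun γ => toCurve le_rfl T (W γ), γ₀, hγ₀, fun γ hγ =>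
    ⟨?_, ?_, fun t => ?_, fun v hv => hv.eq_of_dom hT (hW γ hγ) (hdata zero_le_one le_rfl γ)⟩,
    hc, fun t ht => ?_⟩
  · exact (isSolution_iff k κ _ (hdata h0 hs γ) (toL2_toCurve h0 hs (W γ))).mpr (hW γ hγ)
  · exact (isSolution_iff k κ _ (hdata zero_le_one le_rfl γ)
      (toL2_toCurve zero_le_one le_rfl (W γ))).mpr (hW γ hγ)
  · rw [toL2_toCurve h0, toL2_toCurve zero_le_one]
  · have e := iteratedDeriv_eq_of_expansion (n := 2 * k + 1) (by lia)
      (f := fun γ => toCurve hs T (W γ)) hc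
      (((toCurve hs T).continuous.tendsto _).comp hg) (a := toCurve hs T (linearFlow T p)) (by
        filter_upwards [hexp] with γ h
        rw [h, map_add, map_smul, map_smul]
        rfl)
    -- The derivative is `(2k+1)!` times the first nonlinear term; the factorial is at least one and
    -- is dropped.
    rw [e, ContinuousMap.smul_apply, norm_smul, Real.norm_of_nonneg (by positivity)]
    refine (norm_duhamel_nlC_ge hlam hp h1 hs k hκ hT t ht).trans
      (le_mul_of_one_le_left (norm_nonneg _) ?_)
    exact_mod_cast (Nat.factorial_pos (2 * k + 1))

/-! ### Growth of the first term -/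

/-- After cancelling `(1 + c 5^j)^(s/2)`, the left side grows like `5^(sjk)` and the right side like
`3^(kj)`. The condition on `s` says exactly that `5^s < 3`. -/
theorem eventually_growth {c q T s : ℝ} (hc : 0 < c) (hq : 0 < q) (hT : 0 < T) (h0 : 0 < s)
    (hs : s < Real.log 3 / Real.log 5) {k : ℕ} (hk : 1 ≤ k) (C : ℝ) : ∃ J : ℕ, ∀ j ≥ J,
    C * ((1 + c * 5 ^ j) ^ (s / 2)) ^ (2 * k + 1) <
      (1 + c * 5 ^ j) ^ (s / 2) * (T * (3 ^ (k * j) * q)) := by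
  set r : ℝ := 5 ^ s with hr
  have hr0 : 0 < r := by positivity
  have hr3 : r < 3 := by
    rw [lt_div_iff₀ (Real.log_pos (by norm_num))] at hs
    rw [hr, Real.rpow_def_of_pos (by norm_num), ← Real.lt_log_iff_exp_lt (by norm_num)]
    linarith
  have h1 : 1 < (3 / r) ^ k := one_lt_pow₀ ((one_lt_div hr0).mpr hr3) (by lia)
  have h2 := tendsto_pow_atTop_atTop_of_one_lt h1
  obtain ⟨J, hJ⟩ := Filter.eventually_atTop.mp
    (h2.eventually_gt_atTop (|C| * ((1 + c) ^ s) ^ k / (T * q)))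
  refine ⟨J, fun j hj => ?_⟩
  have hx : 0 < 1 + c * 5 ^ j := by positivity
  set x := 1 + c * 5 ^ j with hxdef
  -- This follows from `1 + c 5^j ≤ (1 + c) 5^j`.
  have h3 : x ^ s ≤ (1 + c) ^ s * r ^ j := by
    have h5 : (1 : ℝ) ≤ 5 ^ j := one_le_pow₀ (by norm_num)
    have e : r ^ j = ((5 : ℝ) ^ j) ^ s := by
      rw [hr, ← Real.rpow_natCast, ← Real.rpow_mul (by norm_num), mul_comm,
        Real.rpow_mul (by norm_num), Real.rpow_natCast]
    rw [e, ← Real.mul_rpow (by positivity) (by positivity)]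
    refine Real.rpow_le_rpow hx.le ?_ h0.le
    rw [hxdef]
    linarith
  have h4 : (x ^ (s / 2)) ^ (2 * k + 1) = x ^ (s / 2) * (x ^ s) ^ k := by
    rw [pow_succ', pow_mul, ← Real.rpow_natCast (x ^ (s / 2)) 2, ← Real.rpow_mul hx.le]
    congr 3
    push_cast
    ring
  have h6 := hJ j hj
  rw [div_lt_iff₀ (by positivity), ← pow_mul, div_pow, div_mul_eq_mul_div,
    lt_div_iff₀ (by positivity)] at h6
  rw [h4, mul_left_comm]
  refine mul_lt_mul_of_pos_left ?_ (Real.rpow_pos_of_pos hx _)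
  calc C * (x ^ s) ^ k ≤ |C| * ((1 + c) ^ s * r ^ j) ^ k := by
        gcongr
        exact le_abs_self C
    _ = |C| * ((1 + c) ^ s) ^ k * r ^ (k * j) := by rw [mul_pow, ← pow_mul, mul_comm j k]; ring
    _ < 3 ^ (k * j) * (T * q) := h6
    _ = T * (3 ^ (k * j) * q) := by ring

/-! ### Derivatives along lines -/

/-- The derivatives of a function of class `C^n` along lines through the origin are bounded. -/
theorem exists_iteratedDeriv_line_le {E F : Type*} [NormedAddCommGroup E] [NormedSpace ℝ E]
    [NormedAddCommGroup F] [NormedSpace ℝ F] {n : ℕ} {Φ : E → F} (hΦ : ContDiffAt ℝ n Φ 0) :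
    ∃ C : ℝ, ∀ x : E, ‖iteratedDeriv n (fun γ : ℝ => Φ (γ • x)) 0‖ ≤ C * ‖x‖ ^ n := by
  obtain ⟨u, hu, hΦu⟩ := hΦ.contDiffOn le_rfl (by simp)
  obtain ⟨U, hUu, hU, h0⟩ := mem_nhds_iff.mp hu
  refine ⟨‖iteratedFDerivWithin ℝ n Φ U 0‖, fun x => ?_⟩
  set L : ℝ →L[ℝ] E := ContinuousLinearMap.toSpanSingleton ℝ x with hL
  have hV : IsOpen (L ⁻¹' U) := hU.preimage L.continuous
  have h0V : (0 : ℝ) ∈ L ⁻¹' U := by simpa using h0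
  -- The chain rule with the linear map `γ ↦ γ x`, on an open set where `Φ` is of class C^n. It
  -- expresses the derivative along the line by a multilinear map that does not depend on `x`, whose
  -- norm is the constant.
  have h := L.iteratedFDerivWithin_comp_right (i := n) (x := 0) (hΦu.mono hUu) hU.uniqueDiffOn
    hV.uniqueDiffOn h0V le_rfl
  rw [iteratedFDerivWithin_of_isOpen n hV h0V, map_zero] at h
  have e : iteratedDeriv n (fun γ : ℝ => Φ (γ • x)) 0 =
      iteratedFDerivWithin ℝ n Φ U 0 fun _ => x := by
    rw [iteratedDeriv_eq_iteratedFDeriv]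
    refine (congrArg (fun M => M fun _ => 1) h).trans ?_
    simp [hL]
  rw [e]
  refine (ContinuousMultilinearMap.le_opNorm _ _).trans_eq ?_
  simp

/-! ### Failure of smoothness -/

/-- No function of class `C^{2k+1}` on `H^s` gives the solutions with data `γ ψ`, for all `ψ` in a
family for which the derivatives of order `2k+1` at `γ = 0` are unbounded. -/
theorem not_contDiffAt_of_unbounded {E F : Type*} [NormedAddCommGroup E] [NormedSpace ℝ E]
    [NormedAddCommGroup F] [NormedSpace ℝ F] {n : ℕ} {Φ : E → F}
    (h : ∀ C : ℝ, ∃ (x : E) (u : ℝ → F), (∀ᶠ γ : ℝ in nhds 0, Φ (γ • x) = u γ) ∧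
      C * ‖x‖ ^ n < ‖iteratedDeriv n u 0‖) : ¬ ContDiffAt ℝ n Φ 0 := by
  intro hΦ
  obtain ⟨C, hC⟩ := exists_iteratedDeriv_line_le hΦ
  obtain ⟨x, u, hu, hlt⟩ := h C
  have e : iteratedDeriv n (fun γ : ℝ => Φ (γ • x)) 0 = iteratedDeriv n u 0 :=
    Filter.EventuallyEq.iteratedDeriv_eq n hu
  exact absurd (e ▸ hC x) (not_le.mpr hlt)

theorem eventually_norm_smul_lt {E : Type*} [NormedAddCommGroup E] [NormedSpace ℝ E] (x : E) {r : ℝ}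
    (hr : 0 < r) : ∀ᶠ γ : ℝ in nhds 0, ‖γ • x‖ < r := by
  have : Continuous fun γ : ℝ => ‖γ • x‖ := by fun_prop
  exact this.continuousAt.eventually_lt continuousAt_const (by simpa using hr)

end SierpinskiNLS

/-! ### The main theorem -/

theorem theorem1 :
    ∃ (c a b : ℝ) (ψ : ℕ → SierpinskiNLS.SG → ℝ), 0 < c ∧ 0 < a ∧ 0 < b ∧
      -- localized eigenfunctions, with eigenvalue `c 5^j` and support of measure about `3^{-j}`
      (∀ j ≥ 2, SierpinskiNLS.IsLocalizedEigenfunction (c * 5 ^ j) (ψ j) ∧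
        ∫ x, ψ j x ^ 2 ∂SierpinskiNLS.sgMeasure = 1 ∧
        a * ((3 : ℝ) ^ j)⁻¹ ≤ SierpinskiNLS.sgMeasure.real (tsupport (ψ j)) ∧
        SierpinskiNLS.sgMeasure.real (tsupport (ψ j)) ≤ b * ((3 : ℝ) ^ j)⁻¹) ∧
      ∀ (s : ℝ) (k : ℕ) (κ : ℝ), 0 < s → s < Real.log 3 / Real.log 5 → 1 ≤ k → κ = 1 ∨ κ = -1 →
        -- the `(2k+1)`-th derivative at `γ = 0` of the solution with data `γ ψ_j` is not bounded
        -- by a constant times `‖ψ_j‖_{H^s}^{2k+1}`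
        (∀ (T : ℝ) (hT : 0 < T) (C : ℝ), ∃ J : ℕ, ∀ j ≥ J, 2 ≤ j →
          ∃ (u₀ : SierpinskiNLS.Sobolev s) (w₀ : SierpinskiNLS.Sobolev 1)
            (u : ℝ → SierpinskiNLS.Curve s T) (w : ℝ → SierpinskiNLS.Curve 1 T) (γ₀ : ℝ),
            (u₀.toL2 =ᵐ[SierpinskiNLS.sgMeasure] fun x => (ψ j x : ℂ)) ∧
            (w₀.toL2 =ᵐ[SierpinskiNLS.sgMeasure] fun x => (ψ j x : ℂ)) ∧
            0 < γ₀ ∧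
            (∀ γ : ℝ, |γ| < γ₀ →
              SierpinskiNLS.IsSolution k κ T (γ • u₀) (u γ) ∧
              SierpinskiNLS.IsSolution k κ T (γ • w₀) (w γ) ∧
              (∀ t, (u γ t).toL2 = (w γ t).toL2) ∧
              ∀ v : SierpinskiNLS.Curve 1 T,
                SierpinskiNLS.IsSolution k κ T (γ • w₀) v → v = w γ) ∧
            ContDiffAt ℝ (2 * k + 1 : ℕ) u 0 ∧
            C * ‖u₀‖ ^ (2 * k + 1) <
              ‖iteratedDeriv (2 * k + 1) u 0 ⟨T, by constructor <;> linarith⟩‖) ∧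
        -- the solution map is not of class `C^{2k+1}`
        ¬ SierpinskiNLS.IsWellPosed (2 * k + 1) s k κ ∧
        -- the flow map of `H^1` has no extension to `H^s` of class `C^{2k+1}` near the origin
        ¬ ∃ T > 0, ∃ Φ : SierpinskiNLS.Sobolev s → SierpinskiNLS.Curve s T,
          SierpinskiNLS.ExtendsH1Flow k κ T Φ ∧ ContDiffAt ℝ (2 * k + 1 : ℕ) Φ 0 := by
  open SierpinskiNLS in
  obtain ⟨c, a, ψ, hc, ha, hψ, hcont, hnorm, hsupp, hpow⟩ := exists_localized_eigenfunctions
  refine ⟨c, a, a, ψ, hc, ha, ha, fun j hj => ⟨hψ j hj, hnorm j, (hsupp j).ge, (hsupp j).le⟩,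
    fun s k κ h0 hslt hk hκ => ?_⟩
  have hs : s ≤ 1 := by
    refine hslt.le.trans ((div_le_one (Real.log_pos (by norm_num))).mpr ?_)
    exact Real.log_le_log (by norm_num) (by norm_num)
  have hκ' : |κ| = 1 := by rcases hκ with rfl | rfl <;> simp
  obtain ⟨q, hq, hpow⟩ := hpow k
  have main : ∀ (T : ℝ) (hT : 0 < T) (C : ℝ), ∃ J : ℕ, ∀ j ≥ J, 2 ≤ j →
      ∃ (u₀ : Sobolev s) (w₀ : Sobolev 1) (u : ℝ → Curve s T) (w : ℝ → Curve 1 T) (γ₀ : ℝ),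
        (u₀.toL2 =ᵐ[sgMeasure] fun x => (ψ j x : ℂ)) ∧
        (w₀.toL2 =ᵐ[sgMeasure] fun x => (ψ j x : ℂ)) ∧
        0 < γ₀ ∧
        (∀ γ : ℝ, |γ| < γ₀ →
          IsSolution k κ T (γ • u₀) (u γ) ∧ IsSolution k κ T (γ • w₀) (w γ) ∧
          (∀ t, (u γ t).toL2 = (w γ t).toL2) ∧
          ∀ v : Curve 1 T, IsSolution k κ T (γ • w₀) v → v = w γ) ∧
        ContDiffAt ℝ (2 * k + 1 : ℕ) u 0 ∧
        C * ‖u₀‖ ^ (2 * k + 1) <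
          ‖iteratedDeriv (2 * k + 1) u 0 ⟨T, by constructor <;> linarith⟩‖ := by
    intro T hT C
    obtain ⟨J, hJ⟩ := eventually_growth hc hq hT h0 hslt hk C
    refine ⟨J, fun j hj h2 => ?_⟩
    let p : Dom := ⟨fun x => ((ψ j x : ℝ) : ℂ), (hψ j h2).1.1⟩
    have hp : p.IsEigen (c * 5 ^ j) := Dom.isEigen_iff.mpr (hψ j h2).1
    have hp1 : ‖p.toL2‖ = 1 := by
      have e : ‖p.toL2‖ ^ 2 = 1 := by
        rw [@norm_sq_eq_re_inner ℂ, Dom.inner_toL2, Dom.integral_mul_conj_self, ← hnorm j]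
        simp [p]
      exact (pow_eq_one_iff_of_nonneg (norm_nonneg _) two_ne_zero).mp e
    -- As `ψ j` is real, the integrand is `ψ j ^ (2k+2)`, whose integral is known exactly.
    have hQ : inner ℂ p.toL2 (Dom.nl k p).toL2 = ((3 ^ (k * j) * q : ℝ) : ℂ) := by
      rw [← hpow j, Dom.inner_toL2, ← integral_complex_ofReal]
      refine integral_congr_ae (Filter.Eventually.of_forall fun x => ?_)
      have hx : p x = (ψ j x : ℂ) := rfl
      simp only [Dom.nl_apply, hx]
      rw [Complex.conj_ofReal, Complex.norm_real, pow_mul, Real.norm_eq_abs, sq_abs, ← pow_mul]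
      push_cast
      ring
    obtain ⟨u, w, γ₀, hγ₀, hsol, hu, hder⟩ := exists_curves (by positivity) hp hp1 h0.le hs hk hκ' hT
    have hnorm₀ : ‖toSobolev hs p‖ = (1 + c * 5 ^ j) ^ (s / 2) := by
      have e := congrArg norm (hp.sobolevMap_eq hs)
      rw [norm_smul, hp1, mul_one, Complex.norm_real,
        Real.norm_of_nonneg (Real.rpow_nonneg (by positivity) _)] at e
      exact e
    refine ⟨toSobolev hs p, toSobolev le_rfl p, u, w, γ₀, ?_, ?_, hγ₀, hsol, hu, ?_⟩
    · rw [toL2_toSobolev h0.le]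
      exact Dom.coeFn_toL2 p
    · rw [toL2_toSobolev zero_le_one]
      exact Dom.coeFn_toL2 p
    · have h3 := hder ⟨T, by constructor <;> linarith⟩ rfl
      rw [hQ, Complex.norm_real, Real.norm_of_nonneg (by positivity)] at h3
      rw [hnorm₀]
      exact (hJ j hj).trans_le h3
  have main' : ∀ T > 0, ∀ C : ℝ, ∃ (u₀ : Sobolev s) (w₀ : Sobolev 1)
      (u : ℝ → Curve s T) (w : ℝ → Curve 1 T), u₀.toL2 = w₀.toL2 ∧
      (∀ᶠ γ : ℝ in nhds 0, IsSolution k κ T (γ • u₀) (u γ) ∧ IsSolution k κ T (γ • w₀) (w γ) ∧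
        ∀ t, (u γ t).toL2 = (w γ t).toL2) ∧
      C * ‖u₀‖ ^ (2 * k + 1) < ‖iteratedDeriv (2 * k + 1) u 0‖ := by
    intro T hT C
    obtain ⟨J, hJ⟩ := main T hT C
    obtain ⟨u₀, w₀, u, w, γ₀, h1, h2, hγ₀, hsol, -, hlt⟩ := hJ (J + 2) (by lia) (by lia)
    refine ⟨u₀, w₀, u, w, Lp.ext (h1.trans h2.symm), ?_,
      hlt.trans_le (ContinuousMap.norm_coe_le_norm _ _)⟩
    refine Metric.eventually_nhds_iff.mpr ⟨γ₀, hγ₀, fun γ hγ => ?_⟩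
    rw [Real.dist_eq, sub_zero] at hγ
    obtain ⟨ha, hb, hc, -⟩ := hsol γ hγ
    exact ⟨ha, hb, hc⟩
  refine ⟨main, ?_, ?_⟩
  · rintro ⟨T, hT, r, hr, X, Φ, hX, hΦ⟩
    refine not_contDiffAt_of_unbounded (n := 2 * k + 1) (Φ := Φ) (fun C => ?_) hΦ
    obtain ⟨u₀, w₀, u, w, -, hsol, hlt⟩ := main' T hT C
    refine ⟨u₀, u, ?_, hlt⟩
    -- For small `γ` the data lie in the ball of radius `r`, and the constructed solution, being a
    -- curve in H¹, belongs to `X`; uniqueness in `X` identifies it with `Φ (γ • u₀)`.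
    filter_upwards [hsol, eventually_norm_smul_lt u₀ hr] with γ ⟨h1, _, h3⟩ h4
    obtain ⟨-, huniq, hmem⟩ := hX _ h4
    exact (huniq _ (hmem _ _ h3 h1) h1).symm
  · rintro ⟨T, hT, Φ, ⟨δ, hδ, hext⟩, hΦ⟩
    refine not_contDiffAt_of_unbounded (n := 2 * k + 1) (Φ := Φ) (fun C => ?_) hΦ
    obtain ⟨u₀, w₀, u, w, heq, hsol, hlt⟩ := main' T hT C
    refine ⟨u₀, u, ?_, hlt⟩
    -- The H¹ norm of `w₀` may be large, so the range of `γ` depends on the eigenfunction; this is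
    -- harmless because only the germ at `γ = 0` enters the derivative.
    filter_upwards [hsol, eventually_norm_smul_lt w₀ hδ] with γ ⟨_, h2, h3⟩ h4
    ext1 t
    apply Sobolev.toL2_injective h0.le
    rw [hext _ _ h4 h2 _ (by rw [Sobolev.toL2_smul h0.le, Sobolev.toL2_smul zero_le_one, heq]) t,
      h3]

end
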